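/- Let $d\ge 1$ and let $x_\alpha k^\alpha=x^0k^0-x^1k^1-\dots-x^{d-1}k^{d-1}$ be the Minkowski product on $\mathcal M=\mathbb R^d$. Let $\mu$ be a $\sigma$-finite Borel measure on momentum space $\mathbb R^d$, with Lebesgue decomposition $\mu=\mu'+\mu''$, where $d\mu'(k)=w(k)\,d^dk$ and $\mu''$ is singular with respect to Lebesgue measure; put $S=\{k: w(k)\ne 0\}$. Let $\Sigma$ be a countable set and, for $\sigma\in\Sigma$, let $R_\sigma\subset\mathbb R^d$ be a Borel set. Let $\mathcal H=\int^\oplus\mathcal H(k)\,d\mu(k)$ be the Hilbert space of the families $\psi=(\psi_\sigma)_{\sigma\in\Sigma}$ of wave functions $\psi_\sigma\in L^2(R_\sigma,\mu)$, extended by $0$ outside $R_\sigma$, with $\|\psi\|^2=\sum_\sigma\int|\psi_\sigma(k)|^2\,d\mu(k)<\infty$; thus $\mathcal H(k)$ is the space of the square-summable $c=(c_\sigma)_{\sigma\in\Sigma}$ with $c_\sigma=0$ if $k\notin R_\sigma$. Let $(\exp(ix_\alpha P^\alpha)\psi)_\sigma(k)=e^{ix_\alpha k^\alpha}\psi_\sigma(k)$.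 Let $\mathcal H'$ and $\mathcal H''$ be the closed subspaces of the $\psi$ whose wave functions vanish $\mu''$-almost everywhere, respectively $\mu'$-almost everywhere, and let $P'$ be the orthogonal projection onto $\mathcal H'$. A bounded translation covariant POV measure is a $\sigma$-additive (in the weak sense) map $\tau$ from the Borel sets of $\mathcal M$ to the bounded positive operators on $\mathcal H$ with $\tau(\mathcal M)\le 1$ and $$e^{-ix_\alpha P^\alpha}\,\tau(I+x)\,e^{ix_\alpha P^\alpha}=\tau(I)\qquad\text{for all Borel } I\subset\mathcal M \text{ and all } x\in\mathcal M .$$ For a countable set $\Gamma$ and measurable functions $K_{\gamma\sigma}:\mathbb R^d\to\mathbb C$ ($\gamma\in\Gamma$, $\sigma\in\Sigma$), call $K$ a contraction if, for almost every $k\in S$ and every $c\in\mathcal H(k)$, $$\sum_\gamma\Big|\sum_\sigma K_{\gamma\sigma}(k)c_\sigma\Big|^2\le\sum_\sigma|c_\sigma|^2 ,$$ where the series converge. Say that $\tau$ is given by $K$ if, for every $\psi\in\mathcal H$, the functions $\sum_\sigma K_{\gamma\sigma}\sqrt{w}\,\psi_\sigma$ belong to $L^2(\mathbb R^d,d^dk)$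 and, with their $L^2$ Fourier transforms $$\Psi_\gamma(x)=(2\pi)^{-d/2}\int\sum_\sigma K_{\gamma\sigma}(k)\,e^{-ix_\alpha k^\alpha}\sqrt{w(k)}\,\psi_\sigma(k)\,d^dk ,$$ the density $\rho(\psi,x)=\sum_\gamma|\Psi_\gamma(x)|^2$ converges for almost every $x$, is integrable, and satisfies $(\psi,\tau(I)\psi)=\int_I\rho(\psi,x)\,d^dx$ for every Borel set $I$. (If the wave functions are normalized so that $d\mu'=\mathbf 1_S\,d^dk$, the factor $\sqrt{w}$ can be omitted.) Then: 1. Every bounded translation covariant POV measure is given by some contraction $K$, with $\Gamma$ countable. 2. Conversely, every contraction $K$ gives some $\tau$, and every $\tau$ given by a contraction $K$ is a bounded translation covariant POV measure. For such $\tau$ and $K$, $\tau(\mathcal M)\ne 0$ if and only if it is not true that, for almost every $k\in S$, $K_{\gamma\sigma}(k)=0$ for all $\gamma$ and all $\sigma$ with $k\in R_\sigma$; and $\tau(\mathcal M)=P'$ if and only if $K(k)$ is isometric on $\mathcal H(k)$ for almost every $k\in S$, that is, $\sum_\gamma\overline{K_{\gamma\sigma}(k)}K_{\gamma\sigma'}(k)=\delta_{\sigma\sigma'}$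 for all $\sigma,\sigma'$ with $k\in R_\sigma\cap R_{\sigma'}$. 3. If $\tau$ is a bounded translation covariant POV measure, then $\tau(I)\psi=0$ for every Borel set $I$ and every $\psi\in\mathcal H''$. 4. $\mathcal H''$ contains the vacuum, i.e. every $\psi$ with $\exp(ix_\alpha P^\alpha)\psi=\psi$ for all $x$, and the one-particle states, i.e. every $\psi$ whose wave functions are, up to $\mu$-null sets, nonzero only at momenta $k$ with $k^0>0$ and $k_\alpha k^\alpha=m^2$ for some $m$ in a fixed countable set of masses. -/

import Mathlib

open MeasureTheory Filter
open scoped ENNReal FourierTransform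

noncomputable section

namespace CovariantPOV

/-! ### Minkowski space, momentum space and the Fourier transform -/

/-- `d`-dimensional space-time, and also the momentum space, with coordinates `x 0, …, x (d - 1)`.
The Euclidean structure serves only for the topology and the Lebesgue measure `volume`. -/
abbrev Spacetime (d : ℕ) : Type := EuclideanSpace ℝ (Fin d)

/-- Lowering of the index with the metric `diag(1, -1, …, -1)`. -/
def lower {d : ℕ} [NeZero d] (x : Spacetime d) : Spacetime d :=
  WithLp.toLp 2 (fun α => if α = 0 then x α else -x α)

/-- The Minkowski product `x_α k^α = x⁰ k⁰ - x¹ k¹ - … - x^(d-1) k^(d-1)`. -/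
def minkowski {d : ℕ} [NeZero d] (x k : Spacetime d) : ℝ := ∑ α, lower x α * k α

/-- `Ψ` is the Fourier transform, in the sense of `L²`, of the square integrable function `g`:
`Ψ(x) = (2π)^(-d/2) ∫ exp(-i x_α k^α) g(k) dk`.
Mathlib's `𝓕` on `L²` extends `ξ ↦ ∫ exp(-2πi ⟪k, ξ⟫) g(k) dk`; it is evaluated at the point
`ξ = (2π)⁻¹ (x_α)`, where `2π ⟪k, ξ⟫ = x_α k^α`. -/
def IsFourierOf {d : ℕ} [NeZero d] (Ψ g : Spacetime d → ℂ) : Prop :=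
  ∃ hg : MemLp g 2 volume,
    Ψ =ᵐ[volume] fun x =>
      (((2 * Real.pi) ^ (-(d : ℝ) / 2) : ℝ) : ℂ) *
        (𝓕 (hg.toLp g) : Lp ℂ 2 (volume : Measure (Spacetime d)))
          ((2 * Real.pi)⁻¹ • lower x)

/-! ### The Hilbert space of wave functions -/

/-- The direct integral `∫ H(k) dμ(k)` written in components: a vector is a family of wave
functions `ψ_σ ∈ L²(R_σ, μ)`, each defined in its own region `R σ` of momentum space, with
`‖ψ‖² = ∑_σ ∫_{R_σ} |ψ_σ(k)|² dμ(k)`. The fibre `H(k)` is the `ℓ²` space over the indices `σ` with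
`k ∈ R σ`. -/
abbrev WaveSpace {d : ℕ} {ι : Type*} (μ : Measure (Spacetime d)) (R : ι → Set (Spacetime d)) :
    Type _ :=
  lp (fun σ : ι => Lp ℂ 2 (μ.restrict (R σ))) 2

section

variable {d : ℕ} {ι : Type*} {μ : Measure (Spacetime d)} {R : ι → Set (Spacetime d)}

/-- The wave function `ψ_σ(k)`, which vanishes outside the region in which it is defined. -/
def wave (ψ : WaveSpace μ R) (σ : ι) (k : Spacetime d) : ℂ := (R σ).indicator (ψ σ) k

/-- The wave function rescaled by the square root of the density of the absolutely continuous part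
`μ'` of `μ`, so that `∫ |ψ_σ|² dμ' = ∫ |rescaled ψ σ k|² dk`. -/
def rescaled (ψ : WaveSpace μ R) (σ : ι) (k : Spacetime d) : ℂ :=
  (Real.sqrt (μ.rnDeriv volume k).toReal : ℂ) * wave ψ σ k

/-- The phase `exp(i x_α k^α)`. -/
def phase [NeZero d] (x k : Spacetime d) : ℂ := Complex.exp (Complex.I * (minkowski x k : ℂ))

lemma norm_phase [NeZero d] (x k : Spacetime d) : ‖phase x k‖ = 1 := by
  rw [phase, mul_comm, Complex.norm_exp_ofReal_mul_I]

lemma memLp_phase_mul [NeZero d] {ν : Measure (Spacetime d)} (x : Spacetime d) (f : Lp ℂ 2 ν) :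
    MemLp (fun k => phase x k * f k) 2 ν := by
  refine (Lp.memLp f).of_le (AEStronglyMeasurable.mul ?_ (Lp.aestronglyMeasurable f))
    (Eventually.of_forall fun k => by rw [norm_mul, norm_phase, one_mul])
  refine Continuous.aestronglyMeasurable ?_
  unfold phase minkowski
  fun_prop

/-- Multiplication by the phase `exp(i x_α k^α)` on `L²`. -/
def phaseMul [NeZero d] (ν : Measure (Spacetime d)) (x : Spacetime d) :
    Lp ℂ 2 ν →L[ℂ] Lp ℂ 2 ν :=
  LinearMap.mkContinuous
    { toFun := fun f => (memLp_phase_mul x f).toLp _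
      map_add' := fun f g => by
        ext1
        filter_upwards [(memLp_phase_mul x (f + g)).coeFn_toLp, (memLp_phase_mul x f).coeFn_toLp,
          (memLp_phase_mul x g).coeFn_toLp, Lp.coeFn_add f g,
          Lp.coeFn_add ((memLp_phase_mul x f).toLp _) ((memLp_phase_mul x g).toLp _)]
          with k h1 h2 h3 h4 h5
        rw [h1, h5, Pi.add_apply, h2, h3, h4, Pi.add_apply, mul_add]
      map_smul' := fun c f => by
        ext1
        filter_upwards [(memLp_phase_mul x (c • f)).coeFn_toLp, (memLp_phase_mul x f).coeFn_toLp,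
          Lp.coeFn_smul c f, Lp.coeFn_smul c ((memLp_phase_mul x f).toLp _)]
          with k h1 h2 h3 h4
        rw [h1, RingHom.id_apply, h4, Pi.smul_apply, h2, h3, Pi.smul_apply, smul_eq_mul,
          smul_eq_mul, mul_left_comm] }
    1 (fun f => by
      rw [one_mul]
      refine Lp.norm_le_norm_of_ae_le ?_
      filter_upwards [(memLp_phase_mul x f).coeFn_toLp] with k h
      simp only [LinearMap.coe_mk, AddHom.coe_mk]
      rw [h, norm_mul, norm_phase, one_mul])

lemma norm_phaseMul_le [NeZero d] (ν : Measure (Spacetime d)) (x : Spacetime d) :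
    ‖phaseMul ν x‖ ≤ 1 :=
  LinearMap.mkContinuous_norm_le _ zero_le_one _

variable (μ R) in
/-- The operator `exp(i x_α P^α)` which represents the translation by `x`:
`ψ_σ(k) ↦ exp(i x_α k^α) ψ_σ(k)`. -/
def translation [NeZero d] (x : Spacetime d) : WaveSpace μ R →L[ℂ] WaveSpace μ R :=
  lp.mapCLM 2 (fun σ => phaseMul (μ.restrict (R σ)) x) zero_le_one fun _ => norm_phaseMul_le _ x

/-- For `ν ≤ μ`, the closed subspace of the wave functions that vanish `ν`-almost everywhere. -/
def vanishing (ν : Measure (Spacetime d)) (hν : ν ≤ μ) : Submodule ℂ (WaveSpace μ R) where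
  carrier := {ψ | ∀ σ, ψ σ =ᵐ[ν.restrict (R σ)] 0}
  zero_mem' := fun σ => by
    have h := Lp.coeFn_zero ℂ 2 (μ.restrict (R σ))
    exact ae_mono (Measure.restrict_mono le_rfl hν) h
  add_mem' := fun {f g} hf hg σ => by
    have h := ae_mono (Measure.restrict_mono le_rfl hν) (Lp.coeFn_add (f σ) (g σ))
    filter_upwards [h, hf σ, hg σ] with k h1 h2 h3
    rw [lp.coeFn_add, Pi.add_apply, h1, Pi.add_apply, h2, h3]
    simp
  smul_mem' := fun c f hf σ => by
    have h := ae_mono (Measure.restrict_mono le_rfl hν) (Lp.coeFn_smul c (f σ))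
    filter_upwards [h, hf σ] with k h1 h2
    rw [lp.coeFn_smul, Pi.smul_apply, h1, Pi.smul_apply, h2]
    simp

lemma isClosed_vanishing (ν : Measure (Spacetime d)) (hν : ν ≤ μ) :
    IsClosed (vanishing (R := R) ν hν : Set (WaveSpace μ R)) := by
  have hset : (vanishing (R := R) ν hν : Set (WaveSpace μ R)) =
      ⋂ σ, (fun ψ : WaveSpace μ R => ψ σ) ⁻¹'
        {f : Lp ℂ 2 (μ.restrict (R σ)) | f =ᵐ[ν.restrict (R σ)] 0} := by
    ext ψ
    simp only [Set.mem_iInter, Set.mem_preimage, Set.mem_ofPred_eq]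
    rfl
  rw [hset]
  refine isClosed_iInter fun σ => IsClosed.preimage
    (lp.evalCLM ℂ (fun σ : ι => Lp ℂ 2 (μ.restrict (R σ))) 2 σ).continuous ?_
  have hle : ν.restrict (R σ) ≤ μ.restrict (R σ) := Measure.restrict_mono le_rfl hν
  refine isClosed_of_closure_subset fun f hf => ?_
  have hm : AEStronglyMeasurable f (ν.restrict (R σ)) := (Lp.aestronglyMeasurable f).mono_measure hle
  rw [Set.mem_ofPred_eq, ← eLpNorm_eq_zero_iff hm two_ne_zero]
  refine le_antisymm (le_of_forall_pos_le_add fun ε hε => ?_) zero_le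
  obtain ⟨g, hg, hfg⟩ := EMetric.mem_closure_iff.1 hf ε hε
  have h1 : (f : Spacetime d → ℂ) =ᵐ[ν.restrict (R σ)] (f : Spacetime d → ℂ) - g := by
    filter_upwards [show g =ᵐ[ν.restrict (R σ)] 0 from hg] with k hk
    simp [hk]
  rw [eLpNorm_congr_ae h1, zero_add]
  rw [Lp.edist_def] at hfg
  exact (eLpNorm_mono_measure _ hle).trans hfg.le

variable (μ R) in
/-- The subspace `H'` of the wave functions that vanish almost everywhere with respect to the
singular part `μ''` of `μ`. -/
def acSubspace : Submodule ℂ (WaveSpace μ R) :=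
  vanishing (μ.singularPart volume) (μ.singularPart_le volume)

instance : CompleteSpace (acSubspace μ R) :=
  (isClosed_vanishing (R := R) _ (μ.singularPart_le volume)).completeSpace_coe

variable (μ R) in
/-- The projection operator `P'` on the subspace `H'`. -/
def acProjection : WaveSpace μ R →L[ℂ] WaveSpace μ R := (acSubspace μ R).starProjection

variable (μ R) in
/-- The singular-spectrum subspace `H''` of the wave functions that vanish almost everywhere with
respect to the absolutely continuous part `μ'` of `μ`. -/
def singularSubspace : Submodule ℂ (WaveSpace μ R) :=
  vanishing (volume.withDensity (μ.rnDeriv volume)) (Measure.withDensity_rnDeriv_le μ volume)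

/-- A state of a single particle: the momentum lies on a mass shell `k_α k^α = m²`, `k⁰ > 0`, where
`m` is one of the particle masses. -/
def IsOneParticleState [NeZero d] (masses : Set ℝ) (ψ : WaveSpace μ R) : Prop :=
  ∀ σ, ∀ᵐ k ∂(μ.restrict (R σ)), ψ σ k ≠ 0 → 0 < k 0 ∧ ∃ m ∈ masses, minkowski k k = m ^ 2

/-! ### Positive-operator-valued measures -/

/-- `τ`, restricted to the Borel sets, is a positive-operator-valued measure on space-time. -/
structure IsPOV {H : Type*} [NormedAddCommGroup H] [InnerProductSpace ℂ H]
    (τ : Set (Spacetime d) → H →L[ℂ] H) : Prop where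
  nonneg : ∀ I, MeasurableSet I → 0 ≤ τ I
  hasSum : ∀ I : ℕ → Set (Spacetime d), (∀ n, MeasurableSet (I n)) →
    Pairwise (fun m n => Disjoint (I m) (I n)) → ∀ φ ψ : H,
      HasSum (fun n => inner ℂ φ (τ (I n) ψ)) (inner ℂ φ (τ (⋃ n, I n) ψ))

/-- Covariance under translations: `exp(-i x_α P^α) τ(I + x) exp(i x_α P^α) = τ(I)`. -/
def IsCovariant [NeZero d] (τ : Set (Spacetime d) → WaveSpace μ R →L[ℂ] WaveSpace μ R) : Prop :=
  ∀ I, MeasurableSet I → ∀ x,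
    translation μ R (-x) ∘L τ ((fun y => y + x) '' I) ∘L translation μ R x = τ I

/-! ### The kernels `K_{γσ}(k)` -/

section Kernel

variable {Γ : Type*}

variable (μ R) in
/-- `K(k) : H(k) → ℓ²(Γ)` is a contraction for almost all `k` in the support of `μ'`:
`∑_γ |∑_σ K_{γσ}(k) c_σ|² ≤ ∑_σ |c_σ|²` for all `c` in the fibre `H(k)`. -/
def IsContraction (K : Γ → ι → Spacetime d → ℂ) : Prop :=
  ∀ᵐ k ∂(volume : Measure (Spacetime d)), μ.rnDeriv volume k ≠ 0 →
    ∀ c : ι → ℂ, (∀ σ, k ∉ R σ → c σ = 0) → Summable (fun σ => ‖c σ‖ ^ 2) →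
      (∀ γ, Summable fun σ => K γ σ k * c σ) ∧
      (Summable fun γ => ‖∑' σ, K γ σ k * c σ‖ ^ 2) ∧
      ∑' γ, ‖∑' σ, K γ σ k * c σ‖ ^ 2 ≤ ∑' σ, ‖c σ‖ ^ 2

variable (μ R) in
/-- `K(k)` is isometric on `H(k)` for almost all `k` in the support of `μ'`:
`∑_γ conj K_{γσ}(k) K_{γσ'}(k) = δ_{σσ'}`. -/
def IsIsometric (K : Γ → ι → Spacetime d → ℂ) : Prop :=
  ∀ᵐ k ∂(volume : Measure (Spacetime d)), μ.rnDeriv volume k ≠ 0 →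
    ∀ σ σ', k ∈ R σ → k ∈ R σ' →
      HasSum (fun γ => star (K γ σ k) * K γ σ' k) (open Classical in if σ = σ' then 1 else 0)

variable (μ R) in
/-- `K(k)` vanishes on `H(k)` for almost all `k` in the support of `μ'`. -/
def IsNull (K : Γ → ι → Spacetime d → ℂ) : Prop :=
  ∀ᵐ k ∂(volume : Measure (Spacetime d)), μ.rnDeriv volume k ≠ 0 →
    ∀ γ σ, k ∈ R σ → K γ σ k = 0

/-- `Ψ_γ(x) = (2π)^(-d/2) ∫ ∑_σ K_{γσ}(k) exp(-i x_α k^α) ψ_σ(k) dk` for all `γ`. -/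
def IsAmplitude [NeZero d] (K : Γ → ι → Spacetime d → ℂ) (ψ : WaveSpace μ R)
    (Ψ : Γ → Spacetime d → ℂ) : Prop :=
  ∀ γ, IsFourierOf (Ψ γ) (fun k => ∑' σ, K γ σ k * rescaled ψ σ k)

/-- `(ψ, τ(I) ψ) = ∫_I ρ(ψ, x) dx` with the integrable density `ρ(ψ, x) = ∑_γ |Ψ_γ(x)|²`. -/
def HasDensity [NeZero d] (τ : Set (Spacetime d) → WaveSpace μ R →L[ℂ] WaveSpace μ R)
    (K : Γ → ι → Spacetime d → ℂ) : Prop :=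
  ∀ ψ : WaveSpace μ R, ∃ Ψ : Γ → Spacetime d → ℂ, IsAmplitude K ψ Ψ ∧
    (∀ᵐ x ∂(volume : Measure (Spacetime d)), Summable fun γ => ‖Ψ γ x‖ ^ 2) ∧
    Integrable (fun x => ∑' γ, ‖Ψ γ x‖ ^ 2) volume ∧
    ∀ I, MeasurableSet I →
      inner ℂ ψ (τ I ψ) = ((∫ x in I, ∑' γ, ‖Ψ γ x‖ ^ 2 : ℝ) : ℂ)

end Kernel

end

end CovariantPOV

end

/-!
# Translation covariant measures and matrix-valued contractions

A bounded covariant measure `τ` is the square of an operator which turns the phases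
`exp(i x_α k^α)` into translations. The argument builds this operator directly, without a dilation
theorem or the imprimitivity theorem.

*From the measure to amplitudes.* Smearing a vector with a continuous function of compact support
over the translations gives, by Jensen's inequality and the boundedness of `τ`, a vector `v` for
which `I ↦ ⟪v, τ(I) v⟫` has a bounded density with respect to the Lebesgue measure
(`quadForm_smear_le_volume`); such vectors are dense. By covariance, the density at the point `x` is
the density at the origin for the vector `U(-x) v`. The density at the origin is a positive
semidefinite form `localForm`. It is defined as a limit of mean values over small balls along an
ultrafilter, so that it exists for all vectors with bounded densities, and by differentiation of
measures it is the actual density at almost every point (`localForm_translate_ae_eq`). On a suitable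
dense subspace the form is separable, hence a sum of squares `∑ |ℓ_n(v)|²` of linear functionals
(`exists_functionals`), and `v ↦ (x ↦ ℓ_n(U(-x) v))` extends to an operator `V` with
`⟪v, τ(I) v⟫ = ∑_n ∫_I |(V v)_n|²` which intertwines the translations (`exists_amplitude_operator`).

*From amplitudes to the kernel.* The inverse Fourier transform `W` of `V` intertwines the phases.
For a fixed square-integrable `g > 0`, the matrix elements `⟪g, W_γ U(x) ψ⟫ = ⟪W_γ* g, U(x) ψ⟫` are
the Fourier transforms of `g (W_γ ψ) dk` and of `∑_σ conj (W_γ* g)_σ ψ_σ dμ`. So these complex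
measures agree, and `W_γ` is the multiplication by the matrix `K_{γσ} = √w conj (W_γ* g)_σ / g`,
which acts on `√w ψ_σ` (`exists_kernel`). The inequality `‖W ψ‖ ≤ ‖ψ‖` holds for the parts of `ψ`
with momenta in arbitrary Borel sets, hence pointwise, and `K(k)` is a contraction for almost every
`k` (`isContraction_of_operator`).

*From the kernel to the measure.* For a contraction-valued `K`, the amplitudes define an operator
`V` of norm at most one, and `τ` is given by `K` if and only if `⟪ψ, τ(I) ψ⟫` is the square norm of
`V ψ` on `I` (`hasDensity_iff`). The properties of `τ` can be read off from `V`. The cases in which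
`τ(univ)` vanishes or is the projection `P'` are decided by pointwise identities of local norms, which
are tested on wave packets with constant coefficients (`ae_hasSum_fibreAmp`).

*Singular spectrum.* The kernel acts on the rescaled wave functions, which vanish almost everywhere
for vectors in the singular-spectrum subspace. The vacuum is supported on `{0}` and a one-particle
state on countably many mass shells. These are null sets: the translates of a mass shell in the
direction of the energy are pairwise disjoint, and only countably many disjoint sets can have
positive measure.
-/

noncomputable section

open scoped Topology NNReal InnerProductSpace Pointwise

namespace CovariantPOV

/-! ### Positive operators and their quadratic forms -/

section Positive

variable {H : Type*} [NormedAddCommGroup H] [InnerProductSpace ℂ H]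

/-- The real quadratic form `v ↦ Re ⟪v, T v⟫` of an operator. -/
def quadForm (T : H →L[ℂ] H) (v : H) : ℝ := (inner ℂ v (T v)).re

variable {T : H →L[ℂ] H}

lemma quadForm_nonneg (hT : 0 ≤ T) (v : H) : 0 ≤ quadForm T v :=
  ((ContinuousLinearMap.nonneg_iff_isPositive T).1 hT).re_inner_nonneg_right v

lemma inner_comm_of_nonneg (hT : 0 ≤ T) (u v : H) : inner ℂ (T u) v = inner ℂ u (T v) :=
  ((ContinuousLinearMap.nonneg_iff_isPositive T).1 hT).inner_left_eq_inner_right u v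

lemma inner_eq_quadForm (hT : 0 ≤ T) (v : H) : inner ℂ v (T v) = (quadForm T v : ℂ) := by
  have h := inner_comm_of_nonneg hT v v
  rw [← inner_conj_symm] at h
  exact (Complex.conj_eq_iff_re.1 h).symm

lemma quadForm_add (hT : 0 ≤ T) (u v : H) :
    quadForm T (u + v) = quadForm T u + quadForm T v + 2 * (inner ℂ u (T v)).re := by
  have h : (inner ℂ v (T u)).re = (inner ℂ u (T v)).re := by
    rw [← inner_comm_of_nonneg hT, ← inner_conj_symm, Complex.conj_re]
  simp only [quadForm, map_add, inner_add_left, inner_add_right, Complex.add_re, h]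
  ring

lemma quadForm_smul (T : H →L[ℂ] H) (c : ℂ) (v : H) :
    quadForm T (c • v) = ‖c‖ ^ 2 * quadForm T v := by
  simp only [quadForm, map_smul, inner_smul_left, inner_smul_right, ← mul_assoc]
  rw [Complex.mul_conj, Complex.re_ofReal_mul, Complex.normSq_eq_norm_sq]

lemma quadForm_neg (T : H →L[ℂ] H) (v : H) : quadForm T (-v) = quadForm T v := by
  simp [quadForm]

lemma abs_re_inner_le (hT : 0 ≤ T) (u v : H) :
    |2 * (inner ℂ u (T v)).re| ≤ quadForm T u + quadForm T v := by
  have h1 := quadForm_nonneg hT (u + v)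
  have h2 := quadForm_nonneg hT (u + -v)
  rw [quadForm_add hT] at h1 h2
  rw [quadForm_neg, map_neg, inner_neg_right, Complex.neg_re] at h2
  rw [abs_le]; constructor <;> linarith

lemma quadForm_add_le (hT : 0 ≤ T) (u v : H) :
    quadForm T (u + v) ≤ 2 * (quadForm T u + quadForm T v) := by
  have := (abs_le.1 (abs_re_inner_le hT u v)).2
  rw [quadForm_add hT]; linarith

lemma norm_inner_le_quadForm (hT : 0 ≤ T) (u v : H) :
    ‖inner ℂ u (T v)‖ ≤ quadForm T u + quadForm T v := by
  have h1 := abs_re_inner_le hT u v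
  have h2 := abs_re_inner_le hT u ((-Complex.I) • v)
  rw [quadForm_smul, map_smul, inner_smul_right] at h2
  simp only [norm_neg, Complex.norm_I, one_pow, one_mul] at h2
  have h3 := Complex.norm_le_abs_re_add_abs_im (inner ℂ u (T v))
  have h4 : (-Complex.I * inner ℂ u (T v)).re = (inner ℂ u (T v)).im := by simp
  rw [h4] at h2
  rw [abs_mul, abs_two] at h1 h2
  linarith

/-- Cauchy-Schwarz for the form of `T`, linearised with a weight `a`. -/
lemma two_mul_re_inner_le (hT : 0 ≤ T) {a : ℝ} (ha : 0 < a) (u v : H) :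
    |2 * (inner ℂ u (T v)).re| ≤ a * quadForm T u + a⁻¹ * quadForm T v := by
  have h := abs_re_inner_le hT ((√a : ℂ) • u) (((√a)⁻¹ : ℂ) • v)
  have hs : 0 < √a := Real.sqrt_pos.2 ha
  have hs' : (√a : ℂ) ≠ 0 := by exact_mod_cast hs.ne'
  rw [quadForm_smul, quadForm_smul, map_smul, inner_smul_left, inner_smul_right,
    Complex.conj_ofReal, ← mul_assoc, mul_inv_cancel₀ hs', one_mul, norm_inv, inv_pow,
    Complex.norm_real, Real.norm_of_nonneg hs.le, Real.sq_sqrt ha.le] at h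
  exact h

lemma continuous_quadForm (T : H →L[ℂ] H) : Continuous (quadForm T) := by
  unfold quadForm; fun_prop

lemma eq_zero_of_quadForm_eq_zero (hT : 0 ≤ T) {v : H} (hv : quadForm T v = 0) : T v = 0 := by
  -- the bound with weight `a` at `u = T v` gives `2 ‖T v‖ ^ 2 ≤ a * quadForm T (T v)` for all `a > 0`
  by_contra hne
  have hpos : 0 < ‖T v‖ ^ 2 := by positivity
  have hq := quadForm_nonneg hT (T v)
  have h := two_mul_re_inner_le hT (a := ‖T v‖ ^ 2 / (quadForm T (T v) + 1)) (by positivity) (T v) v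
  rw [hv, mul_zero, add_zero, inner_self_eq_norm_sq_to_K] at h
  have h1 : (((‖T v‖ : ℂ)) ^ 2).re = ‖T v‖ ^ 2 := by norm_cast
  have h2 : ‖T v‖ ^ 2 / (quadForm T (T v) + 1) * quadForm T (T v) ≤ ‖T v‖ ^ 2 := by
    rw [div_mul_eq_mul_div, div_le_iff₀ (by positivity)]
    nlinarith
  erw [h1] at h
  rw [abs_of_pos (by positivity)] at h
  linarith

end Positive

/-! ### The scalar measures of a positive-operator-valued measure -/

section ScalarMeasure

variable {d : ℕ} {H : Type*} [NormedAddCommGroup H] [InnerProductSpace ℂ H]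
  {τ : Set (Spacetime d) → H →L[ℂ] H}

lemma IsPOV.hasSum_quadForm (hτ : IsPOV τ) {I : ℕ → Set (Spacetime d)}
    (hI : ∀ n, MeasurableSet (I n)) (hd : Pairwise (fun m n => Disjoint (I m) (I n))) (v : H) :
    HasSum (fun n => quadForm (τ (I n)) v) (quadForm (τ (⋃ n, I n)) v) :=
  Complex.hasSum_re (hτ.hasSum I hI hd v v)

lemma IsPOV.quadForm_empty (hτ : IsPOV τ) (v : H) : quadForm (τ ∅) v = 0 := by
  have h := hτ.hasSum_quadForm (I := fun _ => ∅) (fun _ => .empty) (fun _ _ _ => by simp) v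
  exact (summable_const_iff _).1 h.summable

/-- The measure `I ↦ ⟪v, τ I v⟫`, which is finite and on Borel sets has the stated values. -/
def povMeasure (hτ : IsPOV τ) (v : H) : Measure (Spacetime d) :=
  Measure.ofMeasurable (fun I _ => ENNReal.ofReal (quadForm (τ I) v))
    (by simp [hτ.quadForm_empty v]) (fun I hI hd => by
      rw [← (hτ.hasSum_quadForm hI hd v).tsum_eq,
        ENNReal.ofReal_tsum_of_nonneg (fun n => quadForm_nonneg (hτ.nonneg _ (hI n)) v)
          (hτ.hasSum_quadForm hI hd v).summable])

lemma povMeasure_apply (hτ : IsPOV τ) (v : H) {I : Set (Spacetime d)} (hI : MeasurableSet I) :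
    povMeasure hτ v I = ENNReal.ofReal (quadForm (τ I) v) :=
  Measure.ofMeasurable_apply I hI

instance (hτ : IsPOV τ) (v : H) : IsFiniteMeasure (povMeasure hτ v) :=
  ⟨by rw [povMeasure_apply hτ v .univ]; exact ENNReal.ofReal_lt_top⟩

lemma quadForm_le_norm_sq {T : H →L[ℂ] H} (hT : T ≤ 1) (v : H) : quadForm T v ≤ ‖v‖ ^ 2 := by
  have h := ((ContinuousLinearMap.le_def T 1).1 hT).re_inner_nonneg_right v
  have h2 : (inner ℂ v v).re = ‖v‖ ^ 2 := inner_self_eq_norm_sq (𝕜 := ℂ) v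
  simp only [quadForm, _root_.sub_apply, one_apply_eq_self, inner_sub_right, map_sub,
    RCLike.re_eq_complex_re] at h ⊢
  linarith

lemma povMeasure_univ_le (hτ : IsPOV τ) (h1 : τ Set.univ ≤ 1) (v : H) :
    povMeasure hτ v Set.univ ≤ ENNReal.ofReal (‖v‖ ^ 2) := by
  rw [povMeasure_apply hτ v .univ]
  exact ENNReal.ofReal_le_ofReal (quadForm_le_norm_sq h1 v)

end ScalarMeasure

/-! ### Smearing over translations -/

section Smear

variable {d : ℕ} {H : Type*} [NormedAddCommGroup H] [InnerProductSpace ℂ H]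

/-- `U` is a strongly continuous unitary representation of the translation group. Unitarity is
stated as conservation of the inner product; invertibility follows from the group law. -/
structure IsTranslationRep (U : Spacetime d → H →L[ℂ] H) : Prop where
  zero : U 0 = 1
  add : ∀ x y v, U (x + y) v = U x (U y v)
  inner_map : ∀ x u v, inner ℂ (U x u) (U x v) = inner ℂ u v
  cont : ∀ v, Continuous fun x => U x v

/-- Covariance of `τ`, as an identity between matrix elements. -/
def IsTranslationCovariant (U : Spacetime d → H →L[ℂ] H) (τ : Set (Spacetime d) → H →L[ℂ] H) :
    Prop :=
  ∀ I, MeasurableSet I → ∀ x u v,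
    inner ℂ (U x u) (τ ((fun y => y + x) '' I) (U x v)) = inner ℂ u (τ I v)

variable {U : Spacetime d → H →L[ℂ] H} {τ : Set (Spacetime d) → H →L[ℂ] H}

lemma quadForm_translate (hc : IsTranslationCovariant U τ) {I : Set (Spacetime d)}
    (hI : MeasurableSet I) (x : Spacetime d) (v : H) :
    quadForm (τ I) (U x v) = quadForm (τ ((fun y => y + x) ⁻¹' I)) v := by
  have h := hc ((fun y => y + x) ⁻¹' I) (measurable_add_const x hI) x v v
  rw [Set.image_preimage_eq _ (add_right_surjective x)] at h
  rw [quadForm, h, quadForm]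

/-- The vector `∫ g(z) U(z) v dz`. -/
def smear (U : Spacetime d → H →L[ℂ] H) (g : Spacetime d → ℝ) (v : H) : H :=
  ∫ z, (g z : ℂ) • U z v

lemma integrable_smear (hU : IsTranslationRep U) {g : Spacetime d → ℝ} (hg : Continuous g)
    (hgs : HasCompactSupport g) (v : H) : Integrable fun z => (g z : ℂ) • U z v := by
  refine Continuous.integrable_of_hasCompactSupport ?_ ?_
  · exact (Complex.continuous_ofReal.comp hg).smul (hU.cont v)
  · exact hgs.mono' (fun z hz => subset_tsupport _ (fun h => hz (by simp [h])))

variable [CompleteSpace H]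

omit [CompleteSpace H] in
lemma smear_sub (hU : IsTranslationRep U) {g h : Spacetime d → ℝ} (hg : Continuous g)
    (hgs : HasCompactSupport g) (hh : Continuous h) (hhs : HasCompactSupport h) (v : H) :
    smear U (g - h) v = smear U g v - smear U h v := by
  rw [smear, smear, smear, ← integral_sub (integrable_smear hU hg hgs v)
    (integrable_smear hU hh hhs v)]
  simp [sub_smul]

lemma translate_smear (hU : IsTranslationRep U) {g : Spacetime d → ℝ} (hg : Continuous g)
    (hgs : HasCompactSupport g) (x : Spacetime d) (v : H) :
    U x (smear U g v) = smear U (fun z => g (z - x)) v := by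
  rw [smear, ← ContinuousLinearMap.integral_comp_comm _ (integrable_smear hU hg hgs v), smear,
    ← integral_add_right_eq_self (fun z => ((g (z - x) : ℝ) : ℂ) • U z v) x]
  congr 1; ext z
  rw [map_smul, add_sub_cancel_right, add_comm z x, hU.add]

/-- Jensen's inequality for the quadratic form of a positive operator. -/
lemma quadForm_smear_le (hU : IsTranslationRep U) {T : H →L[ℂ] H} (hT : 0 ≤ T)
    {g : Spacetime d → ℝ} (hg : Continuous g) (hgs : HasCompactSupport g) (v : H) :
    quadForm T (smear U g v) ≤ (∫ z, |g z|) * ∫ z, |g z| * quadForm T (U z v) := by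
  have hint : Integrable fun z => |g z| := (hg.integrable_of_hasCompactSupport hgs).abs
  have hint2 : Integrable fun z => |g z| * quadForm T (U z v) :=
    (hg.abs.mul ((continuous_quadForm T).comp (hU.cont v))).integrable_of_hasCompactSupport
      (hgs.norm.mul_right)
  have hN0 : 0 ≤ ∫ z, |g z| := integral_nonneg fun z => abs_nonneg (g z)
  rcases hN0.eq_or_lt with h0 | hpos
  · have h1 : (fun z => |g z|) =ᵐ[volume] 0 :=
      (integral_eq_zero_iff_of_nonneg_ae (Eventually.of_forall fun z => abs_nonneg (g z)) hint).1
        h0.symm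
    have h2 : smear U g v = 0 := by
      rw [smear, integral_eq_zero_of_ae]
      filter_upwards [h1] with z hz
      have : g z = 0 := abs_eq_zero.1 hz
      simp [this]
    rw [h2, ← h0, zero_mul]; simp [quadForm]
  set N := ∫ z, |g z| with hN
  set s := smear U g v with hs
  have key : quadForm T s = ∫ z, g z * (inner ℂ s (T (U z v))).re := by
    have h1 : inner ℂ s (T s) = ∫ z, inner ℂ s (T ((g z : ℂ) • U z v)) := by
      have := ContinuousLinearMap.integral_comp_comm ((innerSL ℂ s) ∘L T)
        (integrable_smear hU hg hgs v)
      simp only [ContinuousLinearMap.comp_apply, innerSL_apply_apply] at this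
      rw [this]; rfl
    have hint3 : Integrable fun z => inner ℂ s (T ((g z : ℂ) • U z v)) :=
      ContinuousLinearMap.integrable_comp ((innerSL ℂ s) ∘L T) (integrable_smear hU hg hgs v)
    rw [quadForm, h1]
    have := integral_re hint3
    simp only [RCLike.re_eq_complex_re] at this
    rw [← this]
    congr 1; ext z
    rw [map_smul, inner_smul_right, Complex.re_ofReal_mul]
  have hb : ∀ z, g z * (inner ℂ s (T (U z v))).re ≤
      |g z| * (N⁻¹ * quadForm T s / 2) + N * (|g z| * quadForm T (U z v)) / 2 := by
    intro z
    have h := two_mul_re_inner_le hT (inv_pos.2 hpos) s (U z v)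
    rw [inv_inv, abs_mul, abs_two] at h
    calc _ ≤ |g z * (inner ℂ s (T (U z v))).re| := le_abs_self _
      _ = |g z| * |(inner ℂ s (T (U z v))).re| := abs_mul _ _
      _ ≤ |g z| * ((N⁻¹ * quadForm T s + N * quadForm T (U z v)) / 2) := by gcongr; linarith
      _ = _ := by ring
  have hint4 : Integrable fun z => g z * (inner ℂ s (T (U z v))).re := by
    refine (hg.mul (Complex.continuous_re.comp ?_)).integrable_of_hasCompactSupport (hgs.mul_right)
    exact continuous_const.inner (T.continuous.comp (hU.cont v))
  have hle := integral_mono hint4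
    ((hint.mul_const (N⁻¹ * quadForm T s / 2)).add ((hint2.const_mul N).div_const 2)) hb
  simp only [Pi.add_apply] at hle
  rw [← key, integral_add (hint.mul_const _) ((hint2.const_mul N).div_const 2),
    integral_mul_const, integral_div, integral_const_mul, ← hN] at hle
  have : N * (N⁻¹ * quadForm T s / 2) = quadForm T s / 2 := by field_simp
  rw [this] at hle
  linarith

omit [CompleteSpace H] in
/-- The average of the translates of `I ↦ ⟪v, τ I v⟫` with the weight `|g|` is bounded by a multiple
of the Lebesgue measure, since the average with constant weight is translation invariant. -/
lemma integral_quadForm_translate_le (hU : IsTranslationRep U) (hτ : IsPOV τ)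
    (h1 : τ Set.univ ≤ 1) (hc : IsTranslationCovariant U τ) {g : Spacetime d → ℝ}
    {M : ℝ} (hM : ∀ z, |g z| ≤ M) {I : Set (Spacetime d)} (hI : MeasurableSet I)
    (hIf : volume I ≠ ∞) (v : H) :
    ∫ z, |g z| * quadForm (τ I) (U z v) ≤ M * ‖v‖ ^ 2 * volume.real I := by
  have hM0 : 0 ≤ M := (abs_nonneg _).trans (hM 0)
  have hq : ∀ z, 0 ≤ quadForm (τ I) (U z v) := fun z => quadForm_nonneg (hτ.nonneg I hI) _
  have hmass : ∫⁻ z, ENNReal.ofReal (quadForm (τ I) (U z v)) ≤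
      ENNReal.ofReal (‖v‖ ^ 2) * volume I := by
    have h2 : ∀ z, ENNReal.ofReal (quadForm (τ I) (U z v)) =
        ∫⁻ y, I.indicator 1 (y + z) ∂(povMeasure hτ v) := by
      intro z
      rw [quadForm_translate hc hI, ← povMeasure_apply hτ v (measurable_add_const z hI),
        ← lintegral_indicator_one (measurable_add_const z hI)]
      rfl
    have hmeas : Measurable (I.indicator (1 : Spacetime d → ℝ≥0∞)) := measurable_one.indicator hI
    simp_rw [h2]
    rw [lintegral_lintegral_swap]
    · have h3 : ∀ y, ∫⁻ z, I.indicator (1 : Spacetime d → ℝ≥0∞) (y + z) = volume I := by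
        intro y
        rw [lintegral_add_left_eq_self (fun z => I.indicator (1 : Spacetime d → ℝ≥0∞) z) y,
          lintegral_indicator_one hI]
      simp_rw [h3]
      rw [lintegral_const, mul_comm]
      gcongr
      exact povMeasure_univ_le hτ h1 v
    · exact (hmeas.comp (measurable_snd.add measurable_fst)).aemeasurable
  have hfin : ENNReal.ofReal (‖v‖ ^ 2) * volume I ≠ ∞ := ENNReal.mul_ne_top ENNReal.ofReal_ne_top hIf
  have hcont : Continuous fun z => quadForm (τ I) (U z v) :=
    (continuous_quadForm _).comp (hU.cont v)
  have hint : Integrable fun z => quadForm (τ I) (U z v) := by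
    refine ⟨hcont.aestronglyMeasurable, ?_⟩
    rw [hasFiniteIntegral_iff_ofReal (Eventually.of_forall hq)]
    exact hmass.trans_lt hfin.lt_top
  calc ∫ z, |g z| * quadForm (τ I) (U z v) ≤ ∫ z, M * quadForm (τ I) (U z v) := by
        refine integral_mono_of_nonneg (Eventually.of_forall fun z => mul_nonneg (abs_nonneg _) (hq z))
          (hint.const_mul M) (Eventually.of_forall fun z => ?_)
        exact mul_le_mul_of_nonneg_right (hM z) (hq z)
    _ = M * (∫⁻ z, ENNReal.ofReal (quadForm (τ I) (U z v))).toReal := by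
        rw [integral_const_mul, integral_eq_lintegral_of_nonneg_ae (Eventually.of_forall hq)
          hcont.aestronglyMeasurable]
    _ ≤ M * (ENNReal.ofReal (‖v‖ ^ 2) * volume I).toReal := by
        gcongr
    _ = M * ‖v‖ ^ 2 * volume.real I := by
        rw [ENNReal.toReal_mul, ENNReal.toReal_ofReal (by positivity), mul_assoc]; rfl

/-- Smeared vectors have bounded densities. -/
lemma quadForm_smear_le_volume (hU : IsTranslationRep U) (hτ : IsPOV τ)
    (h1 : τ Set.univ ≤ 1) (hc : IsTranslationCovariant U τ) {g : Spacetime d → ℝ}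
    (hg : Continuous g) (hgs : HasCompactSupport g) {M : ℝ} (hM : ∀ z, |g z| ≤ M)
    {I : Set (Spacetime d)} (hI : MeasurableSet I) (hIf : volume I ≠ ∞) (v : H) :
    quadForm (τ I) (smear U g v) ≤ (∫ z, |g z|) * (M * ‖v‖ ^ 2) * volume.real I := by
  refine (quadForm_smear_le hU (hτ.nonneg I hI) hg hgs v).trans ?_
  rw [mul_assoc]
  exact mul_le_mul_of_nonneg_left (integral_quadForm_translate_le hU hτ h1 hc hM hI hIf v)
    (integral_nonneg fun z => abs_nonneg _)

/-- A smeared vector depends continuously on the translation, uniformly with respect to the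
densities of the measures `I ↦ ⟪v, τ I v⟫`. -/
lemma exists_quadForm_translate_sub_le (hU : IsTranslationRep U) (hτ : IsPOV τ)
    (h1 : τ Set.univ ≤ 1) (hc : IsTranslationCovariant U τ) {g : Spacetime d → ℝ}
    (hg : Continuous g) (hgs : HasCompactSupport g) (v : H) (x : Spacetime d) :
    ∃ C : Spacetime d → ℝ, Tendsto C (𝓝 x) (𝓝 0) ∧ ∀ y I, MeasurableSet I → volume I ≠ ∞ →
      quadForm (τ I) (U y (smear U g v) - U x (smear U g v)) ≤ C y * volume.real I := by
  obtain ⟨M, hM⟩ := hg.bounded_above_of_compact_support hgs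
  have hts : ∀ x, Continuous (fun z => g (z - x)) ∧ HasCompactSupport (fun z => g (z - x)) :=
    fun x => ⟨hg.comp (continuous_sub_right x), hgs.comp_homeomorph (Homeomorph.subRight x)⟩
  refine ⟨fun y => (∫ z, |g (z - y) - g (z - x)|) * (2 * M * ‖v‖ ^ 2), ?_, fun y I hI hIf => ?_⟩
  · have hlim : Tendsto (fun y => ∫ z, |g (z - y) - g (z - x)|) (𝓝 x) (𝓝 0) := by
      -- for `y` near `x` all these functions live on one compact set
      set S : Set (Spacetime d) := Metric.closedBall x 1 + tsupport g with hS
      have hSc : IsCompact S := (isCompact_closedBall x 1).add hgs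
      have hzero : ∀ y ∈ Metric.closedBall x 1, ∀ z, z ∉ S → g (z - y) = 0 := by
        intro y hy z hz
        by_contra hne
        exact hz ⟨y, hy, z - y, subset_tsupport _ hne, by simp⟩
      have hcont : Continuous fun y => ∫ z in S, |g (z - y) - g (z - x)| := by
        refine continuous_parametric_integral_of_continuous ?_ hSc
        simp only [Function.uncurry_def]
        fun_prop
      have h3 := hcont.tendsto x
      simp only [sub_self, abs_zero, integral_zero] at h3
      refine h3.congr' ?_
      filter_upwards [Metric.closedBall_mem_nhds x one_pos] with y hy
      refine setIntegral_eq_integral_of_forall_compl_eq_zero fun z hz => ?_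
      rw [hzero y hy z hz, hzero x (Metric.mem_closedBall_self zero_le_one) z hz]; simp
    simpa using hlim.mul_const (2 * M * ‖v‖ ^ 2)
  · rw [translate_smear hU hg hgs, translate_smear hU hg hgs,
      ← smear_sub hU (hts y).1 (hts y).2 (hts x).1 (hts x).2]
    refine quadForm_smear_le_volume hU hτ h1 hc ((hts y).1.sub (hts x).1)
      ((hts y).2.sub (hts x).2) (fun z => ?_) hI hIf v
    have ha := hM (z - y)
    have hb := hM (z - x)
    rw [Real.norm_eq_abs] at ha hb
    exact (abs_sub _ _).trans (by linarith)

variable (d) in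
/-- A bump function supported in the ball of radius `1 / (n + 1)`. -/
def bump (n : ℕ) : ContDiffBump (0 : Spacetime d) where
  rIn := 1 / (2 * (n + 1))
  rOut := 1 / (n + 1)
  rIn_pos := by positivity
  rIn_lt_rOut := by
    have : (0 : ℝ) < n + 1 := by positivity
    exact one_div_lt_one_div_of_lt this (by linarith)

/-- Smeared vectors approximate every vector. -/
lemma exists_dist_smear_le (hU : IsTranslationRep U) (v : H) {ε : ℝ} (hε : 0 < ε) :
    ∃ n : ℕ, dist (smear U ((bump d n).normed volume) v) v ≤ ε := by
  obtain ⟨δ, hδ, hball⟩ := Metric.continuous_iff.1 ((hU.cont v).comp continuous_neg) 0 ε hε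
  obtain ⟨n, hn⟩ := exists_nat_one_div_lt hδ
  refine ⟨n, ?_⟩
  have h := (bump d n).dist_normed_convolution_le (μ := volume) (g := fun x => U (-x) v)
    (x₀ := 0) (ε := ε) ((hU.cont v).comp continuous_neg).aestronglyMeasurable
    (fun x hx => (hball x (lt_trans hx hn)).le)
  have h0 : U (-0) v = v := by simp [hU.zero]
  have h1 : smear U ((bump d n).normed volume) v =
      convolution ((bump d n).normed volume) (fun x => U (-x) v) (ContinuousLinearMap.lsmul ℝ ℝ)
        volume 0 := by
    rw [convolution_def, smear]
    congr 1; ext z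
    simp
  rw [h0] at h
  rwa [h1]

end Smear

/-! ### Square-summable families of square-integrable functions -/

section Amplitudes

lemma norm_sq_Lp {X : Type*} [MeasurableSpace X] {ν : Measure X} (f : Lp ℂ 2 ν) :
    ‖f‖ ^ 2 = ∫ x, ‖f x‖ ^ 2 ∂ν := by
  have h : (inner ℂ f f : ℂ) = ((∫ x, ‖f x‖ ^ 2 ∂ν : ℝ) : ℂ) := by
    rw [L2.inner_def, ← integral_complex_ofReal]
    congr 1; ext x
    rw [inner_self_eq_norm_sq_to_K]; simp
  have h2 : (inner ℂ f f : ℂ).re = ‖f‖ ^ 2 := inner_self_eq_norm_sq (𝕜 := ℂ) f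
  rw [← h2, h, Complex.ofReal_re]

section lpTwo

variable {Γ : Type*} {G : Γ → Type*} [∀ i, NormedAddCommGroup (G i)]

lemma memℓp_two_iff {f : ∀ i, G i} : Memℓp f 2 ↔ Summable fun i => ‖f i‖ ^ 2 := by
  rw [memℓp_gen_iff (by simp)]
  simp

lemma hasSum_norm_sq_lp (f : lp G 2) : HasSum (fun i => ‖f i‖ ^ 2) (‖f‖ ^ 2) := by
  simpa using lp.hasSum_norm (by simp) f

end lpTwo

variable {d : ℕ}

variable (d) in
/-- The Hilbert space of square-summable families of square-integrable functions on
`d`-dimensional space, which is the range of the amplitudes. -/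
abbrev AmpSpace (Γ : Type*) : Type _ :=
  lp (fun _ : Γ => Lp ℂ 2 (volume : Measure (Spacetime d))) 2

lemma norm_LpToLpRestrictCLM_le (I : Set (Spacetime d)) :
    ‖LpToLpRestrictCLM (Spacetime d) ℂ ℂ volume 2 I‖ ≤ 1 :=
  LinearMap.mkContinuous_norm_le _ zero_le_one _

/-- Restriction of all amplitudes to a subset of space-time. -/
def ampRestrict (Γ : Type*) (I : Set (Spacetime d)) :
    AmpSpace d Γ →L[ℂ] lp (fun _ : Γ => Lp ℂ 2 ((volume : Measure (Spacetime d)).restrict I)) 2 :=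
  lp.mapCLM 2 (fun _ => LpToLpRestrictCLM (Spacetime d) ℂ ℂ volume 2 I) zero_le_one
    fun _ => norm_LpToLpRestrictCLM_le I

lemma hasSum_ampRestrict {Γ : Type*} (I : Set (Spacetime d)) (f : AmpSpace d Γ) :
    HasSum (fun γ => ∫ x in I, ‖f γ x‖ ^ 2) (‖ampRestrict Γ I f‖ ^ 2) := by
  have h := hasSum_norm_sq_lp (ampRestrict Γ I f)
  convert h using 1
  ext γ
  rw [norm_sq_Lp]
  refine integral_congr_ae ?_
  filter_upwards [LpToLpRestrictCLM_coeFn ℂ I (f γ)] with x hx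
  have : (ampRestrict Γ I f) γ = LpToLpRestrictCLM (Spacetime d) ℂ ℂ volume 2 I (f γ) := rfl
  rw [this, hx]

lemma norm_ampRestrict_univ {Γ : Type*} (f : AmpSpace d Γ) :
    ‖ampRestrict Γ Set.univ f‖ ^ 2 = ‖f‖ ^ 2 := by
  refine (hasSum_ampRestrict Set.univ f).unique ?_
  convert hasSum_norm_sq_lp f using 2 with γ
  rw [norm_sq_Lp, setIntegral_univ]

/-- If the squares of the functions `g γ` sum to an integrable function, the sum can be integrated
term by term. -/
lemma hasSum_setIntegral_norm_sq {X : Type*} [MeasurableSpace X] {ν : Measure X} {Γ : Type*}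
    [Countable Γ] {g : Γ → X → ℂ} (hg : ∀ γ, AEStronglyMeasurable (g γ) ν) {Q : X → ℝ}
    (hQ : Integrable Q ν) (hsum : ∀ᵐ x ∂ν, HasSum (fun γ => ‖g γ x‖ ^ 2) (Q x)) (I : Set X) :
    HasSum (fun γ => ∫ x in I, ‖g γ x‖ ^ 2 ∂ν) (∫ x in I, Q x ∂ν) := by
  have hsum' := ae_restrict_of_ae (s := I) hsum
  refine hasSum_integral_of_dominated_convergence (fun γ x => ‖g γ x‖ ^ 2)
    (fun γ => ((hg γ).norm.pow 2).restrict) (fun γ => Eventually.of_forall fun x => ?_) ?_ ?_ hsum'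
  · rw [Real.norm_of_nonneg (by positivity)]
  · filter_upwards [hsum'] with x hx using hx.summable
  · refine hQ.restrict.congr ?_
    filter_upwards [hsum'] with x hx using hx.tsum_eq.symm

lemma memLp_two_of_hasSum {X : Type*} [MeasurableSpace X] {ν : Measure X} {Γ : Type*}
    {g : Γ → X → ℂ} (hg : ∀ γ, AEStronglyMeasurable (g γ) ν) {Q : X → ℝ}
    (hQ : Integrable Q ν) (hsum : ∀ᵐ x ∂ν, HasSum (fun γ => ‖g γ x‖ ^ 2) (Q x)) (γ : Γ) :
    MemLp (g γ) 2 ν := by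
  rw [memLp_two_iff_integrable_sq_norm (hg γ)]
  refine hQ.mono' ((hg γ).norm.pow 2) ?_
  filter_upwards [hsum] with x hx
  rw [Real.norm_of_nonneg (by positivity)]
  exact le_hasSum hx γ fun _ _ => by positivity

lemma norm_sq_toLp {X : Type*} [MeasurableSpace X] {ν : Measure X} {g : X → ℂ}
    (hg : MemLp g 2 ν) : ‖hg.toLp g‖ ^ 2 = ∫ x, ‖g x‖ ^ 2 ∂ν := by
  rw [norm_sq_Lp]
  refine integral_congr_ae ?_
  filter_upwards [hg.coeFn_toLp] with x hx
  rw [hx]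

/-- The linear map into the square-summable families that is given by representatives of the
components. -/
def familyMap {D : Type*} [AddCommGroup D] [Module ℂ D] {X : Type*} [MeasurableSpace X]
    {ν : Measure X} {Γ : Type*} (f : D → Γ → X → ℂ) (hmem : ∀ v γ, MemLp (f v γ) 2 ν)
    (hadd : ∀ v w γ, f (v + w) γ =ᵐ[ν] f v γ + f w γ)
    (hsmul : ∀ (c : ℂ) v γ, f (c • v) γ =ᵐ[ν] c • f v γ)
    (hsum : ∀ v, Summable fun γ => ‖(hmem v γ).toLp‖ ^ 2) :
    D →ₗ[ℂ] lp (fun _ : Γ => Lp ℂ 2 ν) 2 where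
  toFun v := ⟨fun γ => (hmem v γ).toLp, memℓp_two_iff.2 (hsum v)⟩
  map_add' v w := by
    refine lp.ext (funext fun γ => ?_)
    change (hmem (v + w) γ).toLp = (hmem v γ).toLp + (hmem w γ).toLp
    exact ((MemLp.toLp_eq_toLp_iff (hmem (v + w) γ) ((hmem v γ).add (hmem w γ))).2
      (hadd v w γ)).trans (MemLp.toLp_add (hmem v γ) (hmem w γ))
  map_smul' c v := by
    refine lp.ext (funext fun γ => ?_)
    change (hmem (c • v) γ).toLp = c • (hmem v γ).toLp
    exact ((MemLp.toLp_eq_toLp_iff (hmem (c • v) γ) ((hmem v γ).const_smul c)).2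
      (hsmul c v γ)).trans (MemLp.toLp_const_smul c (hmem v γ))

end Amplitudes

/-! ### Coordinates for a separable positive semidefinite form -/

lemma Orthonormal.countable_of_separable {K : Type*} [NormedAddCommGroup K] [InnerProductSpace ℂ K]
    [TopologicalSpace.SeparableSpace K] {κ : Type*} {b : κ → K} (hb : Orthonormal ℂ b) :
    Countable κ := by
  refine Pairwise.countable_of_isOpen_disjoint (s := fun i => Metric.ball (b i) (1 / 2)) ?_
    (fun _ => Metric.isOpen_ball) (fun i => ⟨b i, Metric.mem_ball_self (by norm_num)⟩)
  intro i j hij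
  refine Metric.ball_disjoint_ball ?_
  have h : ‖b i - b j‖ ^ 2 = 2 := by
    rw [@norm_sub_sq ℂ, hb.1, hb.1, hb.2 hij]; norm_num
  rw [dist_eq_norm]
  nlinarith [norm_nonneg (b i - b j)]

/-- A positive semidefinite form on `D` is the square sum of countably many linear functionals, if
`D` is spanned by countably many families that depend continuously on a parameter in a separable
space. -/
theorem exists_functionals {D : Type*} [AddCommGroup D] [Module ℂ D]
    (c : PreInnerProductSpace.Core ℂ D) {J X : Type*} [Countable J] [TopologicalSpace X]
    [TopologicalSpace.SeparableSpace X] (v : J → X → D)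
    (hv : ∀ j x, Tendsto (fun y => (c.inner (v j y - v j x) (v j y - v j x)).re) (𝓝 x) (𝓝 0))
    (hspan : Submodule.span ℂ (Set.range fun p : J × X => v p.1 p.2) = ⊤) :
    ∃ ℓ : ℕ → D →ₗ[ℂ] ℂ, (∀ ψ, HasSum (fun n => ‖ℓ n ψ‖ ^ 2) (c.inner ψ ψ).re) ∧
      ∀ n j, Continuous fun x => ℓ n (v j x) := by
  let _ : SeminormedAddCommGroup D := InnerProductSpace.Core.toSeminormedAddCommGroup (𝕜 := ℂ)
  let _ : InnerProductSpace ℂ D := InnerProductSpace.ofCore c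
  have hinner : ∀ ψ : D, (c.inner ψ ψ).re = ‖ψ‖ ^ 2 := fun ψ =>
    inner_self_eq_norm_sq (𝕜 := ℂ) ψ
  have hcont : ∀ j, Continuous (v j) := by
    intro j
    refine continuous_iff_continuousAt.2 fun x => ?_
    rw [ContinuousAt, tendsto_iff_norm_sub_tendsto_zero]
    have h := (Real.continuous_sqrt.tendsto 0).comp (hv j x)
    rw [Real.sqrt_zero] at h
    refine h.congr fun y => ?_
    rw [Function.comp_apply, hinner, Real.sqrt_sq (norm_nonneg _)]
  have hsep : TopologicalSpace.IsSeparable (Set.range fun p : J × X => v p.1 p.2) := by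
    have : (Set.range fun p : J × X => v p.1 p.2) = ⋃ j, Set.range (v j) := by
      ext; simp
    rw [this]
    exact TopologicalSpace.IsSeparable.iUnion fun j => TopologicalSpace.isSeparable_range (hcont j)
  have : TopologicalSpace.SeparableSpace D := by
    have h := hsep.span (R := ℂ)
    rw [hspan] at h
    exact TopologicalSpace.isSeparable_univ_iff.1 h
  obtain ⟨w, b, -⟩ := exists_hilbertBasis ℂ (UniformSpace.Completion D)
  have : Countable w := Orthonormal.countable_of_separable b.orthonormal
  obtain ⟨e, he⟩ := exists_injective_nat w
  let L : w → D →L[ℂ] ℂ := fun i => (innerSL ℂ (b i)) ∘L (UniformSpace.Completion.toComplL (𝕜 := ℂ))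
  have hL : ∀ i ψ, L i ψ = inner ℂ (b i) (ψ : UniformSpace.Completion D) := fun i ψ => rfl
  classical
  have hz : ∀ n, n ∉ Set.range e → Function.extend e L 0 n = 0 := fun n hn =>
    Function.extend_apply' _ _ _ (by simpa using hn)
  refine ⟨fun n => (Function.extend e L 0 n : D →L[ℂ] ℂ), fun ψ => ?_, fun n j => ?_⟩
  · rw [hinner, ← he.hasSum_iff (fun n hn => by simp [hz n hn])]
    have h := Complex.hasSum_re (b.hasSum_inner_mul_inner (ψ : UniformSpace.Completion D) ψ)
    have h2 : (inner ℂ (ψ : UniformSpace.Completion D) (ψ : UniformSpace.Completion D)).re =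
        ‖ψ‖ ^ 2 := by
      rw [← UniformSpace.Completion.norm_coe ψ]
      exact inner_self_eq_norm_sq (𝕜 := ℂ) (ψ : UniformSpace.Completion D)
    rw [h2] at h
    convert h using 1
    ext i
    rw [Function.comp_apply]
    simp only [he.extend_apply]
    change ‖L i ψ‖ ^ 2 = _
    rw [hL, ← inner_conj_symm, RCLike.norm_conj, Complex.mul_conj, Complex.ofReal_re,
      Complex.normSq_eq_norm_sq]
  · exact (Function.extend e L 0 n).continuous.comp (hcont j)

/-! ### The density of a covariant measure at the origin -/

section LocalForm

variable {d : ℕ} {H : Type*} [NormedAddCommGroup H] [InnerProductSpace ℂ H]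

/-- The measure `I ↦ ⟪v, τ I v⟫` has a bounded density with respect to the Lebesgue measure. -/
def HasBoundedDensity (τ : Set (Spacetime d) → H →L[ℂ] H) (v : H) : Prop :=
  ∃ C : ℝ, ∀ I, MeasurableSet I → volume I ≠ ∞ → quadForm (τ I) v ≤ C * volume.real I

/-- Shrinking balls around the origin. -/
def probe (d n : ℕ) : Set (Spacetime d) := Metric.closedBall 0 (1 / (n + 1))

lemma measurableSet_probe (n : ℕ) : MeasurableSet (probe d n) := Metric.isClosed_closedBall.measurableSet

lemma volume_probe_ne_top (n : ℕ) : volume (probe d n) ≠ ∞ :=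
  (isCompact_closedBall _ _).measure_lt_top.ne

lemma volume_real_probe_pos (n : ℕ) : 0 < volume.real (probe d n) := by
  refine ENNReal.toReal_pos ?_ (volume_probe_ne_top n)
  exact (Metric.measure_closedBall_pos volume 0 (by positivity)).ne'

/-- The mean value of `I ↦ ⟪u, τ I v⟫` over a small ball around the origin. -/
def meanForm (τ : Set (Spacetime d) → H →L[ℂ] H) (n : ℕ) (u v : H) : ℂ :=
  ((volume.real (probe d n))⁻¹ : ℂ) * inner ℂ u (τ (probe d n) v)

/-- The density at the origin of `I ↦ ⟪u, τ I v⟫`, as a limit along an ultrafilter. The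
ultrafilter makes it a sesquilinear form on all vectors with bounded densities, although the mean
values need not converge in the ordinary sense. -/
def localForm (τ : Set (Spacetime d) → H →L[ℂ] H) (u v : H) : ℂ :=
  limUnder (hyperfilter ℕ : Filter ℕ) fun n => meanForm τ n u v

variable {τ : Set (Spacetime d) → H →L[ℂ] H}

lemma meanForm_self (hτ : IsPOV τ) (n : ℕ) (v : H) :
    meanForm τ n v v = (((volume.real (probe d n))⁻¹ * quadForm (τ (probe d n)) v : ℝ) : ℂ) := by
  rw [meanForm, inner_eq_quadForm (hτ.nonneg _ (measurableSet_probe n))]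
  push_cast; rfl

lemma tendsto_localForm (hτ : IsPOV τ) {u v : H} (hu : HasBoundedDensity τ u)
    (hv : HasBoundedDensity τ v) :
    Tendsto (fun n => meanForm τ n u v) (hyperfilter ℕ : Filter ℕ) (𝓝 (localForm τ u v)) := by
  obtain ⟨C, hC⟩ := hu
  obtain ⟨C', hC'⟩ := hv
  have hb : ∀ n, meanForm τ n u v ∈ Metric.closedBall (0 : ℂ) (C + C') := by
    intro n
    have hpos := volume_real_probe_pos (d := d) n
    rw [mem_closedBall_zero_iff, meanForm, norm_mul, norm_inv, Complex.norm_real,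
      Real.norm_of_nonneg hpos.le, inv_mul_le_iff₀ hpos]
    have h := norm_inner_le_quadForm (hτ.nonneg _ (measurableSet_probe n)) u v
    have h1 := hC _ (measurableSet_probe n) (volume_probe_ne_top n)
    have h2 := hC' _ (measurableSet_probe n) (volume_probe_ne_top n)
    linarith
  obtain ⟨a, -, ha⟩ := (isCompact_closedBall (0 : ℂ) (C + C')).ultrafilter_le_nhds
    ((hyperfilter ℕ).map fun n => meanForm τ n u v)
    (by
      rw [Ultrafilter.coe_map, le_principal_iff]
      exact mem_map.2 (Eventually.of_forall hb))
  exact tendsto_nhds_limUnder ⟨a, ha⟩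

lemma HasBoundedDensity.add (hτ : IsPOV τ) {u v : H} (hu : HasBoundedDensity τ u)
    (hv : HasBoundedDensity τ v) : HasBoundedDensity τ (u + v) := by
  obtain ⟨C, hC⟩ := hu
  obtain ⟨C', hC'⟩ := hv
  refine ⟨2 * (C + C'), fun I hI hIf => ?_⟩
  have := quadForm_add_le (hτ.nonneg I hI) u v
  have h1 := hC I hI hIf
  have h2 := hC' I hI hIf
  linarith

lemma HasBoundedDensity.smul {v : H} (hv : HasBoundedDensity τ v) (c : ℂ) :
    HasBoundedDensity τ (c • v) := by
  obtain ⟨C, hC⟩ := hv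
  refine ⟨‖c‖ ^ 2 * C, fun I hI hIf => ?_⟩
  rw [quadForm_smul, mul_assoc]
  exact mul_le_mul_of_nonneg_left (hC I hI hIf) (by positivity)

lemma re_localForm_self_le (hτ : IsPOV τ) {v : H} {C : ℝ} (hC : ∀ I, MeasurableSet I →
    volume I ≠ ∞ → quadForm (τ I) v ≤ C * volume.real I) : (localForm τ v v).re ≤ C := by
  refine le_of_tendsto (Complex.continuous_re.continuousAt.tendsto.comp
    (tendsto_localForm hτ ⟨C, hC⟩ ⟨C, hC⟩)) (Eventually.of_forall fun n => ?_)
  rw [Function.comp_apply, meanForm_self hτ, Complex.ofReal_re,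
    inv_mul_le_iff₀ (volume_real_probe_pos n), mul_comm]
  exact hC _ (measurableSet_probe n) (volume_probe_ne_top n)

lemma re_localForm_self_nonneg (hτ : IsPOV τ) {v : H} (hv : HasBoundedDensity τ v) :
    0 ≤ (localForm τ v v).re := by
  refine ge_of_tendsto (Complex.continuous_re.continuousAt.tendsto.comp
    (tendsto_localForm hτ hv hv)) (Eventually.of_forall fun n => ?_)
  rw [Function.comp_apply, meanForm_self hτ, Complex.ofReal_re]
  exact mul_nonneg (inv_nonneg.2 (volume_real_probe_pos n).le)
    (quadForm_nonneg (hτ.nonneg _ (measurableSet_probe n)) v)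

/-- The density at the origin is a positive semidefinite form. -/
@[reducible] def localCore (hτ : IsPOV τ) (D : Submodule ℂ H) (hD : ∀ v ∈ D, HasBoundedDensity τ v) :
    PreInnerProductSpace.Core ℂ D where
  inner u v := localForm τ u v
  conj_inner_symm u v := by
    have h := (Complex.continuous_conj.continuousAt.tendsto.comp
      (tendsto_localForm hτ (hD v v.2) (hD u u.2)))
    refine tendsto_nhds_unique (h.congr fun n => ?_) (tendsto_localForm hτ (hD u u.2) (hD v v.2))
    rw [Function.comp_apply, meanForm, map_mul, inner_conj_symm,
      inner_comm_of_nonneg (hτ.nonneg _ (measurableSet_probe n)), meanForm, map_inv₀,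
      Complex.conj_ofReal]
  re_inner_nonneg v := re_localForm_self_nonneg hτ (hD v v.2)
  add_left u v w := by
    refine tendsto_nhds_unique (tendsto_localForm hτ (hD _ (u + v).2) (hD w w.2))
      (((tendsto_localForm hτ (hD u u.2) (hD w w.2)).add
        (tendsto_localForm hτ (hD v v.2) (hD w w.2))).congr fun n => ?_)
    simp only [meanForm, Submodule.coe_add, inner_add_left, mul_add]
  smul_left u v c := by
    refine tendsto_nhds_unique (tendsto_localForm hτ (hD _ (c • u).2) (hD v v.2))
      (((tendsto_localForm hτ (hD u u.2) (hD v v.2)).const_mul ((starRingEnd ℂ) c)).congr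
        fun n => ?_)
    simp only [meanForm, Submodule.coe_smul, inner_smul_left]
    ring

variable {U : Spacetime d → H →L[ℂ] H}

lemma HasBoundedDensity.translate (hc : IsTranslationCovariant U τ) {v : H}
    (hv : HasBoundedDensity τ v) (x : Spacetime d) : HasBoundedDensity τ (U x v) := by
  obtain ⟨C, hC⟩ := hv
  refine ⟨C, fun I hI hIf => ?_⟩
  rw [quadForm_translate hc hI]
  have h : volume ((fun y => y + x) ⁻¹' I) = volume I := measure_preimage_add_right volume x I
  have h2 := hC _ (measurable_add_const x hI) (by rwa [h])
  rwa [Measure.real, h] at h2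

lemma HasBoundedDensity.absolutelyContinuous (hτ : IsPOV τ) {v : H}
    (hv : HasBoundedDensity τ v) : povMeasure hτ v ≪ volume := by
  obtain ⟨C, hC⟩ := hv
  refine Measure.AbsolutelyContinuous.mk fun I hI h0 => ?_
  have h := hC I hI (by simp [h0])
  rw [Measure.real, h0, ENNReal.toReal_zero, mul_zero] at h
  rw [povMeasure_apply hτ v hI, ENNReal.ofReal_eq_zero]
  exact h

/-- By covariance, the density at an arbitrary point is the density at the origin of the
translated vector. -/
lemma localForm_translate_ae_eq (hτ : IsPOV τ) (hc : IsTranslationCovariant U τ) {v : H}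
    (hv : HasBoundedDensity τ v) :
    (fun x => (localForm τ (U (-x) v) (U (-x) v)).re) =ᵐ[volume]
      fun x => ((povMeasure hτ v).rnDeriv volume x).toReal := by
  filter_upwards [Besicovitch.ae_tendsto_rnDeriv (povMeasure hτ v) volume,
    Measure.rnDeriv_lt_top (povMeasure hτ v) volume] with x hx hfin
  have hr : Tendsto (fun n : ℕ => (1 : ℝ) / (n + 1)) (hyperfilter ℕ : Filter ℕ) (𝓝[>] 0) :=
    (tendsto_nhdsWithin_iff.2 ⟨tendsto_one_div_add_atTop_nhds_zero_nat,
      Eventually.of_forall fun n => by simp only [Set.mem_Ioi]; positivity⟩).mono_left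
      Nat.hyperfilter_le_atTop
  have h1 := (ENNReal.tendsto_toReal hfin.ne).comp (hx.comp hr)
  have h2 := Complex.continuous_re.continuousAt.tendsto.comp
    (tendsto_localForm hτ (hv.translate hc (-x)) (hv.translate hc (-x)))
  refine tendsto_nhds_unique h2 (h1.congr fun n => ?_)
  have hpre : (fun y => y + -x) ⁻¹' (probe d n) = Metric.closedBall x (1 / (n + 1)) := by
    ext y
    simp [probe, dist_eq_norm, sub_eq_add_neg]
  rw [Function.comp_apply, Function.comp_apply, Function.comp_apply, meanForm_self hτ,
    Complex.ofReal_re, quadForm_translate hc (measurableSet_probe n), hpre, ENNReal.toReal_div,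
    povMeasure_apply hτ v Metric.isClosed_closedBall.measurableSet, ENNReal.toReal_ofReal,
    Measure.addHaar_closedBall_center, div_eq_inv_mul]
  · rfl
  · exact quadForm_nonneg (hτ.nonneg _ Metric.isClosed_closedBall.measurableSet) v

end LocalForm

/-! ### Amplitudes of a covariant positive-operator-valued measure -/

section Amplitude

variable {d : ℕ} {H : Type*} [NormedAddCommGroup H] [InnerProductSpace ℂ H] [CompleteSpace H]
  {U : Spacetime d → H →L[ℂ] H} {τ : Set (Spacetime d) → H →L[ℂ] H}

/-- A dense, translation invariant supply of vectors with bounded densities that depend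
continuously on the translation. -/
lemma exists_regular_vectors [TopologicalSpace.SeparableSpace H] (hU : IsTranslationRep U)
    (hτ : IsPOV τ) (h1 : τ Set.univ ≤ 1) (hc : IsTranslationCovariant U τ) :
    ∃ u : ℕ × ℕ → H, (∀ j, HasBoundedDensity τ (u j)) ∧ DenseRange u ∧
      ∀ j x, ∃ C : Spacetime d → ℝ, Tendsto C (𝓝 x) (𝓝 0) ∧
        ∀ y I, MeasurableSet I → volume I ≠ ∞ →
          quadForm (τ I) (U y (u j) - U x (u j)) ≤ C y * volume.real I := by
  have hb : ∀ n, Continuous ((bump d n).normed volume) := fun n => (bump d n).continuous_normed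
  have hbs : ∀ n, HasCompactSupport ((bump d n).normed volume) := fun n =>
    (bump d n).hasCompactSupport_normed
  refine ⟨fun j => smear U ((bump d j.1).normed volume) (TopologicalSpace.denseSeq H j.2),
    fun j => ?_, ?_, fun j x =>
      exists_quadForm_translate_sub_le hU hτ h1 hc (hb _) (hbs _) _ x⟩
  · obtain ⟨M, hM⟩ := (hb j.1).bounded_above_of_compact_support (hbs j.1)
    exact ⟨_, fun I hI hIf => quadForm_smear_le_volume hU hτ h1 hc (hb _) (hbs _) hM hI hIf _⟩
  · refine Metric.denseRange_iff.2 fun v ε hε => ?_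
    obtain ⟨m, hm⟩ := Metric.denseRange_iff.1 (TopologicalSpace.denseRange_denseSeq H) v (ε / 2)
      (half_pos hε)
    obtain ⟨n, hn⟩ := exists_dist_smear_le hU (TopologicalSpace.denseSeq H m)
      (half_pos (half_pos hε))
    refine ⟨(n, m), ?_⟩
    have := dist_triangle v (TopologicalSpace.denseSeq H m)
      (smear U ((bump d n).normed volume) (TopologicalSpace.denseSeq H m))
    rw [dist_comm] at hn
    dsimp only
    linarith

/-- On a dense translation invariant subspace, the density of `τ` at the origin is the square sum of
linear functionals, which depend continuously on translations of their arguments. -/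
lemma exists_local_functionals [TopologicalSpace.SeparableSpace H] (hU : IsTranslationRep U)
    (hτ : IsPOV τ) (h1 : τ Set.univ ≤ 1) (hc : IsTranslationCovariant U τ) :
    ∃ (D : Submodule ℂ H) (hDU : ∀ x, ∀ v ∈ D, U x v ∈ D) (ℓ : ℕ → D →ₗ[ℂ] ℂ),
      Dense (D : Set H) ∧ (∀ v ∈ D, HasBoundedDensity τ v) ∧
      (∀ v : D, HasSum (fun n => ‖ℓ n v‖ ^ 2) (localForm τ (v : H) v).re) ∧
      ∀ n (v : D), Continuous fun x => ℓ n ⟨U (-x) v, hDU _ v v.2⟩ := by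
  obtain ⟨u, hu, hdense, hucont⟩ := exists_regular_vectors hU hτ h1 hc
  obtain ⟨D, hD⟩ : ∃ D : Submodule ℂ H,
    D = Submodule.span ℂ (Set.range fun p : (ℕ × ℕ) × Spacetime d => U p.2 (u p.1)) := ⟨_, rfl⟩
  have hgen : ∀ j x, U x (u j) ∈ D := fun j x => hD ▸ Submodule.subset_span ⟨(j, x), rfl⟩
  have hDU : ∀ x, ∀ v ∈ D, U x v ∈ D := by
    intro x v hv
    rw [hD] at hv
    induction hv using Submodule.span_induction with
    | mem v hv =>
      obtain ⟨p, rfl⟩ := hv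
      simp only [← hU.add]
      exact hgen _ _
    | zero => simp
    | add v w _ _ h h' => rw [map_add]; exact D.add_mem h h'
    | smul c v _ h => rw [map_smul]; exact D.smul_mem c h
  have hDb : ∀ v ∈ D, HasBoundedDensity τ v := by
    intro v hv
    rw [hD] at hv
    induction hv using Submodule.span_induction with
    | mem v hv =>
      obtain ⟨p, rfl⟩ := hv
      exact (hu p.1).translate hc p.2
    | zero => exact ⟨0, fun I _ _ => by simp [quadForm]⟩
    | add v w _ _ h h' => exact h.add hτ h'
    | smul c v _ h => exact h.smul c
  have hDdense : Dense (D : Set H) := by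
    refine hdense.mono ?_
    rintro _ ⟨j, rfl⟩
    have := hgen j 0
    rwa [hU.zero] at this
  have hspan : Submodule.span ℂ (Set.range fun p : (ℕ × ℕ) × Spacetime d =>
      (⟨U p.2 (u p.1), hgen p.1 p.2⟩ : D)) = ⊤ := by
    subst hD
    convert Submodule.span_span_coe_preimage (R := ℂ)
      (s := Set.range fun p : (ℕ × ℕ) × Spacetime d => U p.2 (u p.1)) using 2
    ext v
    simp only [Set.mem_range, Set.mem_preimage, Subtype.ext_iff]
  obtain ⟨ℓ, hℓ, hℓc⟩ := exists_functionals (localCore hτ D hDb)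
    (fun (j : ℕ × ℕ) (x : Spacetime d) => (⟨U x (u j), hgen j x⟩ : D))
    (fun j x => by
      obtain ⟨C, hC, hCb⟩ := hucont j x
      refine squeeze_zero (fun y => ?_) (fun y => ?_) hC
      · exact re_localForm_self_nonneg hτ (hDb _ (D.sub_mem (hgen j y) (hgen j x)))
      · exact re_localForm_self_le hτ (hCb y)) hspan
  refine ⟨D, hDU, ℓ, hDdense, hDb, hℓ, fun n v => ?_⟩
  have hv : v ∈ Submodule.span ℂ (Set.range fun p : (ℕ × ℕ) × Spacetime d =>
      (⟨U p.2 (u p.1), hgen p.1 p.2⟩ : D)) := hspan ▸ Submodule.mem_top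
  induction hv using Submodule.span_induction with
  | mem v hv =>
    obtain ⟨⟨j, y⟩, rfl⟩ := hv
    refine ((hℓc n j).comp (continuous_neg.add (continuous_const (y := y)))).congr fun x => ?_
    rw [Function.comp_apply]
    congr 1
    exact Subtype.ext (hU.add _ _ _)
  | zero =>
    refine (continuous_const (y := (0 : ℂ))).congr fun x => ?_
    rw [← map_zero (ℓ n)]
    congr 1
    exact Subtype.ext (map_zero (U (-x))).symm
  | add v w _ _ h h' =>
    refine (h.add h').congr fun x => ?_
    rw [Pi.add_apply, ← map_add]
    congr 1
    exact Subtype.ext (map_add (U (-x)) _ _).symm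
  | smul c v _ h =>
    refine (h.const_smul c).congr fun x => ?_
    rw [Pi.smul_apply, ← map_smul]
    congr 1
    exact Subtype.ext (map_smul (U (-x)) _ _).symm

/-- A covariant positive-operator-valued measure is the square of an operator that intertwines the
translations with those of the amplitudes. -/
theorem exists_amplitude_operator [TopologicalSpace.SeparableSpace H] (hU : IsTranslationRep U)
    (hτ : IsPOV τ) (h1 : τ Set.univ ≤ 1) (hc : IsTranslationCovariant U τ) :
    ∃ V : H →L[ℂ] AmpSpace d ℕ,
      (∀ I, MeasurableSet I → ∀ v, quadForm (τ I) v = ‖ampRestrict ℕ I (V v)‖ ^ 2) ∧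
      ∀ x v n, V (U x v) n =ᵐ[volume] fun y => V v n (y - x) := by
  obtain ⟨D, hDU, ℓ, hDdense, hDb, hℓ, hℓc⟩ := exists_local_functionals hU hτ h1 hc
  -- the amplitudes of vectors in `D`
  let f : D → ℕ → Spacetime d → ℂ := fun v n x => ℓ n ⟨U (-x) v, hDU _ v v.2⟩
  have hfadd : ∀ v w n x, f (v + w) n x = f v n x + f w n x := by
    intro v w n x
    simp only [f]; rw [← map_add]; congr 1; exact Subtype.ext (map_add (U (-x)) _ _)
  have hfsmul : ∀ (c : ℂ) v n x, f (c • v) n x = c * f v n x := by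
    intro c v n x
    simp only [f]; rw [← smul_eq_mul, ← map_smul]; congr 1
    exact Subtype.ext (map_smul (U (-x)) _ _)
  have hfcont : ∀ v n, Continuous (f v n) := fun v n => hℓc n v
  have hfmeas : ∀ v n, AEStronglyMeasurable (f v n) volume := fun v n =>
    (hfcont v n).aestronglyMeasurable
  let Q : D → Spacetime d → ℝ := fun v x => ((povMeasure hτ (v : H)).rnDeriv volume x).toReal
  have hQint : ∀ v, Integrable (Q v) volume := fun v => Measure.integrable_toReal_rnDeriv
  have hfsum : ∀ v, ∀ᵐ x ∂volume, HasSum (fun n => ‖f v n x‖ ^ 2) (Q v x) := by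
    intro v
    filter_upwards [localForm_translate_ae_eq hτ hc (hDb v v.2)] with x hx
    simp only [Q]
    rw [← hx]
    exact hℓ ⟨U (-x) v, hDU _ v v.2⟩
  have hmem : ∀ v n, MemLp (f v n) 2 volume := fun v n =>
    memLp_two_of_hasSum (hfmeas v) (hQint v) (hfsum v) n
  have hsum : ∀ (v : D) {I}, MeasurableSet I → HasSum (fun n => ∫ x in I, ‖f v n x‖ ^ 2)
      (quadForm (τ I) v) := by
    intro v I hI
    have h := hasSum_setIntegral_norm_sq (hfmeas v) (hQint v) (hfsum v) I
    have h2 : ∫ x in I, Q v x = quadForm (τ I) v := by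
      rw [Measure.setIntegral_toReal_rnDeriv ((hDb v v.2).absolutelyContinuous hτ),
        Measure.real, povMeasure_apply hτ _ hI, ENNReal.toReal_ofReal (quadForm_nonneg (hτ.nonneg I hI) _)]
    rwa [h2] at h
  have hnorm : ∀ v : D, HasSum (fun n => ‖(hmem v n).toLp‖ ^ 2) (quadForm (τ Set.univ) v) := by
    intro v
    convert hsum v MeasurableSet.univ using 2 with n
    rw [norm_sq_toLp, setIntegral_univ]
  let V₀ : D →ₗ[ℂ] AmpSpace d ℕ := familyMap f hmem
    (fun v w n => Eventually.of_forall fun x => hfadd v w n x)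
    (fun c v n => Eventually.of_forall fun x => hfsmul c v n x) (fun v => (hnorm v).summable)
  have hV₀ : ∀ v n, V₀ v n = (hmem v n).toLp := fun v n => rfl
  have hV₀norm : ∀ v, ‖V₀ v‖ ≤ 1 * ‖v‖ := by
    intro v
    rw [one_mul]
    refine le_of_sq_le_sq ?_ (norm_nonneg _)
    rw [(hasSum_norm_sq_lp (V₀ v)).unique (hnorm v)]
    exact quadForm_le_norm_sq h1 v
  have hV₀q : ∀ (v : D) {I}, MeasurableSet I → quadForm (τ I) v = ‖ampRestrict ℕ I (V₀ v)‖ ^ 2 := by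
    intro v I hI
    refine (hsum v hI).unique ?_
    convert hasSum_ampRestrict I (V₀ v) using 2 with n
    refine integral_congr_ae (ae_restrict_of_ae ?_)
    filter_upwards [(hmem v n).coeFn_toLp] with x hx
    rw [hV₀, hx]
  let V : H →L[ℂ] AmpSpace d ℕ := (V₀.mkContinuous 1 hV₀norm).extend D.subtypeL
  have hVD : ∀ v : D, V v = V₀ v := fun v =>
    ContinuousLinearMap.extend_eq _ hDdense.denseRange_val
      D.subtypeₗᵢ.isometry.isUniformInducing v
  refine ⟨V, fun I hI v => ?_, fun x v n => ?_⟩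
  · refine hDdense.induction (P := fun v => quadForm (τ I) v = ‖ampRestrict ℕ I (V v)‖ ^ 2)
      (fun v hv => ?_) (isClosed_eq (continuous_quadForm _) (by fun_prop)) v
    have := hV₀q ⟨v, hv⟩ hI
    rwa [← hVD] at this
  · have hmp : MeasurePreserving (fun y : Spacetime d => y - x) volume volume :=
      measurePreserving_sub_right volume x
    have hcl : V (U x v) n = Lp.compMeasurePreserving _ hmp (V v n) := by
      refine hDdense.induction
        (P := fun v => V (U x v) n = Lp.compMeasurePreserving _ hmp (V v n)) (fun v hv => ?_) ?_ v
      · have e1 := hVD ⟨v, hv⟩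
        have e2 := hVD ⟨U x v, hDU x v hv⟩
        dsimp only at e1 e2
        rw [e1, e2, hV₀, hV₀, Lp.toLp_compMeasurePreserving]
        refine (MemLp.toLp_eq_toLp_iff _ _).2 (Eventually.of_forall fun y => ?_)
        simp only [f, Function.comp_apply]
        congr 1; ext; simp only
        rw [← hU.add, neg_sub, sub_eq_neg_add]
      · refine isClosed_eq ?_ ?_
        · exact (lp.evalCLM ℂ (fun _ : ℕ => Lp ℂ 2 (volume : Measure (Spacetime d))) 2 n).continuous.comp
            (V.continuous.comp (U x).continuous)
        · exact (Lp.isometry_compMeasurePreserving hmp).continuous.comp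
            ((lp.evalCLM ℂ (fun _ : ℕ => Lp ℂ 2 (volume : Measure (Spacetime d))) 2 n).continuous.comp V.continuous)
    rw [hcl]
    exact Lp.coeFn_compMeasurePreserving _ hmp

end Amplitude

/-! ### The Fourier transform of square-integrable functions -/

section Fourier

variable {d : ℕ} [NeZero d]

lemma lower_apply (x : Spacetime d) (α : Fin d) : lower x α = if α = 0 then x α else -x α := rfl

lemma lower_lower (x : Spacetime d) : lower (lower x) = x := by
  ext α
  simp only [lower_apply]
  split_ifs <;> simp

variable (d) in
/-- Lowering of the index, as an isometry of the Euclidean structure. -/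
def lowerIsometry : Spacetime d ≃ₗᵢ[ℝ] Spacetime d where
  toFun := lower
  invFun := lower
  map_add' x y := by
    ext α; simp only [lower_apply, PiLp.add_apply]; split_ifs <;> ring
  map_smul' c x := by
    ext α; simp only [lower_apply, PiLp.smul_apply, smul_eq_mul, RingHom.id_apply]
    split_ifs <;> ring
  left_inv := lower_lower
  right_inv := lower_lower
  norm_map' x := by
    change ‖lower x‖ = ‖x‖
    rw [EuclideanSpace.norm_eq, EuclideanSpace.norm_eq]
    congr 1
    refine Finset.sum_congr rfl fun α _ => ?_
    rw [lower_apply]; split_ifs <;> simp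

lemma lowerIsometry_apply (x : Spacetime d) : lowerIsometry d x = lower x := rfl

lemma minkowski_eq_inner (x k : Spacetime d) : minkowski x k = inner ℝ k (lower x) := by
  rw [minkowski, PiLp.inner_apply]
  exact Finset.sum_congr rfl fun α _ => rfl

lemma lower_sub (x y : Spacetime d) : lower (x - y) = lower x - lower y :=
  map_sub (lowerIsometry d) x y

lemma lower_add (x y : Spacetime d) : lower (x + y) = lower x + lower y :=
  map_add (lowerIsometry d) x y

lemma lower_neg (x : Spacetime d) : lower (-x) = -lower x := map_neg (lowerIsometry d) x

lemma measurePreserving_lower : MeasurePreserving (lower : Spacetime d → Spacetime d) :=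
  (lowerIsometry d).measurePreserving

lemma quasiMeasurePreserving_smul_lower {r : ℝ} (hr : r ≠ 0) :
    Measure.QuasiMeasurePreserving (fun x : Spacetime d => r • lower x) volume volume := by
  refine Measure.QuasiMeasurePreserving.comp (g := fun x : Spacetime d => r • x)
    ⟨measurable_const_smul r, ?_⟩ measurePreserving_lower.quasiMeasurePreserving
  rw [Measure.map_addHaar_smul volume hr]
  exact Measure.smul_absolutelyContinuous

lemma integral_comp_smul_lower (g : Spacetime d → ℝ) (r : ℝ) :
    ∫ x, g (r • lower x) = |(r ^ d)⁻¹| * ∫ x, g x := by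
  have h := measurePreserving_lower.integral_comp (lowerIsometry d).toHomeomorph.measurableEmbedding
    (fun x : Spacetime d => g (r • x))
  rw [h, Measure.integral_comp_smul, finrank_euclideanSpace_fin, smul_eq_mul]

lemma memLp_comp_smul_lower {r : ℝ} (hr : r ≠ 0) {g : Spacetime d → ℂ} (hg : MemLp g 2 volume) :
    MemLp (fun x => g (r • lower x)) 2 volume := by
  have hm := hg.1.comp_quasiMeasurePreserving (quasiMeasurePreserving_smul_lower (d := d) hr)
  refine (memLp_two_iff_integrable_sq_norm hm).2 ?_
  have h := (memLp_two_iff_integrable_sq_norm hg.1).1 hg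
  exact measurePreserving_lower.integrable_comp_of_integrable
    ((integrable_comp_smul_iff volume (fun x => ‖g x‖ ^ 2) hr).2 h)

variable (d) in
/-- The normalization factor `(2π)^(-d/2)`. -/
def fourierConst : ℝ := (2 * Real.pi) ^ (-(d : ℝ) / 2)

omit [NeZero d] in
lemma fourierConst_pos : 0 < fourierConst d := Real.rpow_pos_of_pos (by positivity) _

lemma memLp_fourier (g : Lp ℂ 2 (volume : Measure (Spacetime d))) :
    MemLp (fun x => (fourierConst d : ℂ) * (𝓕 g : Lp ℂ 2 (volume : Measure (Spacetime d)))
      ((2 * Real.pi)⁻¹ • lower x)) 2 volume :=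
  (memLp_comp_smul_lower (by positivity) (Lp.memLp _)).const_mul _

/-- The Fourier transform with the phase `exp(-i x_α k^α)`, on classes of functions. -/
def covFourier : Lp ℂ 2 (volume : Measure (Spacetime d)) →ₗᵢ[ℂ]
    Lp ℂ 2 (volume : Measure (Spacetime d)) where
  toFun g := (memLp_fourier g).toLp
  map_add' g h := by
    have hq := quasiMeasurePreserving_smul_lower (d := d) (r := (2 * Real.pi)⁻¹) (by positivity)
    refine ((MemLp.toLp_eq_toLp_iff (memLp_fourier (g + h))
      ((memLp_fourier g).add (memLp_fourier h))).2 ?_).trans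
        (MemLp.toLp_add (memLp_fourier g) (memLp_fourier h))
    rw [FourierTransform.fourier_add]
    filter_upwards [hq.ae (Lp.coeFn_add (𝓕 g) (𝓕 h))] with x hx
    simp only [Pi.add_apply] at hx ⊢
    rw [hx, mul_add]
  map_smul' c g := by
    have hq := quasiMeasurePreserving_smul_lower (d := d) (r := (2 * Real.pi)⁻¹) (by positivity)
    refine ((MemLp.toLp_eq_toLp_iff (memLp_fourier (c • g))
      ((memLp_fourier g).const_smul c)).2 ?_).trans (MemLp.toLp_const_smul c (memLp_fourier g))
    rw [FourierTransform.fourier_smul]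
    filter_upwards [hq.ae (Lp.coeFn_smul c (𝓕 g))] with x hx
    simp only [Pi.smul_apply, smul_eq_mul] at hx ⊢
    rw [hx]; ring
  norm_map' g := by
    refine (sq_eq_sq₀ (norm_nonneg _) (norm_nonneg _)).1 ?_
    change ‖(memLp_fourier g).toLp‖ ^ 2 = _
    rw [norm_sq_toLp, ← Lp.norm_fourier_eq g, norm_sq_Lp]
    simp only [norm_mul, Complex.norm_real, mul_pow]
    rw [integral_const_mul, integral_comp_smul_lower
      (fun x => ‖(𝓕 g : Lp ℂ 2 (volume : Measure (Spacetime d))) x‖ ^ 2), ← mul_assoc]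
    have h2 : (0 : ℝ) < 2 * Real.pi := by positivity
    have : ‖fourierConst d‖ ^ 2 * |(((2 * Real.pi)⁻¹) ^ d)⁻¹| = 1 := by
      rw [Real.norm_of_nonneg fourierConst_pos.le, abs_of_pos (by positivity), inv_pow, inv_inv,
        fourierConst, ← Real.rpow_natCast, ← Real.rpow_natCast, ← Real.rpow_mul h2.le,
        ← Real.rpow_add h2]
      norm_num
    rw [this, one_mul]

lemma covFourier_ae (g : Lp ℂ 2 (volume : Measure (Spacetime d))) :
    covFourier g =ᵐ[volume] fun x => (fourierConst d : ℂ) *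
      (𝓕 g : Lp ℂ 2 (volume : Measure (Spacetime d))) ((2 * Real.pi)⁻¹ • lower x) :=
  (memLp_fourier g).coeFn_toLp

lemma isFourierOf_iff {Ψ g : Spacetime d → ℂ} :
    IsFourierOf Ψ g ↔ ∃ hg : MemLp g 2 volume, Ψ =ᵐ[volume] covFourier (hg.toLp g) := by
  refine exists_congr fun hg => ?_
  have h := covFourier_ae (hg.toLp g)
  exact ⟨fun h' => h'.trans h.symm, fun h' => h'.trans h⟩

lemma covFourier_surjective : Function.Surjective
    (covFourier : Lp ℂ 2 (volume : Measure (Spacetime d)) → _) := by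
  intro f
  have hm : MemLp (fun x => ((fourierConst d)⁻¹ : ℂ) * f ((2 * Real.pi) • lower x)) 2 volume :=
    (memLp_comp_smul_lower (by positivity) (Lp.memLp f)).const_mul _
  have hq := quasiMeasurePreserving_smul_lower (d := d) (r := (2 * Real.pi)⁻¹) (by positivity)
  have hc : (fourierConst d : ℂ) ≠ 0 := by exact_mod_cast fourierConst_pos.ne'
  refine ⟨(Lp.fourierTransformₗᵢ (Spacetime d) ℂ).symm hm.toLp, ?_⟩
  have h : 𝓕 ((Lp.fourierTransformₗᵢ (Spacetime d) ℂ).symm hm.toLp) = hm.toLp :=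
    (Lp.fourierTransformₗᵢ (Spacetime d) ℂ).apply_symm_apply _
  ext1
  refine (covFourier_ae _).trans ?_
  rw [h]
  filter_upwards [hq.ae hm.coeFn_toLp] with x hx
  have h3 : (2 * Real.pi) • lower ((2 * Real.pi)⁻¹ • lower x) = x := by
    rw [← lowerIsometry_apply, map_smul, lowerIsometry_apply, lower_lower,
      smul_inv_smul₀ (by positivity)]
  rw [hx, h3, mul_inv_cancel_left₀ hc]

lemma phaseMul_ae (ν : Measure (Spacetime d)) (x : Spacetime d) (f : Lp ℂ 2 ν) :
    phaseMul ν x f =ᵐ[ν] fun k => phase x k * f k := (memLp_phase_mul x f).coeFn_toLp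

lemma fourierInv_schwartz_translate (x : Spacetime d) (h : SchwartzMap (Spacetime d) ℂ)
    (k : Spacetime d) : 𝓕⁻ (h.compSubConstCLM ℂ ((2 * Real.pi)⁻¹ • lower x)) k =
      phase x k * 𝓕⁻ h k := by
  rw [SchwartzMap.fourierInv_coe, SchwartzMap.fourierInv_coe, Real.fourierInv_eq',
    Real.fourierInv_eq', ← integral_add_right_eq_self _ ((2 * Real.pi)⁻¹ • lower x),
    ← integral_const_mul]
  congr 1; ext v
  rw [SchwartzMap.compSubConstCLM_apply, add_sub_cancel_right, inner_add_left, smul_eq_mul,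
    smul_eq_mul, ← mul_assoc, phase, ← Complex.exp_add, minkowski_eq_inner]
  congr 2
  rw [inner_smul_left, real_inner_comm k (lower x)]
  push_cast
  have : (Real.pi : ℂ) ≠ 0 := by exact_mod_cast Real.pi_ne_zero
  simp
  field_simp
  exact add_comm _ _

lemma fourierInv_translate (x : Spacetime d) (f : Lp ℂ 2 (volume : Measure (Spacetime d))) :
    𝓕⁻ (Lp.compMeasurePreserving _
      (measurePreserving_sub_right volume ((2 * Real.pi)⁻¹ • lower x)) f) =
      phaseMul volume x (𝓕⁻ f) := by
  have hmp := measurePreserving_sub_right (volume : Measure (Spacetime d))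
    ((2 * Real.pi)⁻¹ • lower x)
  refine (SchwartzMap.denseRange_toLpCLM (p := 2) ENNReal.ofNat_ne_top).induction_on
    (p := fun f : Lp ℂ 2 (volume : Measure (Spacetime d)) =>
      𝓕⁻ (Lp.compMeasurePreserving _ hmp f) = phaseMul volume x (𝓕⁻ f)) f ?_ fun h => ?_
  · exact isClosed_eq ((Lp.fourierTransformₗᵢ (Spacetime d) ℂ).symm.continuous.comp
      (Lp.isometry_compMeasurePreserving hmp).continuous)
      ((phaseMul volume x).continuous.comp
        (Lp.fourierTransformₗᵢ (Spacetime d) ℂ).symm.continuous)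
  · change 𝓕⁻ (Lp.compMeasurePreserving _ hmp (h.toLp 2)) = phaseMul volume x (𝓕⁻ (h.toLp 2))
    have h1 : Lp.compMeasurePreserving _ hmp (h.toLp 2) =
        (h.compSubConstCLM ℂ ((2 * Real.pi)⁻¹ • lower x)).toLp 2 := by
      ext1
      refine (Lp.coeFn_compMeasurePreserving _ hmp).trans ?_
      filter_upwards [hmp.quasiMeasurePreserving.ae (h.coeFn_toLp 2 volume),
        (h.compSubConstCLM ℂ ((2 * Real.pi)⁻¹ • lower x)).coeFn_toLp 2 volume] with y h2 h3
      rw [h3, Function.comp_apply, h2, SchwartzMap.compSubConstCLM_apply]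
    rw [h1, SchwartzMap.toLp_fourierInv_eq, SchwartzMap.toLp_fourierInv_eq]
    ext1
    filter_upwards [phaseMul_ae volume x ((𝓕⁻ h).toLp 2), (𝓕⁻ h).coeFn_toLp 2 volume,
      (𝓕⁻ (h.compSubConstCLM ℂ ((2 * Real.pi)⁻¹ • lower x))).coeFn_toLp 2 volume] with k h2 h3 h4
    rw [h2, h3, h4, fourierInv_schwartz_translate]

/-- Multiplication by a phase becomes a translation. -/
lemma covFourier_phaseMul (x : Spacetime d) (g : Lp ℂ 2 (volume : Measure (Spacetime d))) :
    covFourier (phaseMul volume x g) =ᵐ[volume] fun y => covFourier g (y - x) := by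
  have hmp := measurePreserving_sub_right (volume : Measure (Spacetime d))
    ((2 * Real.pi)⁻¹ • lower x)
  have hq := quasiMeasurePreserving_smul_lower (d := d) (r := (2 * Real.pi)⁻¹) (by positivity)
  have h1 : 𝓕 (phaseMul volume x g) = Lp.compMeasurePreserving _ hmp (𝓕 g) := by
    have h := fourierInv_translate x (𝓕 g)
    rw [FourierTransform.fourierInv_fourier_eq] at h
    rw [← h, FourierTransform.fourier_fourierInv_eq]
  refine (covFourier_ae _).trans ?_
  rw [h1]
  filter_upwards [hq.ae (Lp.coeFn_compMeasurePreserving (𝓕 g) hmp),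
    (measurePreserving_sub_right volume x).quasiMeasurePreserving.ae (covFourier_ae g)] with y h2 h3
  rw [h2, h3, Function.comp_apply, lower_sub, smul_sub]

end Fourier

/-! ### Wave functions -/

lemma ae_summable_of_summable_integral_norm {X : Type*} [MeasurableSpace X] {ν : Measure X}
    {κ 𝕜 : Type*} [Countable κ] [RCLike 𝕜] {F : κ → X → 𝕜} (hF : ∀ i, Integrable (F i) ν)
    (hsum : Summable fun i => ∫ x, ‖F i x‖ ∂ν) :
    (∀ᵐ x ∂ν, Summable fun i => ‖F i x‖) ∧ Integrable (fun x => ∑' i, F i x) ν := by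
  have hlint : ∑' i, ∫⁻ x, ‖F i x‖ₑ ∂ν ≠ ∞ := by
    have h : ∀ i, ∫⁻ x, ‖F i x‖ₑ ∂ν = ENNReal.ofReal (∫ x, ‖F i x‖ ∂ν) := fun i => by
      rw [ofReal_integral_norm_eq_lintegral_enorm (hF i)]
    simp_rw [h]
    rw [← ENNReal.ofReal_tsum_of_nonneg (fun i => integral_nonneg fun x => norm_nonneg _) hsum]
    exact ENNReal.ofReal_ne_top
  have hm : ∀ i, AEMeasurable (fun x => ‖F i x‖ₑ) ν := fun i => (hF i).1.enorm
  rw [← lintegral_tsum hm] at hlint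
  have h1 : ∀ᵐ x ∂ν, Summable fun i => ‖F i x‖ := by
    filter_upwards [ae_lt_top' (AEMeasurable.tsum hm) hlint] with x hx
    exact tsum_enorm_ne_top_iff_summable_norm.1 hx.ne
  have hF' : ∀ i, AEMeasurable (F i) ν := fun i => (hF i).1.aemeasurable
  refine ⟨h1, ⟨(AEMeasurable.tsum hF').aestronglyMeasurable, ?_⟩⟩
  refine (lintegral_mono fun x => ?_).trans_lt hlint.lt_top
  exact enorm_tsum_le_tsum_enorm

section Wave

variable {d : ℕ} {ι : Type*} {μ : Measure (Spacetime d)} {R : ι → Set (Spacetime d)}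

lemma wave_memLp (hR : ∀ σ, MeasurableSet (R σ)) (ψ : WaveSpace μ R) (σ : ι) :
    MemLp (wave ψ σ) 2 μ :=
  (memLp_indicator_iff_restrict (hR σ)).2 (Lp.memLp (ψ σ))

lemma wave_congr {σ : ι} (hσ : MeasurableSet (R σ)) {ψ : WaveSpace μ R} {f : Spacetime d → ℂ}
    (h : ψ σ =ᵐ[μ.restrict (R σ)] f) : wave ψ σ =ᵐ[μ] (R σ).indicator f :=
  (ae_eq_restrict_iff_indicator_ae_eq hσ).1 h

lemma wave_of_notMem (ψ : WaveSpace μ R) {σ : ι} {k : Spacetime d} (hk : k ∉ R σ) :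
    wave ψ σ k = 0 := Set.indicator_of_notMem hk _

lemma wave_add (hR : ∀ σ, MeasurableSet (R σ)) (φ ψ : WaveSpace μ R) (σ : ι) :
    wave (φ + ψ) σ =ᵐ[μ] fun k => wave φ σ k + wave ψ σ k := by
  refine (wave_congr (hR σ) (Lp.coeFn_add (φ σ) (ψ σ))).trans (Eventually.of_forall fun k => ?_)
  exact congrFun (Set.indicator_add (R σ) (φ σ) (ψ σ)) k

lemma wave_smul (hR : ∀ σ, MeasurableSet (R σ)) (c : ℂ) (ψ : WaveSpace μ R) (σ : ι) :
    wave (c • ψ) σ =ᵐ[μ] fun k => c * wave ψ σ k := by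
  refine (wave_congr (hR σ) (Lp.coeFn_smul c (ψ σ))).trans (Eventually.of_forall fun k => ?_)
  exact Set.indicator_const_smul_apply (R σ) c (ψ σ) k

lemma wave_translation [NeZero d] (hR : ∀ σ, MeasurableSet (R σ)) (x : Spacetime d)
    (ψ : WaveSpace μ R) (σ : ι) :
    wave (translation μ R x ψ) σ =ᵐ[μ] fun k => phase x k * wave ψ σ k := by
  refine (wave_congr (ψ := translation μ R x ψ) (hR σ)
    (phaseMul_ae (μ.restrict (R σ)) x (ψ σ))).trans (Eventually.of_forall fun k => ?_)
  exact Set.indicator_mul_right (R σ) (phase x) (ψ σ)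

lemma inner_component (hR : ∀ σ, MeasurableSet (R σ)) (φ ψ : WaveSpace μ R) (σ : ι) :
    inner ℂ (φ σ) (ψ σ) = ∫ k, star (wave φ σ k) * wave ψ σ k ∂μ := by
  rw [L2.inner_def, ← integral_indicator (hR σ)]
  congr 1; ext k
  by_cases hk : k ∈ R σ
  · simp [wave, hk, mul_comm]
  · simp [wave, hk]

/-- The local inner product `∑_σ conj φ_σ(k) ψ_σ(k)` in the fibre over `k`. -/
def overlap (φ ψ : WaveSpace μ R) (k : Spacetime d) : ℂ := ∑' σ, star (wave φ σ k) * wave ψ σ k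

variable [Countable ι]

omit [Countable ι] in
lemma summable_integral_norm_overlap (hR : ∀ σ, MeasurableSet (R σ)) (φ ψ : WaveSpace μ R) :
    (∀ σ, Integrable (fun k => star (wave φ σ k) * wave ψ σ k) μ) ∧
      Summable fun σ => ∫ k, ‖star (wave φ σ k) * wave ψ σ k‖ ∂μ := by
  have hint : ∀ σ, Integrable (fun k => star (wave φ σ k) * wave ψ σ k) μ := fun σ =>
    MemLp.integrable_mul (wave_memLp hR φ σ).star (wave_memLp hR ψ σ)
  have hsq : ∀ (ψ : WaveSpace μ R) σ, Integrable (fun k => ‖wave ψ σ k‖ ^ 2) μ := fun ψ σ =>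
    (memLp_two_iff_integrable_sq_norm (wave_memLp hR ψ σ).1).1 (wave_memLp hR ψ σ)
  have hn : ∀ (ψ : WaveSpace μ R) σ, ∫ k, ‖wave ψ σ k‖ ^ 2 ∂μ = ‖ψ σ‖ ^ 2 := by
    intro ψ σ
    rw [norm_sq_Lp, ← integral_indicator (hR σ)]
    congr 1; ext k
    by_cases hk : k ∈ R σ <;> simp [wave, hk]
  refine ⟨hint, Summable.of_nonneg_of_le (fun σ => integral_nonneg fun k => norm_nonneg _)
    (fun σ => ?_) ((hasSum_norm_sq_lp φ).summable.add (hasSum_norm_sq_lp ψ).summable)⟩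
  rw [← hn φ, ← hn ψ, ← integral_add (hsq φ σ) (hsq ψ σ)]
  refine integral_mono (hint σ).norm ((hsq φ σ).add (hsq ψ σ)) fun k => ?_
  simp only [norm_mul, norm_star]
  nlinarith [sq_nonneg (‖wave φ σ k‖ - ‖wave ψ σ k‖), sq_nonneg ‖wave φ σ k‖,
    sq_nonneg ‖wave ψ σ k‖]

lemma integrable_overlap (hR : ∀ σ, MeasurableSet (R σ)) (φ ψ : WaveSpace μ R) :
    Integrable (overlap φ ψ) μ :=
  (ae_summable_of_summable_integral_norm (summable_integral_norm_overlap hR φ ψ).1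
    (summable_integral_norm_overlap hR φ ψ).2).2

lemma inner_eq_integral_overlap (hR : ∀ σ, MeasurableSet (R σ)) (φ ψ : WaveSpace μ R) :
    inner ℂ φ ψ = ∫ k, overlap φ ψ k ∂μ := by
  have h := hasSum_integral_of_summable_integral_norm (summable_integral_norm_overlap hR φ ψ).1
    (summable_integral_norm_overlap hR φ ψ).2
  refine (lp.hasSum_inner φ ψ).unique ?_
  simp_rw [inner_component hR]
  exact h

lemma ae_summable_wave (hR : ∀ σ, MeasurableSet (R σ)) (ψ : WaveSpace μ R) :
    ∀ᵐ k ∂μ, Summable fun σ => ‖wave ψ σ k‖ ^ 2 := by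
  filter_upwards [(ae_summable_of_summable_integral_norm
    (summable_integral_norm_overlap hR ψ ψ).1 (summable_integral_norm_overlap hR ψ ψ).2).1]
    with k hk
  refine hk.congr fun σ => ?_
  rw [norm_mul, norm_star, sq]

omit [Countable ι] in
lemma overlap_self (ψ : WaveSpace μ R) (k : Spacetime d) :
    overlap ψ ψ k = ((∑' σ, ‖wave ψ σ k‖ ^ 2 : ℝ) : ℂ) := by
  rw [overlap, Complex.ofReal_tsum]
  congr 1; ext σ
  rw [Complex.star_def, ← Complex.normSq_eq_conj_mul_self, Complex.normSq_eq_norm_sq]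

lemma integrable_density (hR : ∀ σ, MeasurableSet (R σ)) (ψ : WaveSpace μ R) :
    Integrable (fun k => ∑' σ, ‖wave ψ σ k‖ ^ 2) μ := by
  refine (integrable_overlap hR ψ ψ).re.congr (Eventually.of_forall fun k => ?_)
  simp only [overlap_self]
  exact Complex.ofReal_re _

lemma norm_sq_eq_integral (hR : ∀ σ, MeasurableSet (R σ)) (ψ : WaveSpace μ R) :
    ‖ψ‖ ^ 2 = ∫ k, ∑' σ, ‖wave ψ σ k‖ ^ 2 ∂μ := by
  have h := inner_eq_integral_overlap hR ψ ψ
  simp_rw [overlap_self] at h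
  rw [integral_complex_ofReal] at h
  have h2 : (inner ℂ ψ ψ : ℂ).re = ‖ψ‖ ^ 2 := inner_self_eq_norm_sq (𝕜 := ℂ) ψ
  rw [← h2, h, Complex.ofReal_re]

lemma overlap_translation [NeZero d] (hR : ∀ σ, MeasurableSet (R σ)) (x : Spacetime d)
    (φ ψ : WaveSpace μ R) :
    overlap φ (translation μ R x ψ) =ᵐ[μ] fun k => phase x k * overlap φ ψ k := by
  filter_upwards [ae_all_iff.2 (wave_translation hR x ψ)] with k hk
  rw [overlap, overlap, ← tsum_mul_left]
  congr 1; ext σ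
  rw [hk, mul_left_comm]

lemma continuous_phase [NeZero d] (x : Spacetime d) : Continuous (phase x) := by
  unfold phase minkowski
  fun_prop

lemma continuous_phase_left [NeZero d] (k : Spacetime d) : Continuous fun x => phase x k := by
  unfold phase
  simp only [minkowski_eq_inner]
  have : Continuous (lower : Spacetime d → Spacetime d) := (lowerIsometry d).continuous
  fun_prop

lemma phase_zero [NeZero d] (k : Spacetime d) : phase 0 k = 1 := by
  simp [phase, minkowski_eq_inner, ← lowerIsometry_apply]

lemma phase_add [NeZero d] (x y k : Spacetime d) : phase (x + y) k = phase x k * phase y k := by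
  rw [phase, phase, phase, ← Complex.exp_add, minkowski_eq_inner, minkowski_eq_inner,
    minkowski_eq_inner, lower_add, inner_add_right]
  push_cast; ring_nf

lemma star_phase_mul_phase [NeZero d] (x k : Spacetime d) : star (phase x k) * phase x k = 1 := by
  rw [Complex.star_def, ← Complex.normSq_eq_conj_mul_self, Complex.normSq_eq_norm_sq, norm_phase]
  simp

lemma inner_translation [NeZero d] (hR : ∀ σ, MeasurableSet (R σ)) (x : Spacetime d)
    (φ ψ : WaveSpace μ R) :
    inner ℂ φ (translation μ R x ψ) = ∫ k, phase x k * overlap φ ψ k ∂μ := by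
  rw [inner_eq_integral_overlap hR]
  exact integral_congr_ae (overlap_translation hR x φ ψ)

omit [Countable ι] in
lemma ext_wave (hR : ∀ σ, MeasurableSet (R σ)) {φ ψ : WaveSpace μ R}
    (h : ∀ σ, wave φ σ =ᵐ[μ] wave ψ σ) : φ = ψ := by
  refine lp.ext (funext fun σ => ?_)
  ext1
  exact (ae_eq_restrict_iff_indicator_ae_eq (hR σ)).2 (h σ)

lemma isTranslationRep_translation [NeZero d] (hR : ∀ σ, MeasurableSet (R σ)) :
    IsTranslationRep (translation μ R) := by
  have hinner : ∀ x (u v : WaveSpace μ R),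
      inner ℂ (translation μ R x u) (translation μ R x v) = inner ℂ u v := by
    intro x u v
    rw [inner_eq_integral_overlap hR, inner_eq_integral_overlap hR]
    refine integral_congr_ae ?_
    filter_upwards [ae_all_iff.2 (wave_translation hR x u),
      ae_all_iff.2 (wave_translation hR x v)] with k hu hv
    rw [overlap, overlap]
    congr 1; ext σ
    rw [hu, hv, star_mul', mul_mul_mul_comm, star_phase_mul_phase, one_mul]
  have hnorm : ∀ x (v : WaveSpace μ R), ‖translation μ R x v‖ = ‖v‖ := by
    intro x v
    rw [@norm_eq_sqrt_re_inner ℂ, hinner, ← @norm_eq_sqrt_re_inner ℂ]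
  refine ⟨?_, fun x y v => ?_, hinner, fun v => ?_⟩
  · ext1 v
    refine ext_wave hR fun σ => ?_
    filter_upwards [wave_translation hR 0 v σ] with k hk
    rw [hk, phase_zero, one_mul]; rfl
  · refine ext_wave hR fun σ => ?_
    filter_upwards [wave_translation hR (x + y) v σ,
      wave_translation hR x (translation μ R y v) σ, wave_translation hR y v σ] with k h1 h2 h3
    rw [h1, h2, h3, phase_add, mul_assoc]
  · -- weak continuity suffices, since all the vectors have the same norm
    have hw : ∀ u, Continuous fun x => (inner ℂ u (translation μ R x v) : ℂ) := by
      intro u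
      simp_rw [inner_translation hR]
      refine continuous_of_dominated (bound := fun k => ‖overlap u v k‖) (fun x => ?_) (fun x => ?_)
        (integrable_overlap hR u v).norm ?_
      · exact (continuous_phase x).aestronglyMeasurable.mul (integrable_overlap hR u v).1
      · exact Eventually.of_forall fun k => by rw [norm_mul, norm_phase, one_mul]
      · exact Eventually.of_forall fun k => (continuous_phase_left k).mul continuous_const
    refine continuous_iff_continuousAt.2 fun x => ?_
    rw [ContinuousAt, tendsto_iff_norm_sub_tendsto_zero]
    have h1 : ∀ y, ‖translation μ R y v - translation μ R x v‖ =
        √(2 * ‖v‖ ^ 2 - 2 * (inner ℂ (translation μ R x v) (translation μ R y v) : ℂ).re) := by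
      intro y
      rw [← Real.sqrt_sq (norm_nonneg (translation μ R y v - translation μ R x v)),
        norm_sub_rev, @norm_sub_sq ℂ, hnorm, hnorm]
      congr 1
      simp only [RCLike.re_eq_complex_re]
      ring
    simp_rw [h1]
    have h2 : Continuous fun y => √(2 * ‖v‖ ^ 2 -
        2 * (inner ℂ (translation μ R x v) (translation μ R y v) : ℂ).re) :=
      (continuous_const.sub (continuous_const.mul
        (Complex.continuous_re.comp (hw (translation μ R x v))))).sqrt
    have h3 := h2.tendsto x
    rwa [hinner, show (inner ℂ v v : ℂ).re = ‖v‖ ^ 2 from inner_self_eq_norm_sq (𝕜 := ℂ) v,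
      sub_self, Real.sqrt_zero] at h3

instance [SigmaFinite μ] : TopologicalSpace.SeparableSpace (WaveSpace μ R) := by
  classical
  have : Fact ((2 : ℝ≥0∞) ≠ ∞) := ⟨by simp⟩
  have : ∀ σ, TopologicalSpace.SeparableSpace (Lp ℂ 2 (μ.restrict (R σ))) := fun σ => inferInstance
  have h : TopologicalSpace.IsSeparable (⋃ σ, Set.range (lp.single (E := fun σ => Lp ℂ 2 (μ.restrict (R σ))) 2 σ)) := by
    refine TopologicalSpace.IsSeparable.iUnion fun σ => TopologicalSpace.isSeparable_range ?_
    exact (lp.isometry_single σ).continuous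
  have h2 := (h.span (R := ℂ)).closure
  refine TopologicalSpace.isSeparable_univ_iff.1 (h2.mono fun ψ _ => ?_)
  refine mem_closure_of_tendsto (lp.hasSum_single (by simp) ψ) (Eventually.of_forall fun s => ?_)
  exact Submodule.sum_mem _ fun σ _ =>
    Submodule.subset_span (Set.mem_iUnion.2 ⟨σ, Set.mem_range_self _⟩)

omit [Countable ι] in
/-- The wave packet `ψ_σ = c_σ 1_A`. -/
lemma exists_wavePacket (hR : ∀ σ, MeasurableSet (R σ)) {c : ι → ℂ}
    (hc : Summable fun σ => ‖c σ‖ ^ 2) {A : Set (Spacetime d)} (hA : MeasurableSet A)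
    (hAf : μ A ≠ ∞) : ∃ ψ : WaveSpace μ R, ∀ σ, wave ψ σ =ᵐ[μ]
      fun k => A.indicator 1 k * (R σ).indicator (fun _ => c σ) k := by
  have hm : ∀ σ, MemLp (A.indicator fun _ => c σ) 2 (μ.restrict (R σ)) := fun σ =>
    memLp_indicator_const 2 hA (c σ) (Or.inr ((Measure.restrict_apply_le _ _).trans_lt hAf.lt_top).ne)
  have hn : ∀ σ, ‖(hm σ).toLp‖ ^ 2 ≤ μ.real A * ‖c σ‖ ^ 2 := by
    intro σ
    rw [norm_sq_toLp]
    have h : ∀ k, ‖A.indicator (fun _ => c σ) k‖ ^ 2 = A.indicator (fun _ => ‖c σ‖ ^ 2) k := by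
      intro k
      by_cases hk : k ∈ A <;> simp [hk]
    simp_rw [h]
    rw [integral_indicator_const _ hA, smul_eq_mul]
    gcongr
    exact ENNReal.toReal_mono hAf (Measure.restrict_apply_le _ _)
  refine ⟨⟨fun σ => (hm σ).toLp, memℓp_two_iff.2 ?_⟩, fun σ => ?_⟩
  · exact Summable.of_nonneg_of_le (fun σ => by positivity) hn (hc.mul_left _)
  · refine (wave_congr (hR σ) (hm σ).coeFn_toLp).trans (Eventually.of_forall fun k => ?_)
    by_cases hk : k ∈ A <;> by_cases hk' : k ∈ R σ <;> simp [hk, hk']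

end Wave

/-! ### Uniqueness for complex densities with equal Fourier transforms -/

section Uniqueness

variable {d : ℕ} [NeZero d]

lemma phase_lower (x k : Spacetime d) :
    phase (lower x) k = Complex.exp ((inner ℝ k x : ℝ) * Complex.I) := by
  rw [phase, minkowski_eq_inner, lower_lower, mul_comm]

lemma star_phase (x k : Spacetime d) : star (phase x k) = phase (-x) k := by
  rw [Complex.star_def, phase, phase, ← Complex.exp_conj, minkowski_eq_inner, minkowski_eq_inner,
    lower_neg, inner_neg_right]
  simp

lemma integral_phase_withDensity {ν : Measure (Spacetime d)} {f : Spacetime d → ℝ}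
    (hf : Integrable f ν) (x : Spacetime d) :
    ∫ k, phase x k ∂(ν.withDensity fun k => ENNReal.ofReal (f k)) =
      ∫ k, ((max (f k) 0 : ℝ) : ℂ) * phase x k ∂ν := by
  rw [integral_withDensity_eq_integral_toReal_smul₀ hf.1.aemeasurable.ennreal_ofReal
    (Eventually.of_forall fun k => ENNReal.ofReal_lt_top)]
  rfl

lemma integrable_mul_phase {ν : Measure (Spacetime d)} {f : Spacetime d → ℂ}
    (hf : Integrable f ν) (x : Spacetime d) : Integrable (fun k => f k * phase x k) ν := by
  refine hf.mono (hf.1.mul (continuous_phase x).aestronglyMeasurable)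
    (Eventually.of_forall fun k => ?_)
  rw [norm_mul, norm_phase, mul_one]

lemma setIntegral_eq_of_integral_phase_eq_real {ν₁ ν₂ : Measure (Spacetime d)}
    {f₁ f₂ : Spacetime d → ℝ} (h₁ : Integrable f₁ ν₁) (h₂ : Integrable f₂ ν₂)
    (h : ∀ x, ∫ k, (f₁ k : ℂ) * phase x k ∂ν₁ = ∫ k, (f₂ k : ℂ) * phase x k ∂ν₂)
    {A : Set (Spacetime d)} (hA : MeasurableSet A) :
    ∫ k in A, f₁ k ∂ν₁ = ∫ k in A, f₂ k ∂ν₂ := by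
  have := isFiniteMeasure_withDensity_ofReal h₁.2
  have := isFiniteMeasure_withDensity_ofReal h₂.2
  have := isFiniteMeasure_withDensity_ofReal h₁.neg.2
  have := isFiniteMeasure_withDensity_ofReal h₂.neg.2
  -- move the negative parts to the other side to obtain two positive measures
  set p₁ := ν₁.withDensity fun k => ENNReal.ofReal (f₁ k)
  set n₁ := ν₁.withDensity fun k => ENNReal.ofReal ((-f₁) k)
  set p₂ := ν₂.withDensity fun k => ENNReal.ofReal (f₂ k)
  set n₂ := ν₂.withDensity fun k => ENNReal.ofReal ((-f₂) k)
  have hsplit : ∀ {ν : Measure (Spacetime d)} {f : Spacetime d → ℝ}, Integrable f ν → ∀ x,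
      ∫ k, (f k : ℂ) * phase x k ∂ν =
        ∫ k, phase x k ∂(ν.withDensity fun k => ENNReal.ofReal (f k)) -
        ∫ k, phase x k ∂(ν.withDensity fun k => ENNReal.ofReal ((-f) k)) := by
    intro ν f hf x
    rw [integral_phase_withDensity hf, integral_phase_withDensity hf.neg, ← integral_sub]
    · congr 1; ext k
      rw [← sub_mul, ← Complex.ofReal_sub, Pi.neg_apply, max_zero_sub_max_neg_zero_eq_self]
    · exact integrable_mul_phase hf.pos_part.ofReal x
    · exact integrable_mul_phase hf.neg.pos_part.ofReal x
  have hphase : ∀ (ν : Measure (Spacetime d)) [IsFiniteMeasure ν] (x : Spacetime d),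
      Integrable (phase x) ν := fun ν _ x =>
    (integrable_const (1 : ℝ)).mono' (continuous_phase x).aestronglyMeasurable
      (Eventually.of_forall fun k => (norm_phase x k).le)
  have hmeas : p₁ + n₂ = n₁ + p₂ := by
    refine Measure.ext_of_charFun (funext fun x => ?_)
    rw [charFun_apply, charFun_apply]
    simp_rw [← phase_lower]
    rw [integral_add_measure (hphase _ _) (hphase _ _), integral_add_measure (hphase _ _) (hphase _ _)]
    have h3 := h (lower x)
    rw [hsplit h₁, hsplit h₂] at h3
    linear_combination h3
  have hset : ∀ {ν : Measure (Spacetime d)} {f : Spacetime d → ℝ}, Integrable f ν →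
      ∫ k in A, f k ∂ν = (ν.withDensity fun k => ENNReal.ofReal (f k)).real A -
        (ν.withDensity fun k => ENNReal.ofReal ((-f) k)).real A := by
    intro ν f hf
    rw [Measure.real, Measure.real, withDensity_apply _ hA, withDensity_apply _ hA]
    exact integral_eq_lintegral_pos_part_sub_lintegral_neg_part hf.restrict
  rw [hset h₁, hset h₂]
  have h4 := congrArg (fun m : Measure (Spacetime d) => m.real A) hmeas
  rw [measureReal_add_apply, measureReal_add_apply] at h4
  linarith

/-- Two integrable complex densities, with respect to two measures, that have the same Fourier
transform, define the same set function. -/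
lemma setIntegral_eq_of_integral_phase_eq {ν₁ ν₂ : Measure (Spacetime d)}
    {f₁ f₂ : Spacetime d → ℂ} (h₁ : Integrable f₁ ν₁) (h₂ : Integrable f₂ ν₂)
    (h : ∀ x, ∫ k, f₁ k * phase x k ∂ν₁ = ∫ k, f₂ k * phase x k ∂ν₂)
    {A : Set (Spacetime d)} (hA : MeasurableSet A) :
    ∫ k in A, f₁ k ∂ν₁ = ∫ k in A, f₂ k ∂ν₂ := by
  have hre : ∀ {ν : Measure (Spacetime d)} {f : Spacetime d → ℂ}, Integrable f ν → ∀ x,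
      ∫ k, ((f k).re : ℂ) * phase x k ∂ν =
        (∫ k, f k * phase x k ∂ν + star (∫ k, f k * phase (-x) k ∂ν)) / 2 := by
    intro ν f hf x
    have hc : star (∫ k, f k * phase (-x) k ∂ν) = ∫ k, star (f k) * phase x k ∂ν := by
      rw [Complex.star_def, ← integral_conj]
      congr 1; ext k
      rw [map_mul, ← Complex.star_def, star_phase, neg_neg]
    have hf' : Integrable (fun k => star (f k)) ν := by
      refine hf.mono (continuous_star.comp_aestronglyMeasurable hf.1)
        (Eventually.of_forall fun k => by rw [norm_star])
    rw [hc, ← integral_add (integrable_mul_phase hf x) (integrable_mul_phase hf' x),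
      ← integral_div]
    congr 1; ext k
    rw [← add_mul, Complex.star_def, Complex.add_conj]
    push_cast; ring
  have key : ∀ {f₁ f₂ : Spacetime d → ℂ}, Integrable f₁ ν₁ → Integrable f₂ ν₂ →
      (∀ x, ∫ k, f₁ k * phase x k ∂ν₁ = ∫ k, f₂ k * phase x k ∂ν₂) →
      ∫ k in A, (f₁ k).re ∂ν₁ = ∫ k in A, (f₂ k).re ∂ν₂ := by
    intro f₁ f₂ h₁ h₂ h
    refine setIntegral_eq_of_integral_phase_eq_real h₁.re h₂.re (fun x => ?_) hA
    simp only [RCLike.re_eq_complex_re]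
    rw [hre h₁, hre h₂, h, h]
  have h3 := key h₁ h₂ h
  have h4 := key (h₁.const_mul (-Complex.I)) (h₂.const_mul (-Complex.I)) (fun x => by
    simp_rw [mul_assoc]
    rw [integral_const_mul, integral_const_mul, h])
  simp only [neg_mul, Complex.neg_re, Complex.I_mul_re, neg_neg] at h4
  have e1 := integral_re_add_im h₁.restrict (μ := ν₁.restrict A)
  have e2 := integral_re_add_im h₂.restrict (μ := ν₂.restrict A)
  simp only [RCLike.re_eq_complex_re, RCLike.im_eq_complex_im] at e1 e2
  rw [← e1, ← e2, h3, h4]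

end Uniqueness

/-! ### The absolutely continuous part of the momentum measure -/

section AbsolutelyContinuous

variable {d : ℕ} {μ : Measure (Spacetime d)}

/-- The density `w` of the absolutely continuous part of `μ`. -/
def acDensity (μ : Measure (Spacetime d)) (k : Spacetime d) : ℝ := (μ.rnDeriv volume k).toReal

lemma acDensity_nonneg (k : Spacetime d) : 0 ≤ acDensity μ k := ENNReal.toReal_nonneg

lemma measurable_acDensity : Measurable (acDensity μ) := (Measure.measurable_rnDeriv μ volume).ennreal_toReal

lemma ae_of_ae_acPart {p : Spacetime d → Prop} (h : ∀ᵐ k ∂μ, p k) :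
    ∀ᵐ k ∂(volume : Measure (Spacetime d)), μ.rnDeriv volume k ≠ 0 → p k :=
  (ae_withDensity_iff (Measure.measurable_rnDeriv μ volume)).1
    (ae_mono (Measure.withDensity_rnDeriv_le μ volume) h)

variable [SigmaFinite μ]

lemma acDensity_eq_zero_iff : ∀ᵐ k ∂(volume : Measure (Spacetime d)),
    acDensity μ k = 0 ↔ μ.rnDeriv volume k = 0 := by
  filter_upwards [Measure.rnDeriv_lt_top μ volume] with k hk
  rw [acDensity, ENNReal.toReal_eq_zero_iff]
  simp [hk.ne]

variable (μ) in
/-- A set of full Lebesgue measure on which `μ` is absolutely continuous. -/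
def acSet : Set (Spacetime d) := (Measure.mutuallySingular_singularPart μ volume).nullSet

omit [SigmaFinite μ] in
lemma measurableSet_acSet : MeasurableSet (acSet μ) := Measure.MutuallySingular.measurableSet_nullSet _

omit [SigmaFinite μ] in
lemma volume_compl_acSet : volume (acSet μ)ᶜ = 0 := Measure.MutuallySingular.measure_compl_nullSet _

lemma restrict_acSet : μ.restrict (acSet μ) =
    (volume.withDensity (μ.rnDeriv volume)).restrict (acSet μ) := by
  have h := congrArg (fun m : Measure (Spacetime d) => m.restrict (acSet μ))
    (Measure.singularPart_add_rnDeriv μ volume)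
  rw [← h]
  rw [Measure.restrict_add, (Measure.restrict_eq_zero (s := acSet μ)).2
    (Measure.MutuallySingular.measure_nullSet _), zero_add]

omit [SigmaFinite μ] in
lemma withDensity_rnDeriv_restrict_acSet :
    (volume.withDensity (μ.rnDeriv volume)).restrict (acSet μ) =
      volume.withDensity (μ.rnDeriv volume) := by
  refine Measure.restrict_eq_self_of_ae_mem ?_
  exact (withDensity_absolutelyContinuous volume _).ae_le
    (by rw [← Set.ofPred_mem_eq (s := acSet μ)] ; exact volume_compl_acSet)

lemma integrable_acDensity_mul {F : Spacetime d → ℂ} (hF : Integrable F μ) :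
    Integrable (fun k => (acDensity μ k : ℂ) * F k) volume := by
  have h := hF.mono_measure (Measure.withDensity_rnDeriv_le μ volume)
  rw [integrable_withDensity_iff_integrable_smul' (Measure.measurable_rnDeriv μ volume)
    (Measure.rnDeriv_lt_top μ volume)] at h
  exact h

lemma setIntegral_acDensity_mul (F : Spacetime d → ℂ) {A : Set (Spacetime d)}
    (hA : MeasurableSet A) :
    ∫ k in A ∩ acSet μ, F k ∂μ = ∫ k in A, (acDensity μ k : ℂ) * F k := by
  have h1 : μ.restrict (A ∩ acSet μ) = (volume.withDensity (μ.rnDeriv volume)).restrict A := by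
    rw [← Measure.restrict_restrict hA, restrict_acSet, withDensity_rnDeriv_restrict_acSet]
  rw [h1, restrict_withDensity hA, integral_withDensity_eq_integral_toReal_smul
    (Measure.measurable_rnDeriv μ volume) (ae_restrict_of_ae (Measure.rnDeriv_lt_top μ volume))]
  rfl

end AbsolutelyContinuous

section Kernels

variable {d : ℕ} {ι : Type*} {μ : Measure (Spacetime d)} {R : ι → Set (Spacetime d)}

lemma measurable_wave (hR : ∀ σ, MeasurableSet (R σ)) (ψ : WaveSpace μ R) (σ : ι) :
    Measurable (wave ψ σ) := (Lp.stronglyMeasurable (ψ σ)).measurable.indicator (hR σ)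

lemma measurable_rescaled (hR : ∀ σ, MeasurableSet (R σ)) (ψ : WaveSpace μ R) (σ : ι) :
    Measurable (rescaled ψ σ) :=
  (Complex.measurable_ofReal.comp measurable_acDensity.sqrt).mul (measurable_wave hR ψ σ)

lemma rescaled_eq (ψ : WaveSpace μ R) (σ : ι) (k : Spacetime d) :
    rescaled ψ σ k = (√(acDensity μ k) : ℂ) * wave ψ σ k := rfl

/-! ### Operators that commute with the phases -/

/-- There is a strictly positive square-integrable function. -/
lemma exists_pos_memLp (d : ℕ) : ∃ g : Spacetime d → ℝ, Measurable g ∧ (∀ k, 0 < g k) ∧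
    MemLp (fun k => (g k : ℂ)) 2 volume := by
  obtain ⟨g, hpos, hm, hlt⟩ := exists_pos_lintegral_lt_of_sigmaFinite
    (volume : Measure (Spacetime d)) (ε := 1) one_ne_zero
  have hg : Measurable fun k => √(g k : ℝ) := hm.coe_nnreal_real.sqrt
  refine ⟨fun k => √(g k : ℝ), hg, fun k => Real.sqrt_pos.2 (by exact_mod_cast hpos k), ?_⟩
  have hg' : Measurable fun k => ((√(g k : ℝ) : ℝ) : ℂ) := Complex.measurable_ofReal.comp hg
  refine (memLp_two_iff_integrable_sq_norm hg'.aestronglyMeasurable).2 ⟨by fun_prop, ?_⟩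
  refine (lt_of_le_of_lt (lintegral_mono fun k => ?_) hlt).trans ENNReal.one_lt_top
  beta_reduce
  rw [Complex.norm_real, Real.norm_of_nonneg (Real.sqrt_nonneg _),
    Real.sq_sqrt (NNReal.coe_nonneg (g k)), Real.enorm_of_nonneg (NNReal.coe_nonneg (g k)),
    ENNReal.ofReal_coe_nnreal]

variable [NeZero d] [Countable ι] [SigmaFinite μ]

/-- An operator `T` that intertwines the phases is the multiplication by a matrix-valued function of
the momentum. Formally `T* δ_k` would be a row of this matrix; with a square-integrable function
`g > 0` in place of the delta functions, the row is `√w conj (T* g)_σ / g`. -/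
theorem exists_kernel (hR : ∀ σ, MeasurableSet (R σ))
    (T : WaveSpace μ R →L[ℂ] Lp ℂ 2 (volume : Measure (Spacetime d)))
    (hT : ∀ x ψ, T (translation μ R x ψ) = phaseMul volume x (T ψ)) :
    ∃ K : ι → Spacetime d → ℂ, (∀ σ, Measurable (K σ)) ∧
      ∀ ψ, T ψ =ᵐ[volume] fun k => ∑' σ, K σ k * rescaled ψ σ k := by
  obtain ⟨g, hgm, hgpos, hg⟩ := exists_pos_memLp d
  set η := ContinuousLinearMap.adjoint T hg.toLp with hη
  refine ⟨fun σ k => (√(acDensity μ k) : ℂ) * star (wave η σ k) / (g k : ℂ), fun σ => ?_,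
    fun ψ => ?_⟩
  · have h1 := measurable_wave hR η σ
    have h2 := measurable_acDensity (μ := μ)
    have h3 : Measurable fun k => (√(acDensity μ k) : ℂ) := Complex.measurable_ofReal.comp h2.sqrt
    have h4 : Measurable fun k => (g k : ℂ) := Complex.measurable_ofReal.comp hgm
    exact (h3.mul (continuous_star.measurable.comp h1)).div h4
  have hI1 : Integrable (fun k => (g k : ℂ) * T ψ k) volume :=
    MemLp.integrable_mul hg (Lp.memLp (T ψ))
  have hI2 := integrable_overlap hR η ψ
  -- both sides are Fourier transforms of the matrix element between `g` and the translates of `ψ`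
  have hF : ∀ x, ∫ k, ((g k : ℂ) * T ψ k) * phase x k = ∫ k, overlap η ψ k * phase x k ∂μ := by
    intro x
    have h1 : (inner ℂ hg.toLp (T (translation μ R x ψ)) : ℂ) =
        inner ℂ η (translation μ R x ψ) := by
      rw [hη, ContinuousLinearMap.adjoint_inner_left]
    rw [inner_translation hR, hT, L2.inner_def] at h1
    simp_rw [mul_comm (overlap η ψ _)]
    rw [← h1]
    refine integral_congr_ae ?_
    filter_upwards [hg.coeFn_toLp, phaseMul_ae volume x (T ψ)] with k h2 h3
    rw [h2, h3, RCLike.inner_apply, Complex.conj_ofReal]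
    ring
  have hae : (fun k => (g k : ℂ) * T ψ k) =ᵐ[volume]
      fun k => (acDensity μ k : ℂ) * overlap η ψ k := by
    refine Integrable.ae_eq_of_forall_setIntegral_eq _ _ hI1 (integrable_acDensity_mul hI2)
      fun A hA _ => ?_
    have hA' := hA.inter (measurableSet_acSet (μ := μ))
    rw [← setIntegral_acDensity_mul _ hA,
      ← setIntegral_eq_of_integral_phase_eq hI1 hI2 hF hA']
    refine setIntegral_congr_set ?_
    exact (inter_ae_eq_left_of_ae_eq_univ (ae_eq_univ.2 volume_compl_acSet)).symm
  filter_upwards [hae] with k hk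
  have hgk : (g k : ℂ) ≠ 0 := by exact_mod_cast (hgpos k).ne'
  have hw : (√(acDensity μ k) : ℂ) * √(acDensity μ k) = acDensity μ k := by
    rw [← Complex.ofReal_mul, Real.mul_self_sqrt (acDensity_nonneg k)]
  have h2 : ∀ σ, (√(acDensity μ k) : ℂ) * star (wave η σ k) / (g k : ℂ) * rescaled ψ σ k =
      (acDensity μ k : ℂ) / g k * (star (wave η σ k) * wave ψ σ k) := by
    intro σ
    rw [rescaled_eq, ← hw]; ring
  simp_rw [h2]
  rw [tsum_mul_left, div_mul_eq_mul_div, eq_div_iff hgk, mul_comm, hk]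
  rfl

end Kernels

/-! ### Square-summable amplitudes as densities -/

section AmpDensity

variable {d : ℕ} {Γ : Type*} [Countable Γ]

lemma ae_summable_amp (f : AmpSpace d Γ) :
    (∀ᵐ x ∂(volume : Measure (Spacetime d)), Summable fun γ => ‖f γ x‖ ^ 2) ∧
      Integrable (fun x => ∑' γ, ‖f γ x‖ ^ 2) volume := by
  have hint : ∀ γ, Integrable (fun x => ‖f γ x‖ ^ 2) volume := fun γ =>
    (memLp_two_iff_integrable_sq_norm (Lp.memLp (f γ)).1).1 (Lp.memLp (f γ))
  have hnn : ∀ γ (x : Spacetime d), ‖‖f γ x‖ ^ 2‖ = ‖f γ x‖ ^ 2 := fun γ x =>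
    Real.norm_of_nonneg (by positivity)
  have h := ae_summable_of_summable_integral_norm hint (by
    simp_rw [hnn, ← norm_sq_Lp]
    exact (hasSum_norm_sq_lp f).summable)
  simp_rw [hnn] at h
  exact h

lemma norm_sq_ampRestrict (f : AmpSpace d Γ) (I : Set (Spacetime d)) :
    ‖ampRestrict Γ I f‖ ^ 2 = ∫ x in I, ∑' γ, ‖f γ x‖ ^ 2 := by
  refine (hasSum_ampRestrict I f).unique (hasSum_setIntegral_norm_sq
    (fun γ => (Lp.memLp (f γ)).1) (ae_summable_amp f).2 ?_ I)
  filter_upwards [(ae_summable_amp f).1] with x hx using hx.hasSum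

lemma hasSum_norm_sq_ampRestrict (f : AmpSpace d Γ) {I : ℕ → Set (Spacetime d)}
    (hI : ∀ n, MeasurableSet (I n)) (hd : Pairwise fun m n => Disjoint (I m) (I n)) :
    HasSum (fun n => ‖ampRestrict Γ (I n) f‖ ^ 2) (‖ampRestrict Γ (⋃ n, I n) f‖ ^ 2) := by
  simp_rw [norm_sq_ampRestrict]
  exact hasSum_integral_iUnion hI hd (ae_summable_amp f).2.integrableOn

end AmpDensity

/-! ### The Fourier transform of a family -/

section AmpFourier

variable {d : ℕ} [NeZero d]

/-- The Fourier transform of all the members of a family. -/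
def ampFourier (d : ℕ) [NeZero d] (Γ : Type*) : AmpSpace d Γ →L[ℂ] AmpSpace d Γ :=
  lp.mapCLM 2 (fun _ => (covFourier (d := d)).toContinuousLinearMap) zero_le_one
    fun _ => (covFourier (d := d)).norm_toContinuousLinearMap_le

lemma ampFourier_apply {Γ : Type*} (f : AmpSpace d Γ) (γ : Γ) :
    ampFourier d Γ f γ = covFourier (f γ) := rfl

lemma norm_sq_ampFourier {Γ : Type*} (f : AmpSpace d Γ) : ‖ampFourier d Γ f‖ ^ 2 = ‖f‖ ^ 2 := by
  refine (hasSum_norm_sq_lp _).unique ?_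
  simp_rw [ampFourier_apply, LinearIsometry.norm_map]
  exact hasSum_norm_sq_lp f

end AmpFourier

/-! ### The operator of a contraction-valued kernel -/

section KernelOperator

variable {d : ℕ} {ι : Type*} {μ : Measure (Spacetime d)} {R : ι → Set (Spacetime d)}
  {Γ : Type*}

/-- The momentum amplitudes `∑_σ K_{γσ} √w ψ_σ`. -/
def momentumAmp (K : Γ → ι → Spacetime d → ℂ) (ψ : WaveSpace μ R) (γ : Γ) (k : Spacetime d) : ℂ :=
  ∑' σ, K γ σ k * rescaled ψ σ k

lemma isAmplitude_iff [NeZero d] {K : Γ → ι → Spacetime d → ℂ} {ψ : WaveSpace μ R}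
    {Ψ : Γ → Spacetime d → ℂ} : IsAmplitude K ψ Ψ ↔
      ∀ γ, ∃ hg : MemLp (momentumAmp K ψ γ) 2 volume, Ψ γ =ᵐ[volume] covFourier (hg.toLp _) :=
  forall_congr' fun _ => isFourierOf_iff

lemma isAmplitude_of_ae_eq [NeZero d] {K : Γ → ι → Spacetime d → ℂ} {ψ : WaveSpace μ R}
    {g : AmpSpace d Γ} (hg : ∀ γ, g γ =ᵐ[volume] momentumAmp K ψ γ) :
    IsAmplitude K ψ fun γ => ampFourier d Γ g γ := by
  refine isAmplitude_iff.2 fun γ => ?_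
  have hm : MemLp (momentumAmp K ψ γ) 2 volume := (Lp.memLp (g γ)).ae_eq (hg γ)
  refine ⟨hm, ?_⟩
  have h : hm.toLp _ = g γ := by
    ext1
    exact hm.coeFn_toLp.trans (hg γ).symm
  rw [h]
  exact Eventually.of_forall fun x => rfl

lemma IsAmplitude.ae_eq [NeZero d] {K : Γ → ι → Spacetime d → ℂ} {ψ : WaveSpace μ R}
    {Ψ Ψ' : Γ → Spacetime d → ℂ} (h : IsAmplitude K ψ Ψ) (h' : IsAmplitude K ψ Ψ') (γ : Γ) :
    Ψ γ =ᵐ[volume] Ψ' γ := by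
  obtain ⟨_, h1⟩ := isAmplitude_iff.1 h γ
  obtain ⟨_, h2⟩ := isAmplitude_iff.1 h' γ
  exact h1.trans h2.symm

/-- If the amplitudes of `K` are given by an operator `V`, then `τ` is given by `K` if and only if
`⟪ψ, τ(I) ψ⟫` is the square norm of `V ψ` on `I`. -/
lemma hasDensity_iff [NeZero d] [Countable Γ] {K : Γ → ι → Spacetime d → ℂ}
    {V : WaveSpace μ R → AmpSpace d Γ} (hV : ∀ ψ, IsAmplitude K ψ fun γ => V ψ γ)
    {τ : Set (Spacetime d) → WaveSpace μ R →L[ℂ] WaveSpace μ R} :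
    HasDensity τ K ↔ ∀ I, MeasurableSet I → ∀ ψ,
      inner ℂ ψ (τ I ψ) = ((‖ampRestrict Γ I (V ψ)‖ ^ 2 : ℝ) : ℂ) := by
  constructor
  · intro h I hI ψ
    obtain ⟨Ψ, hΨ, -, -, h2⟩ := h ψ
    rw [h2 I hI, norm_sq_ampRestrict]
    congr 1
    refine integral_congr_ae (ae_restrict_of_ae ?_)
    filter_upwards [ae_all_iff.2 (hΨ.ae_eq (hV ψ))] with x hx
    simp_rw [hx]
  · intro h ψ
    refine ⟨_, hV ψ, (ae_summable_amp (V ψ)).1, (ae_summable_amp (V ψ)).2, fun I hI => ?_⟩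
    rw [h I hI, norm_sq_ampRestrict]

lemma tsum_norm_sq_rescaled (ψ : WaveSpace μ R) (k : Spacetime d) :
    ∑' σ, ‖rescaled ψ σ k‖ ^ 2 = acDensity μ k * ∑' σ, ‖wave ψ σ k‖ ^ 2 := by
  rw [← tsum_mul_left]
  congr 1; ext σ
  rw [rescaled_eq, norm_mul, mul_pow, Complex.norm_real, Real.norm_of_nonneg (Real.sqrt_nonneg _),
    Real.sq_sqrt (acDensity_nonneg k)]

lemma rescaled_of_rnDeriv_eq_zero (ψ : WaveSpace μ R) (σ : ι) {k : Spacetime d}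
    (hk : μ.rnDeriv volume k = 0) : rescaled ψ σ k = 0 := by
  rw [rescaled_eq, acDensity, hk]; simp

lemma integral_tsum_rescaled [SigmaFinite μ] (ψ : WaveSpace μ R)
    {A : Set (Spacetime d)} (hA : MeasurableSet A) :
    ∫ k in A, ∑' σ, ‖rescaled ψ σ k‖ ^ 2 = ∫ k in A ∩ acSet μ, ∑' σ, ‖wave ψ σ k‖ ^ 2 ∂μ := by
  have h := setIntegral_acDensity_mul (μ := μ) (overlap ψ ψ) hA
  simp_rw [overlap_self, ← Complex.ofReal_mul, ← tsum_norm_sq_rescaled] at h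
  rw [integral_complex_ofReal, integral_complex_ofReal] at h
  exact_mod_cast h.symm

variable [Countable ι]

lemma ae_summable_rescaled (hR : ∀ σ, MeasurableSet (R σ)) (ψ : WaveSpace μ R) :
    ∀ᵐ k ∂(volume : Measure (Spacetime d)), Summable fun σ => ‖rescaled ψ σ k‖ ^ 2 := by
  filter_upwards [ae_of_ae_acPart (ae_summable_wave hR ψ)] with k hk
  by_cases h0 : μ.rnDeriv volume k = 0
  · simp [rescaled_of_rnDeriv_eq_zero ψ _ h0]
  · refine ((hk h0).mul_left (acDensity μ k)).congr fun σ => ?_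
    rw [rescaled_eq, norm_mul, mul_pow, Complex.norm_real,
      Real.norm_of_nonneg (Real.sqrt_nonneg _), Real.sq_sqrt (acDensity_nonneg k)]

lemma ae_momentumAmp (hR : ∀ σ, MeasurableSet (R σ)) {K : Γ → ι → Spacetime d → ℂ}
    (hK : IsContraction μ R K) (ψ : WaveSpace μ R) :
    ∀ᵐ k ∂(volume : Measure (Spacetime d)),
      (∀ γ, Summable fun σ => K γ σ k * rescaled ψ σ k) ∧
      (Summable fun γ => ‖momentumAmp K ψ γ k‖ ^ 2) ∧
      ∑' γ, ‖momentumAmp K ψ γ k‖ ^ 2 ≤ ∑' σ, ‖rescaled ψ σ k‖ ^ 2 := by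
  filter_upwards [hK, ae_summable_rescaled hR ψ] with k hk hs
  by_cases h0 : μ.rnDeriv volume k = 0
  · simp [momentumAmp, rescaled_of_rnDeriv_eq_zero ψ _ h0, summable_zero]
  · refine hk h0 (fun σ => rescaled ψ σ k) (fun σ hσ => ?_) hs
    rw [rescaled_eq, wave_of_notMem ψ hσ, mul_zero]

lemma momentumAmp_translation [NeZero d] (hR : ∀ σ, MeasurableSet (R σ))
    (K : Γ → ι → Spacetime d → ℂ) (x : Spacetime d) (ψ : WaveSpace μ R) (γ : Γ) :
    momentumAmp K (translation μ R x ψ) γ =ᵐ[volume] fun k => phase x k * momentumAmp K ψ γ k := by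
  filter_upwards [ae_of_ae_acPart (ae_all_iff.2 (wave_translation hR x ψ))] with k h3
  rw [momentumAmp, momentumAmp, ← tsum_mul_left]
  congr 1; ext σ
  by_cases h0 : μ.rnDeriv volume k = 0
  · simp [rescaled_of_rnDeriv_eq_zero _ _ h0]
  · rw [rescaled_eq, rescaled_eq, h3 h0]; ring

variable [SigmaFinite μ]

lemma integrable_tsum_rescaled (hR : ∀ σ, MeasurableSet (R σ)) (ψ : WaveSpace μ R) :
    Integrable (fun k => ∑' σ, ‖rescaled ψ σ k‖ ^ 2) volume := by
  simp_rw [tsum_norm_sq_rescaled]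
  refine (integrable_acDensity_mul (integrable_overlap hR ψ ψ)).re.congr
    (Eventually.of_forall fun k => ?_)
  simp only [overlap_self, ← Complex.ofReal_mul, RCLike.re_eq_complex_re, Complex.ofReal_re]

lemma integral_tsum_rescaled_le (hR : ∀ σ, MeasurableSet (R σ)) (ψ : WaveSpace μ R) :
    ∫ k, ∑' σ, ‖rescaled ψ σ k‖ ^ 2 ≤ ‖ψ‖ ^ 2 := by
  rw [← setIntegral_univ, integral_tsum_rescaled ψ .univ, norm_sq_eq_integral hR]
  exact setIntegral_le_integral (integrable_density hR ψ)
    (Eventually.of_forall fun k => tsum_nonneg fun σ => by positivity)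

variable [Countable Γ]

/-- The amplitudes of a contraction-valued kernel are the values of a contraction operator. -/
theorem exists_momentum_operator (hR : ∀ σ, MeasurableSet (R σ)) {K : Γ → ι → Spacetime d → ℂ}
    (hKm : ∀ γ σ, Measurable (K γ σ)) (hK : IsContraction μ R K) :
    ∃ G : WaveSpace μ R →L[ℂ] AmpSpace d Γ, (∀ ψ γ, G ψ γ =ᵐ[volume] momentumAmp K ψ γ) ∧
      (∀ ψ : WaveSpace μ R, Integrable (fun k => ∑' γ, ‖momentumAmp K ψ γ k‖ ^ 2) volume) ∧
      ∀ ψ, ‖G ψ‖ ^ 2 = ∫ k, ∑' γ, ‖momentumAmp K ψ γ k‖ ^ 2 := by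
  have hmeas : ∀ (ψ : WaveSpace μ R) γ, Measurable (momentumAmp K ψ γ) := fun ψ γ =>
    Measurable.tsum fun σ => (hKm γ σ).mul (measurable_rescaled hR ψ σ)
  have hQ : ∀ ψ : WaveSpace μ R, Integrable (fun k => ∑' γ, ‖momentumAmp K ψ γ k‖ ^ 2) volume := by
    intro ψ
    refine (integrable_tsum_rescaled hR ψ).mono'
      (Measurable.tsum fun γ => (hmeas ψ γ).norm.pow_const 2).aestronglyMeasurable ?_
    filter_upwards [ae_momentumAmp hR hK ψ] with k hk
    rw [Real.norm_of_nonneg (tsum_nonneg fun γ => by positivity)]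
    exact hk.2.2
  have hsum : ∀ ψ : WaveSpace μ R, ∀ᵐ k ∂volume, HasSum (fun γ => ‖momentumAmp K ψ γ k‖ ^ 2)
      (∑' γ, ‖momentumAmp K ψ γ k‖ ^ 2) := by
    intro ψ
    filter_upwards [ae_momentumAmp hR hK ψ] with k hk using hk.2.1.hasSum
  have hmem : ∀ (ψ : WaveSpace μ R) γ, MemLp (momentumAmp K ψ γ) 2 volume := fun ψ γ =>
    memLp_two_of_hasSum (fun γ => (hmeas ψ γ).aestronglyMeasurable) (hQ ψ) (hsum ψ) γ
  have hnorm : ∀ ψ : WaveSpace μ R, HasSum (fun γ => ‖(hmem ψ γ).toLp‖ ^ 2)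
      (∫ k, ∑' γ, ‖momentumAmp K ψ γ k‖ ^ 2) := by
    intro ψ
    have h := hasSum_setIntegral_norm_sq (fun γ => (hmeas ψ γ).aestronglyMeasurable) (hQ ψ)
      (hsum ψ) Set.univ
    simpa only [norm_sq_toLp, setIntegral_univ] using h
  have hadd : ∀ (φ ψ : WaveSpace μ R) γ,
      momentumAmp K (φ + ψ) γ =ᵐ[volume] momentumAmp K φ γ + momentumAmp K ψ γ := by
    intro φ ψ γ
    filter_upwards [ae_momentumAmp hR hK φ, ae_momentumAmp hR hK ψ,
      ae_of_ae_acPart (ae_all_iff.2 (wave_add hR φ ψ))] with k h1 h2 h3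
    rw [Pi.add_apply, momentumAmp, momentumAmp, momentumAmp, ← (h1.1 γ).tsum_add (h2.1 γ)]
    congr 1; ext σ
    by_cases h0 : μ.rnDeriv volume k = 0
    · simp [rescaled_of_rnDeriv_eq_zero _ _ h0]
    · rw [rescaled_eq, rescaled_eq, rescaled_eq, h3 h0]; ring
  have hsmul : ∀ (c : ℂ) (ψ : WaveSpace μ R) γ,
      momentumAmp K (c • ψ) γ =ᵐ[volume] c • momentumAmp K ψ γ := by
    intro c ψ γ
    filter_upwards [ae_of_ae_acPart (ae_all_iff.2 (wave_smul hR c ψ))] with k h3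
    rw [Pi.smul_apply, momentumAmp, momentumAmp, smul_eq_mul, ← tsum_mul_left]
    congr 1; ext σ
    by_cases h0 : μ.rnDeriv volume k = 0
    · simp [rescaled_of_rnDeriv_eq_zero _ _ h0]
    · rw [rescaled_eq, rescaled_eq, h3 h0]; ring
  let G₀ : WaveSpace μ R →ₗ[ℂ] AmpSpace d Γ :=
    familyMap (momentumAmp K) hmem hadd hsmul fun ψ => (hnorm ψ).summable
  have hG₀ : ∀ ψ, ‖G₀ ψ‖ ^ 2 = ∫ k, ∑' γ, ‖momentumAmp K ψ γ k‖ ^ 2 := fun ψ =>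
    (hasSum_norm_sq_lp (G₀ ψ)).unique (hnorm ψ)
  refine ⟨G₀.mkContinuous 1 fun ψ => ?_, fun ψ γ => (hmem ψ γ).coeFn_toLp, hQ, hG₀⟩
  rw [one_mul]
  refine le_of_sq_le_sq ?_ (norm_nonneg _)
  rw [hG₀]
  refine (integral_mono_ae (hQ ψ) (integrable_tsum_rescaled hR ψ) ?_).trans
    (integral_tsum_rescaled_le hR ψ)
  filter_upwards [ae_momentumAmp hR hK ψ] with k hk using hk.2.2

end KernelOperator

/-! ### Matrices that are contractions on finite families -/

section FiniteContraction

variable {Γ ι : Type*}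

/-- A matrix whose finite blocks are contractions is a contraction of `ℓ²`. -/
lemma contraction_of_finite {a : Γ → ι → ℂ}
    (h : ∀ (t : Finset Γ) (s : Finset ι) (c : ι → ℂ),
      ∑ γ ∈ t, ‖∑ σ ∈ s, a γ σ * c σ‖ ^ 2 ≤ ∑ σ ∈ s, ‖c σ‖ ^ 2)
    {c : ι → ℂ} (hc : Summable fun σ => ‖c σ‖ ^ 2) :
    (∀ γ, Summable fun σ => a γ σ * c σ) ∧
      (Summable fun γ => ‖∑' σ, a γ σ * c σ‖ ^ 2) ∧
      ∑' γ, ‖∑' σ, a γ σ * c σ‖ ^ 2 ≤ ∑' σ, ‖c σ‖ ^ 2 := by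
  have hnn : ∀ σ, 0 ≤ ‖c σ‖ ^ 2 := fun σ => by positivity
  have hrow : ∀ γ, Summable fun σ => a γ σ * c σ := by
    intro γ
    refine Summable.of_norm ?_
    refine summable_of_sum_le (c := √(∑' σ, ‖c σ‖ ^ 2)) (fun σ => norm_nonneg _) fun s => ?_
    refine Real.le_sqrt_of_sq_le ?_
    -- the phases of the coefficients are turned so that all the terms of the row add up
    set u : ι → ℂ := fun σ => star (a γ σ * c σ) / ‖a γ σ * c σ‖ with hu
    have hu1 : ∀ σ, ‖u σ‖ ≤ 1 := fun σ => by
      rw [hu]; simp only [norm_div, norm_star, Complex.norm_real, norm_norm]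
      exact div_self_le_one _
    have hu2 : ∀ σ, a γ σ * (c σ * u σ) = ((‖a γ σ * c σ‖ : ℝ) : ℂ) := fun σ => by
      rw [← mul_assoc, hu]
      simp only [Complex.star_def]
      rw [mul_div_assoc', Complex.mul_conj, Complex.normSq_eq_norm_sq]
      by_cases h0 : ‖a γ σ * c σ‖ = 0
      · rw [h0]; simp
      · rw [div_eq_iff (by exact_mod_cast h0)]; push_cast; ring
    have h1 := h {γ} s (fun σ => c σ * u σ)
    rw [Finset.sum_singleton, Finset.sum_congr rfl fun σ _ => hu2 σ, ← Complex.ofReal_sum, Complex.norm_real,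
      Real.norm_of_nonneg (Finset.sum_nonneg fun σ _ => norm_nonneg _)] at h1
    refine h1.trans ((Finset.sum_le_sum fun σ _ => ?_).trans (hc.sum_le_tsum s fun σ _ => hnn σ))
    rw [norm_mul]
    exact pow_le_pow_left₀ (by positivity) (mul_le_of_le_one_right (norm_nonneg _) (hu1 σ)) 2
  have hfin : ∀ t : Finset Γ, ∑ γ ∈ t, ‖∑' σ, a γ σ * c σ‖ ^ 2 ≤ ∑' σ, ‖c σ‖ ^ 2 := by
    intro t
    refine le_of_tendsto (tendsto_finsetSum t fun γ _ => ((hrow γ).hasSum.norm.pow 2))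
      (Eventually.of_forall fun s => ?_)
    exact (h t s c).trans (hc.sum_le_tsum s fun σ _ => hnn σ)
  have hs := summable_of_sum_le (fun γ => by positivity) hfin
  exact ⟨hrow, hs, hs.tsum_le_of_sum_le hfin⟩

end FiniteContraction

/-! ### Localization in momentum space -/

section Localization

variable {d : ℕ} {ι : Type*} {μ : Measure (Spacetime d)} {R : ι → Set (Spacetime d)}

/-- The part of a family of wave functions with momenta in a set. -/
lemma exists_cut (hR : ∀ σ, MeasurableSet (R σ)) (ψ : WaveSpace μ R) {A : Set (Spacetime d)}
    (hA : MeasurableSet A) :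
    ∃ φ : WaveSpace μ R, ∀ σ, wave φ σ =ᵐ[μ] A.indicator (wave ψ σ) := by
  have hm : ∀ σ, MemLp (A.indicator (ψ σ)) 2 (μ.restrict (R σ)) := fun σ =>
    (Lp.memLp (ψ σ)).indicator hA
  have hn : ∀ σ, ‖(hm σ).toLp‖ ^ 2 ≤ ‖ψ σ‖ ^ 2 := by
    intro σ
    refine pow_le_pow_left₀ (norm_nonneg _) (Lp.norm_le_norm_of_ae_le ?_) 2
    filter_upwards [(hm σ).coeFn_toLp] with k hk
    rw [hk]
    exact norm_indicator_le_norm_self _ _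
  refine ⟨⟨fun σ => (hm σ).toLp, memℓp_two_iff.2
    ((hasSum_norm_sq_lp ψ).summable.of_nonneg_of_le (fun σ => by positivity) hn)⟩, fun σ => ?_⟩
  refine (wave_congr (hR σ) (hm σ).coeFn_toLp).trans (Eventually.of_forall fun k => ?_)
  change (R σ).indicator (A.indicator (ψ σ)) k = A.indicator ((R σ).indicator (ψ σ)) k
  rw [Set.indicator_indicator, Set.indicator_indicator, Set.inter_comm]

/-- For the rescaled wave functions, which only see the absolutely continuous part of `μ`, the
restriction to `B ∩ acSet μ` is the restriction to `B`. -/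
lemma rescaled_cut {φ ψ : WaveSpace μ R} {B : Set (Spacetime d)} [Countable ι] [SigmaFinite μ]
    (h : ∀ σ, wave φ σ =ᵐ[μ] (B ∩ acSet μ).indicator (wave ψ σ)) :
    ∀ᵐ k ∂(volume : Measure (Spacetime d)), ∀ σ,
      rescaled φ σ k = B.indicator (rescaled ψ σ) k := by
  have hac : ∀ᵐ k ∂(volume : Measure (Spacetime d)), k ∈ acSet μ := volume_compl_acSet
  filter_upwards [hac, ae_of_ae_acPart (ae_all_iff.2 h)] with k h1 h2 σ
  by_cases h0 : μ.rnDeriv volume k = 0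
  · rw [rescaled_of_rnDeriv_eq_zero φ σ h0, Set.indicator_apply_eq_zero.2 fun _ =>
      rescaled_of_rnDeriv_eq_zero ψ σ h0]
  · rw [rescaled_eq, h2 h0]
    by_cases hB : k ∈ B
    · rw [Set.indicator_of_mem hB, Set.indicator_of_mem (Set.mem_inter hB h1), rescaled_eq]
    · rw [Set.indicator_of_notMem hB, Set.indicator_of_notMem fun h => hB h.1, mul_zero]

variable [Countable ι] [SigmaFinite μ]

/-- The intersection with `acSet μ` removes the contribution of the singular part to the norm. -/
lemma norm_sq_cut (hR : ∀ σ, MeasurableSet (R σ)) {φ ψ : WaveSpace μ R} {B : Set (Spacetime d)}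
    (hB : MeasurableSet B) (h : ∀ σ, wave φ σ =ᵐ[μ] (B ∩ acSet μ).indicator (wave ψ σ)) :
    ‖φ‖ ^ 2 = ∫ k in B, ∑' σ, ‖rescaled ψ σ k‖ ^ 2 := by
  rw [integral_tsum_rescaled ψ hB, norm_sq_eq_integral hR,
    ← integral_indicator (hB.inter measurableSet_acSet)]
  refine integral_congr_ae ?_
  filter_upwards [ae_all_iff.2 h] with k hk
  simp_rw [hk]
  by_cases hk : k ∈ B ∩ acSet μ
  · simp [Set.indicator_of_mem hk]
  · simp [Set.indicator_of_notMem hk]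

variable {Γ : Type*}

/-- A bound on the norms of the amplitudes holds pointwise, since it can be applied to the parts of
`ψ` with momenta in arbitrary sets. -/
lemma ae_sum_norm_sq_momentumAmp_le (hR : ∀ σ, MeasurableSet (R σ)) {K : Γ → ι → Spacetime d → ℂ}
    {W : Γ → WaveSpace μ R → Lp ℂ 2 (volume : Measure (Spacetime d))}
    (hW : ∀ γ ψ, W γ ψ =ᵐ[volume] momentumAmp K ψ γ) {t : Finset Γ}
    (ht : ∀ ψ, ∑ γ ∈ t, ‖W γ ψ‖ ^ 2 ≤ ‖ψ‖ ^ 2) (ψ : WaveSpace μ R) :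
    ∀ᵐ k ∂(volume : Measure (Spacetime d)),
      ∑ γ ∈ t, ‖momentumAmp K ψ γ k‖ ^ 2 ≤ ∑' σ, ‖rescaled ψ σ k‖ ^ 2 := by
  have hm : ∀ ψ γ, MemLp (momentumAmp K ψ γ) 2 volume := fun ψ γ =>
    (Lp.memLp (W γ ψ)).ae_eq (hW γ ψ)
  have hi : ∀ ψ γ, Integrable (fun k => ‖momentumAmp K ψ γ k‖ ^ 2) volume := fun ψ γ =>
    (memLp_two_iff_integrable_sq_norm (hm ψ γ).1).1 (hm ψ γ)
  refine ae_le_of_forall_setIntegral_le (integrable_finsetSum t fun γ _ => hi ψ γ)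
    (integrable_tsum_rescaled hR ψ) fun B hB _ => ?_
  obtain ⟨φ, hφ⟩ := exists_cut hR ψ (hB.inter (measurableSet_acSet (μ := μ)))
  rw [← norm_sq_cut hR hB hφ]
  refine le_trans (le_of_eq ?_) (ht φ)
  rw [integral_finsetSum t fun γ _ => (hi ψ γ).integrableOn]
  refine Finset.sum_congr rfl fun γ _ => ?_
  rw [norm_sq_Lp, ← integral_indicator hB]
  refine integral_congr_ae ?_
  filter_upwards [hW γ φ, rescaled_cut hφ] with k h1 h2
  rw [h1, momentumAmp]
  simp_rw [h2]
  by_cases hk : k ∈ B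
  · simp [Set.indicator_of_mem hk, momentumAmp]
  · simp [Set.indicator_of_notMem hk]

/-- Momentum-independent coefficients `c_σ`, with the momenta confined to a set of finite measure,
are admissible wave functions. -/
lemma exists_rescaled_packet (hR : ∀ σ, MeasurableSet (R σ)) {c : ι → ℂ}
    (hc : Summable fun σ => ‖c σ‖ ^ 2) (n : ℕ) :
    ∃ ψ : WaveSpace μ R, ∀ᵐ k ∂(volume : Measure (Spacetime d)), k ∈ spanningSets μ n → ∀ σ,
      rescaled ψ σ k = (√(acDensity μ k) : ℂ) * (R σ).indicator (fun _ => c σ) k := by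
  obtain ⟨ψ, hψ⟩ := exists_wavePacket hR hc (measurableSet_spanningSets μ n)
    (measure_spanningSets_lt_top μ n).ne
  refine ⟨ψ, ?_⟩
  filter_upwards [ae_of_ae_acPart (ae_all_iff.2 hψ)] with k hk hkn σ
  by_cases h0 : μ.rnDeriv volume k = 0
  · rw [rescaled_of_rnDeriv_eq_zero ψ σ h0, acDensity, h0]; simp
  · rw [rescaled_eq, hk h0, Set.indicator_of_mem hkn, Pi.one_apply, one_mul]

/-- A kernel which defines a contraction operator is a contraction at almost all momenta. -/
theorem isContraction_of_operator [Countable Γ] (hR : ∀ σ, MeasurableSet (R σ))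
    {K : Γ → ι → Spacetime d → ℂ}
    {W : Γ → WaveSpace μ R → Lp ℂ 2 (volume : Measure (Spacetime d))}
    (hW : ∀ γ ψ, W γ ψ =ᵐ[volume] momentumAmp K ψ γ)
    (ht : ∀ (t : Finset Γ) ψ, ∑ γ ∈ t, ‖W γ ψ‖ ^ 2 ≤ ‖ψ‖ ^ 2) : IsContraction μ R K := by
  classical
  -- a countable dense set of coefficients in a finite set of components
  let e : ℕ → Finset ι → ι → ℂ := fun m s => (s : Set ι).indicator (TopologicalSpace.denseSeq (ι → ℂ) m)
  have he : ∀ m s, Summable fun σ => ‖e m s σ‖ ^ 2 := fun m s =>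
    summable_of_ne_finset_zero (s := s) fun σ hσ => by
      rw [show e m s σ = 0 from Set.indicator_of_notMem (by simpa using hσ) _]; simp
  choose ψ hψ using fun m s n => exists_rescaled_packet (μ := μ) hR (he m s) n
  filter_upwards [ae_all_iff.2 fun m => ae_all_iff.2 fun s => ae_all_iff.2 fun n => hψ m s n,
    ae_all_iff.2 fun m => ae_all_iff.2 fun s => ae_all_iff.2 fun n => ae_all_iff.2 fun t =>
      ae_sum_norm_sq_momentumAmp_le hR hW (ht t) (ψ m s n),
    acDensity_eq_zero_iff (μ := μ)] with k h1 h2 h3 h0 c hcR hc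
  have hw : 0 < acDensity μ k := lt_of_le_of_ne (acDensity_nonneg k) fun h => h0 (h3.1 h.symm)
  obtain ⟨n, hn⟩ := Set.mem_iUnion.1
    ((iUnion_spanningSets μ).symm ▸ Set.mem_univ k : k ∈ ⋃ n, spanningSets μ n)
  -- the matrix of `K(k)` on the fibre at `k`
  let a : Γ → ι → ℂ := fun γ σ => if k ∈ R σ then K γ σ k else 0
  have hac : ∀ γ, (fun σ => a γ σ * c σ) = fun σ => K γ σ k * c σ := by
    intro γ; ext σ
    by_cases hk : k ∈ R σ
    · simp [a, hk]
    · simp [a, hcR σ hk]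
  have hfin : ∀ (t : Finset Γ) (s : Finset ι) (c : ι → ℂ),
      ∑ γ ∈ t, ‖∑ σ ∈ s, a γ σ * c σ‖ ^ 2 ≤ ∑ σ ∈ s, ‖c σ‖ ^ 2 := by
    intro t s
    refine fun c => (TopologicalSpace.denseRange_denseSeq (ι → ℂ)).induction_on
      (p := fun c => ∑ γ ∈ t, ‖∑ σ ∈ s, a γ σ * c σ‖ ^ 2 ≤ ∑ σ ∈ s, ‖c σ‖ ^ 2) c
      (isClosed_le (by fun_prop) (by fun_prop)) fun m => ?_
    have h4 := h2 m s n t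
    have h5 := h1 m s n hn
    have hw2 : ‖(√(acDensity μ k) : ℂ)‖ ^ 2 = acDensity μ k := by
      rw [Complex.norm_real, Real.norm_of_nonneg (Real.sqrt_nonneg _), Real.sq_sqrt hw.le]
    have h6 : ∀ γ, momentumAmp K (ψ m s n) γ k = (√(acDensity μ k) : ℂ) *
        ∑ σ ∈ s, a γ σ * TopologicalSpace.denseSeq (ι → ℂ) m σ := by
      intro γ
      rw [momentumAmp, tsum_eq_sum (s := s), Finset.mul_sum]
      · refine Finset.sum_congr rfl fun σ hσ => ?_
        rw [h5, Set.indicator_apply]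
        have : e m s σ = TopologicalSpace.denseSeq (ι → ℂ) m σ :=
          Set.indicator_of_mem (by simpa using hσ) _
        rw [this]
        by_cases hk : k ∈ R σ
        · simp [a, hk]; ring
        · simp [a, hk]
      · intro σ hσ
        have : e m s σ = 0 := Set.indicator_of_notMem (by simpa using hσ) _
        rw [h5, Set.indicator_apply, this]; simp
    have h7 : ∑' σ, ‖rescaled (ψ m s n) σ k‖ ^ 2 ≤
        acDensity μ k * ∑ σ ∈ s, ‖TopologicalSpace.denseSeq (ι → ℂ) m σ‖ ^ 2 := by
      rw [tsum_eq_sum (s := s), Finset.mul_sum]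
      · refine Finset.sum_le_sum fun σ hσ => ?_
        have : e m s σ = TopologicalSpace.denseSeq (ι → ℂ) m σ :=
          Set.indicator_of_mem (by simpa using hσ) _
        rw [h5, norm_mul, mul_pow, hw2, this]
        gcongr
        exact norm_indicator_le_norm_self (fun _ => TopologicalSpace.denseSeq (ι → ℂ) m σ) k
      · intro σ hσ
        have : e m s σ = 0 := Set.indicator_of_notMem (by simpa using hσ) _
        rw [h5, Set.indicator_apply, this]; simp
    simp_rw [h6, norm_mul, mul_pow, hw2, ← Finset.mul_sum] at h4
    exact le_of_mul_le_mul_left (h4.trans h7) hw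
  have h := contraction_of_finite hfin hc
  simp_rw [hac] at h
  exact h

end Localization

/-! ### The kernel of a covariant measure -/

section ExistsKernel

variable {d : ℕ} {ι : Type*} {μ : Measure (Spacetime d)} {R : ι → Set (Spacetime d)} [NeZero d]
  [Countable ι] {τ : Set (Spacetime d) → WaveSpace μ R →L[ℂ] WaveSpace μ R}

lemma translation_neg_translation (hR : ∀ σ, MeasurableSet (R σ)) (x : Spacetime d)
    (ψ : WaveSpace μ R) : translation μ R (-x) (translation μ R x ψ) = ψ := by
  rw [← (isTranslationRep_translation hR).add, neg_add_cancel,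
    (isTranslationRep_translation hR).zero, one_apply_eq_self]

lemma IsCovariant.isTranslationCovariant (hR : ∀ σ, MeasurableSet (R σ)) (hc : IsCovariant τ) :
    IsTranslationCovariant (translation μ R) τ := by
  intro I hI x u v
  rw [← (isTranslationRep_translation hR).inner_map (-x), translation_neg_translation hR,
    ← hc I hI x]
  rfl

variable [SigmaFinite μ]

/-- A bounded covariant measure is given by a contraction-valued kernel. -/
theorem exists_contraction_kernel (hR : ∀ σ, MeasurableSet (R σ)) (hτ : IsPOV τ)
    (h1 : τ Set.univ ≤ 1) (hc : IsCovariant τ) :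
    ∃ K : ℕ → ι → Spacetime d → ℂ, (∀ γ σ, Measurable (K γ σ)) ∧ IsContraction μ R K ∧
      HasDensity τ K := by
  obtain ⟨V, hV, hVU⟩ := exists_amplitude_operator (isTranslationRep_translation hR) hτ h1
    (hc.isTranslationCovariant hR)
  -- the amplitudes in momentum space intertwine the phases
  let Φ : Lp ℂ 2 (volume : Measure (Spacetime d)) ≃ₗᵢ[ℂ] Lp ℂ 2 (volume : Measure (Spacetime d)) :=
    LinearIsometryEquiv.ofSurjective covFourier covFourier_surjective
  let W : ℕ → WaveSpace μ R →L[ℂ] Lp ℂ 2 (volume : Measure (Spacetime d)) := fun n =>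
    (Φ.symm : Lp ℂ 2 (volume : Measure (Spacetime d)) ≃L[ℂ] _).toContinuousLinearMap ∘L
      lp.evalCLM ℂ (fun _ : ℕ => Lp ℂ 2 (volume : Measure (Spacetime d))) 2 n ∘L V
  have hΦW : ∀ n ψ, covFourier (W n ψ) = V ψ n := fun n ψ => Φ.apply_symm_apply (V ψ n)
  have hW : ∀ n x ψ, W n (translation μ R x ψ) = phaseMul volume x (W n ψ) := by
    intro n x ψ
    refine covFourier.injective ?_
    ext1
    have h := covFourier_phaseMul x (W n ψ)
    rw [hΦW] at h ⊢
    exact (hVU x ψ n).trans h.symm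
  choose K hKm hK using fun n => exists_kernel hR (W n) (hW n)
  refine ⟨K, hKm, isContraction_of_operator hR (W := fun n ψ => W n ψ) hK fun t ψ => ?_, ?_⟩
  · have h2 := hV Set.univ .univ ψ
    rw [norm_ampRestrict_univ] at h2
    refine le_trans ?_ (h2.symm.le.trans (quadForm_le_norm_sq h1 ψ))
    refine le_trans (le_of_eq (Finset.sum_congr rfl fun n _ => ?_))
      (sum_le_hasSum t (fun n _ => by positivity) (hasSum_norm_sq_lp (V ψ)))
    rw [← hΦW, LinearIsometry.norm_map]
  · refine (hasDensity_iff (V := V) fun ψ => isAmplitude_iff.2 fun n => ?_).2 fun I hI ψ => ?_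
    · have hm : MemLp (momentumAmp K ψ n) 2 volume := (Lp.memLp (W n ψ)).ae_eq (hK n ψ)
      refine ⟨hm, ?_⟩
      have h : hm.toLp _ = W n ψ := by
        ext1
        exact hm.coeFn_toLp.trans (hK n ψ).symm
      rw [h, hΦW]
    · rw [← hV I hI, inner_eq_quadForm (hτ.nonneg I hI)]

end ExistsKernel

/-! ### The measure of an operator into the amplitudes -/

section OperatorMeasure

variable {H H' : Type*} [NormedAddCommGroup H] [InnerProductSpace ℂ H] [NormedAddCommGroup H']
  [InnerProductSpace ℂ H']

lemma ext_inner_self {S T : H →L[ℂ] H} (h : ∀ v, inner ℂ v (S v) = inner ℂ v (T v)) : S = T := by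
  refine ContinuousLinearMap.coe_injective ((ext_inner_map (S : H →ₗ[ℂ] H) (T : H →ₗ[ℂ] H)).1
    fun v => ?_)
  rw [← inner_conj_symm, ContinuousLinearMap.coe_coe, h, inner_conj_symm]
  rfl

variable [CompleteSpace H] [CompleteSpace H']

lemma inner_adjoint_comp_self (A : H →L[ℂ] H') (v : H) :
    inner ℂ v ((ContinuousLinearMap.adjoint A ∘L A) v) = ((‖A v‖ ^ 2 : ℝ) : ℂ) := by
  rw [ContinuousLinearMap.comp_apply, ContinuousLinearMap.adjoint_inner_right,
    inner_self_eq_norm_sq_to_K]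
  push_cast; rfl

/-- Polarization of the form `‖A v‖ ^ 2`. -/
lemma inner_adjoint_comp_self_eq (A : H →L[ℂ] H') (u v : H) :
    inner ℂ u ((ContinuousLinearMap.adjoint A ∘L A) v) =
      (((‖A (u + v)‖ ^ 2 : ℝ) : ℂ) - ((‖A (u - v)‖ ^ 2 : ℝ) : ℂ) +
        (((‖A (u - Complex.I • v)‖ ^ 2 : ℝ) : ℂ) -
          ((‖A (u + Complex.I • v)‖ ^ 2 : ℝ) : ℂ)) * Complex.I) / 4 := by
  rw [ContinuousLinearMap.comp_apply, ContinuousLinearMap.adjoint_inner_right,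
    inner_eq_sum_norm_sq_div_four (𝕜 := ℂ)]
  simp only [map_add, map_sub, map_smul]
  push_cast; rfl

lemma eq_adjoint_comp_self {T : H →L[ℂ] H} {A : H →L[ℂ] H'}
    (h : ∀ v, inner ℂ v (T v) = ((‖A v‖ ^ 2 : ℝ) : ℂ)) :
    T = ContinuousLinearMap.adjoint A ∘L A :=
  ext_inner_self fun v => by rw [h, inner_adjoint_comp_self]

variable {d : ℕ} {Γ : Type*} [Countable Γ] {τ : Set (Spacetime d) → H →L[ℂ] H}
  {V : H →L[ℂ] AmpSpace d Γ}

/-- The form `⟪ψ, τ(I) ψ⟫ = ∫_I ∑_γ |(V ψ)_γ|²` defines a positive-operator-valued measure. -/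
theorem isPOV_of_operator
    (h : ∀ I, MeasurableSet I → ∀ ψ,
      inner ℂ ψ (τ I ψ) = ((‖ampRestrict Γ I (V ψ)‖ ^ 2 : ℝ) : ℂ)) : IsPOV τ := by
  have hτ : ∀ I, MeasurableSet I →
      τ I = ContinuousLinearMap.adjoint (ampRestrict Γ I ∘L V) ∘L (ampRestrict Γ I ∘L V) :=
    fun I hI => eq_adjoint_comp_self (h I hI)
  refine ⟨fun I hI => ?_, fun I hI hd φ ψ => ?_⟩
  · rw [hτ I hI, ContinuousLinearMap.nonneg_iff_isPositive]
    exact ContinuousLinearMap.isPositive_adjoint_comp_self _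
  · have hpol : ∀ I, MeasurableSet I → inner ℂ φ (τ I ψ) =
        (((‖ampRestrict Γ I (V (φ + ψ))‖ ^ 2 : ℝ) : ℂ) -
          ((‖ampRestrict Γ I (V (φ - ψ))‖ ^ 2 : ℝ) : ℂ) +
        (((‖ampRestrict Γ I (V (φ - Complex.I • ψ))‖ ^ 2 : ℝ) : ℂ) -
          ((‖ampRestrict Γ I (V (φ + Complex.I • ψ))‖ ^ 2 : ℝ) : ℂ)) * Complex.I) / 4 := by
      intro I hI
      rw [hτ I hI, inner_adjoint_comp_self_eq]
      rfl
    rw [hpol _ (MeasurableSet.iUnion hI)]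
    simp_rw [hpol _ (hI _)]
    have hs : ∀ v : H, HasSum (fun n => ((‖ampRestrict Γ (I n) (V v)‖ ^ 2 : ℝ) : ℂ))
        ((‖ampRestrict Γ (⋃ n, I n) (V v)‖ ^ 2 : ℝ) : ℂ) := fun v =>
      Complex.hasSum_ofReal.2 (hasSum_norm_sq_ampRestrict (V v) hI hd)
    exact (((hs _).sub (hs _)).add (((hs _).sub (hs _)).mul_right _)).div_const _

omit [CompleteSpace H] [Countable Γ] in
lemma le_one_of_operator (hV : ∀ ψ, ‖V ψ‖ ^ 2 ≤ ‖ψ‖ ^ 2)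
    (h : ∀ ψ, inner ℂ ψ (τ Set.univ ψ) = ((‖ampRestrict Γ Set.univ (V ψ)‖ ^ 2 : ℝ) : ℂ)) :
    τ Set.univ ≤ 1 := by
  rw [ContinuousLinearMap.le_def, ContinuousLinearMap.isPositive_iff_complex]
  intro ψ
  have h2 : inner ℂ ((1 - τ Set.univ) ψ) ψ = ((‖ψ‖ ^ 2 - ‖V ψ‖ ^ 2 : ℝ) : ℂ) := by
    rw [← inner_conj_symm, _root_.sub_apply, inner_sub_right, h, norm_ampRestrict_univ,
      one_apply_eq_self, inner_self_eq_norm_sq_to_K, map_sub, Complex.conj_ofReal]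
    push_cast
    congr 1
    exact map_pow (starRingEnd ℂ) (‖ψ‖ : ℂ) 2 |>.trans (by rw [Complex.conj_ofReal])
  rw [h2]
  refine ⟨rfl, ?_⟩
  rw [RCLike.re_eq_complex_re, Complex.ofReal_re, sub_nonneg]
  exact hV ψ

end OperatorMeasure

/-! ### The projection on the absolutely continuous subspace -/

section Projection

variable {d : ℕ} {ι : Type*} {μ : Measure (Spacetime d)} {R : ι → Set (Spacetime d)}

lemma mem_vanishing_iff (hR : ∀ σ, MeasurableSet (R σ)) {ν : Measure (Spacetime d)} {hν : ν ≤ μ}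
    {ψ : WaveSpace μ R} : ψ ∈ vanishing (R := R) ν hν ↔ ∀ σ, wave ψ σ =ᵐ[ν] 0 := by
  refine forall_congr' fun σ => ?_
  rw [ae_eq_restrict_iff_indicator_ae_eq (hR σ), Set.indicator_zero']
  rfl

variable [SigmaFinite μ]

/-- Outside the set `acSet μ` the measure `μ` is its singular part. -/
lemma ae_of_ae_singularPart {p : Spacetime d → Prop} (h : ∀ᵐ k ∂(μ.singularPart volume), p k) :
    ∀ᵐ k ∂μ, k ∉ acSet μ → p k := by
  rw [← Measure.singularPart_add_rnDeriv μ volume, ae_add_measure_iff,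
    Measure.singularPart_add_rnDeriv μ volume]
  refine ⟨h.mono fun k hk _ => hk, ?_⟩
  have hac : ∀ᵐ k ∂(volume : Measure (Spacetime d)), k ∈ acSet μ := volume_compl_acSet
  filter_upwards [(withDensity_absolutelyContinuous volume (μ.rnDeriv volume)).ae_le hac]
    with k hk hk' using absurd hk hk'

variable [Countable ι]

/-- The projection on the absolutely continuous subspace is the restriction of the wave functions to
momenta in `acSet μ`. -/
lemma inner_acProjection (hR : ∀ σ, MeasurableSet (R σ)) (ψ : WaveSpace μ R) :
    inner ℂ ψ (acProjection μ R ψ) = ((∫ k, ∑' σ, ‖rescaled ψ σ k‖ ^ 2 : ℝ) : ℂ) := by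
  obtain ⟨φ, hφ⟩ := exists_cut hR ψ (MeasurableSet.univ.inter (measurableSet_acSet (μ := μ)))
  have hmem : φ ∈ acSubspace μ R := by
    refine (mem_vanishing_iff hR).2 fun σ => ?_
    have hnull : ∀ᵐ k ∂(μ.singularPart volume), k ∉ acSet μ := by
      rw [ae_iff]
      simp only [not_not]
      exact Measure.MutuallySingular.measure_nullSet _
    filter_upwards [ae_mono (μ.singularPart_le volume) (hφ σ), hnull] with k h1 h2
    rw [h1, Set.indicator_of_notMem fun h => h2 h.2, Pi.zero_apply]
  have horth : ∀ w ∈ acSubspace μ R, inner ℂ (ψ - φ) w = 0 := by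
    intro w hw
    rw [inner_eq_integral_overlap hR]
    refine integral_eq_zero_of_ae ?_
    have hw' := ae_of_ae_singularPart (ae_all_iff.2 ((mem_vanishing_iff hR).1 hw))
    have hsub := ae_all_iff.2 (wave_add hR (ψ - φ) φ)
    rw [sub_add_cancel] at hsub
    filter_upwards [hw', ae_all_iff.2 hφ, hsub] with k h1 h2 h3
    have h : ∀ σ, star (wave (ψ - φ) σ k) * wave w σ k = 0 := by
      intro σ
      by_cases hk : k ∈ acSet μ
      · have h4 := h3 σ
        rw [h2 σ, Set.indicator_of_mem (Set.mem_inter (Set.mem_univ k) hk)] at h4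
        rw [add_eq_right.1 h4.symm, star_zero, zero_mul]
      · rw [h1 hk σ, Pi.zero_apply, mul_zero]
    exact (tsum_congr h).trans tsum_zero
  have hP : acProjection μ R ψ = φ := Submodule.eq_starProjection_of_mem_of_inner_eq_zero hmem horth
  have h := norm_sq_cut hR .univ hφ
  rw [setIntegral_univ] at h
  have h2 : inner ℂ ψ φ = inner ℂ φ φ := by
    rw [← sub_eq_zero, ← inner_sub_left, horth φ hmem]
  rw [hP, h2, inner_self_eq_norm_sq_to_K, ← h]
  push_cast; rfl

end Projection

/-! ### The fibres of a kernel -/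

section Fibre

variable {d : ℕ} {ι : Type*} {μ : Measure (Spacetime d)} {R : ι → Set (Spacetime d)}
  {Γ : Type*} {K : Γ → ι → Spacetime d → ℂ}

variable (R) in
/-- The values of the matrix `K(k)` on coefficients `c_σ` restricted to the fibre at `k`. -/
def fibreAmp (K : Γ → ι → Spacetime d → ℂ) (c : ι → ℂ) (γ : Γ) (k : Spacetime d) : ℂ :=
  ∑' σ, K γ σ k * (R σ).indicator (fun _ => c σ) k

lemma fibreAmp_single [DecidableEq ι] {k : Spacetime d} {σ : ι} (hσ : k ∈ R σ) (z : ℂ) (γ : Γ) :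
    fibreAmp R K (Pi.single σ z) γ k = K γ σ k * z := by
  rw [fibreAmp, tsum_eq_single σ]
  · rw [Set.indicator_of_mem hσ, Pi.single_eq_same]
  · intro τ hτ
    rw [Pi.single_eq_of_ne hτ]; simp

lemma tsum_pair {M : Type*} [AddCommMonoid M] [TopologicalSpace M] {f : ι → M}
    {σ σ' : ι} (hne : σ ≠ σ') (hf : ∀ τ, τ ≠ σ → τ ≠ σ' → f τ = 0) :
    ∑' τ, f τ = f σ + f σ' := by
  classical
  rw [tsum_eq_sum (s := {σ, σ'}), Finset.sum_pair hne]
  intro τ hτ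
  simp only [Finset.mem_insert, Finset.mem_singleton, not_or] at hτ
  exact hf τ hτ.1 hτ.2

variable [Countable ι] [SigmaFinite μ]

/-- If the amplitudes of all vectors have `θ` times the norm of the vector at almost all momenta,
this holds for the matrix `K(k)` on fixed coefficients. -/
lemma ae_hasSum_fibreAmp (hR : ∀ σ, MeasurableSet (R σ)) (hK : IsContraction μ R K) {θ : ℝ}
    (h : ∀ ψ : WaveSpace μ R, ∀ᵐ k ∂(volume : Measure (Spacetime d)),
      ∑' γ, ‖momentumAmp K ψ γ k‖ ^ 2 = θ * ∑' σ, ‖rescaled ψ σ k‖ ^ 2)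
    {c : ι → ℂ} (hc : Summable fun σ => ‖c σ‖ ^ 2) :
    ∀ᵐ k ∂(volume : Measure (Spacetime d)), μ.rnDeriv volume k ≠ 0 →
      HasSum (fun γ => ‖fibreAmp R K c γ k‖ ^ 2)
        (θ * ∑' σ, ‖(R σ).indicator (fun _ => c σ) k‖ ^ 2) := by
  choose ψ hψ using fun n => exists_rescaled_packet (μ := μ) hR hc n
  filter_upwards [hK, ae_all_iff.2 hψ, ae_all_iff.2 fun n => h (ψ n),
    acDensity_eq_zero_iff (μ := μ)] with k h1 h2 h3 h4 h0
  have hw : 0 < acDensity μ k := lt_of_le_of_ne (acDensity_nonneg k) fun h => h0 (h4.1 h.symm)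
  have hw2 : ‖(√(acDensity μ k) : ℂ)‖ ^ 2 = acDensity μ k := by
    rw [Complex.norm_real, Real.norm_of_nonneg (Real.sqrt_nonneg _), Real.sq_sqrt hw.le]
  obtain ⟨n, hn⟩ := Set.mem_iUnion.1
    ((iUnion_spanningSets μ).symm ▸ Set.mem_univ k : k ∈ ⋃ n, spanningSets μ n)
  have h5 := h2 n hn
  have h6 : ∀ γ, momentumAmp K (ψ n) γ k = (√(acDensity μ k) : ℂ) * fibreAmp R K c γ k := by
    intro γ
    rw [momentumAmp, fibreAmp, ← tsum_mul_left]
    congr 1; ext σ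
    rw [h5]; ring
  have h7 := h3 n
  simp_rw [h6, h5, norm_mul, mul_pow, hw2, tsum_mul_left, mul_left_comm θ] at h7
  rw [← mul_left_cancel₀ hw.ne' h7]
  refine (h1 h0 (fun σ => (R σ).indicator (fun _ => c σ) k)
    (fun σ hσ => Set.indicator_of_notMem hσ _) ?_).2.1.hasSum
  exact hc.of_nonneg_of_le (fun σ => by positivity) fun σ =>
    pow_le_pow_left₀ (norm_nonneg _) (norm_indicator_le_norm_self (fun _ => c σ) k) 2

/-- A kernel vanishes almost everywhere if and only if all its amplitudes do. -/
lemma isNull_iff (hR : ∀ σ, MeasurableSet (R σ)) (hK : IsContraction μ R K) :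
    IsNull μ R K ↔ ∀ ψ : WaveSpace μ R, ∀ᵐ k ∂(volume : Measure (Spacetime d)),
      ∑' γ, ‖momentumAmp K ψ γ k‖ ^ 2 = 0 := by
  classical
  constructor
  · intro h ψ
    filter_upwards [h] with k hk
    have h1 : ∀ γ, momentumAmp K ψ γ k = 0 := by
      intro γ
      rw [momentumAmp]
      refine (tsum_congr fun σ => ?_).trans tsum_zero
      by_cases h0 : μ.rnDeriv volume k = 0
      · rw [rescaled_of_rnDeriv_eq_zero ψ σ h0, mul_zero]
      · by_cases hσ : k ∈ R σ
        · rw [hk h0 γ σ hσ, zero_mul]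
        · rw [rescaled_eq, wave_of_notMem ψ hσ, mul_zero, mul_zero]
    simp [h1]
  · intro h
    have hs : ∀ σ : ι, Summable fun τ => ‖(Pi.single σ 1 : ι → ℂ) τ‖ ^ 2 := fun σ =>
      summable_of_ne_finset_zero (s := {σ}) fun τ hτ => by
        rw [Pi.single_eq_of_ne (by simpa using hτ)]; simp
    filter_upwards [ae_all_iff.2 fun σ => ae_hasSum_fibreAmp hR hK (θ := 0)
      (fun ψ => by simpa using h ψ) (hs σ)] with k hk h0 γ σ hσ
    have h1 := hk σ h0
    rw [zero_mul, hasSum_zero_iff_of_nonneg fun γ => by positivity] at h1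
    have h2 := congrFun h1 γ
    rw [fibreAmp_single hσ] at h2
    simpa using h2

/-- A matrix with orthonormal columns is isometric on `ℓ²`. -/
lemma tsum_norm_sq_of_orthonormal {S : Type*} {a : Γ → S → ℂ}
    (ha : ∀ σ σ', HasSum (fun γ => star (a γ σ) * a γ σ') (open Classical in if σ = σ' then 1 else 0))
    {c : S → ℂ} (hc : Summable fun σ => ‖c σ‖ ^ 2) :
    ∑' γ, ‖∑' σ, a γ σ * c σ‖ ^ 2 = ∑' σ, ‖c σ‖ ^ 2 := by
  classical
  have hsq : ∀ σ, HasSum (fun γ => ‖a γ σ‖ ^ 2) 1 := fun σ => by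
    have h := Complex.hasSum_re (ha σ σ)
    rw [if_pos rfl, Complex.one_re] at h
    refine h.congr_fun ?_
    intro γ
    rw [Complex.star_def, ← Complex.normSq_eq_conj_mul_self, Complex.normSq_eq_norm_sq,
      Complex.ofReal_re]
  let v : S → lp (fun _ : Γ => ℂ) 2 := fun σ => ⟨fun γ => a γ σ, memℓp_two_iff.2 (hsq σ).summable⟩
  have hv : Orthonormal ℂ v := by
    rw [orthonormal_iff_ite]
    intro σ σ'
    refine (lp.hasSum_inner (v σ) (v σ')).unique ?_
    refine (ha σ σ').congr_fun ?_
    intro γ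
    rw [RCLike.inner_apply, mul_comm]; rfl
  let f : lp (fun _ : S => ℂ) 2 := ⟨c, memℓp_two_iff.2 hc⟩
  set y := hv.orthogonalFamily.linearIsometry f
  have hy : HasSum (fun σ => c σ • v σ) y := hv.orthogonalFamily.hasSum_linearIsometry f
  have hyγ : ∀ γ, ∑' σ, a γ σ * c σ = y γ := by
    intro γ
    refine HasSum.tsum_eq ?_
    have h := hy.mapL (lp.evalCLM ℂ (fun _ : Γ => ℂ) 2 γ)
    refine h.congr_fun ?_
    intro σ
    exact mul_comm _ _
  simp_rw [hyγ]
  rw [(hasSum_norm_sq_lp y).tsum_eq, LinearIsometry.norm_map]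
  exact (hasSum_norm_sq_lp f).tsum_eq.symm

/-- The columns of `K(k)` are orthonormal at almost all momenta if and only if all vectors keep their
local norm. -/
lemma isIsometric_iff (hR : ∀ σ, MeasurableSet (R σ)) (hK : IsContraction μ R K) :
    IsIsometric μ R K ↔ ∀ ψ : WaveSpace μ R, ∀ᵐ k ∂(volume : Measure (Spacetime d)),
      ∑' γ, ‖momentumAmp K ψ γ k‖ ^ 2 = ∑' σ, ‖rescaled ψ σ k‖ ^ 2 := by
  classical
  constructor
  · intro h ψ
    filter_upwards [h, ae_summable_rescaled hR ψ] with k hk hs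
    by_cases h0 : μ.rnDeriv volume k = 0
    · simp [momentumAmp, rescaled_of_rnDeriv_eq_zero ψ _ h0]
    · have hsupp : ∀ σ, k ∉ R σ → rescaled ψ σ k = 0 := fun σ hσ => by
        rw [rescaled_eq, wave_of_notMem ψ hσ, mul_zero]
      have h1 := tsum_norm_sq_of_orthonormal (S := {σ // k ∈ R σ}) (a := fun γ σ => K γ σ k)
        (c := fun σ => rescaled ψ σ k)
        (fun σ σ' => by simpa only [Subtype.ext_iff] using hk h0 σ σ' σ.2 σ'.2)
        (hs.comp_injective Subtype.val_injective)
      have hsub : ∀ {M : Type} [AddCommMonoid M] [TopologicalSpace M] (f : ι → M),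
          (∀ σ, k ∉ R σ → f σ = 0) → ∑' σ : {σ // k ∈ R σ}, f σ = ∑' σ, f σ := by
        intro M _ _ f hf
        refine tsum_subtype_eq_of_support_subset (s := {σ | k ∈ R σ}) fun σ hσ => ?_
        by_contra hσ'
        exact hσ (hf σ hσ')
      rw [hsub (fun σ => ‖rescaled ψ σ k‖ ^ 2) fun σ hσ => by simp [hsupp σ hσ]] at h1
      rw [← h1]
      refine tsum_congr fun γ => ?_
      rw [momentumAmp, hsub (fun σ => K γ σ k * rescaled ψ σ k) fun σ hσ => by
        rw [hsupp σ hσ, mul_zero]]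
  · intro h
    -- the form `∑_γ |∑_σ K_{γσ} c_σ|²` is determined by its values on `e_σ`, `e_σ + e_σ'` and
    -- `e_σ + i e_σ'`
    let e : ι → ι → ℂ → ι → ℂ := fun σ σ' z => Pi.single σ 1 + Pi.single σ' z
    have hs : ∀ σ σ' z, Summable fun τ => ‖e σ σ' z τ‖ ^ 2 := fun σ σ' z =>
      summable_of_ne_finset_zero (s := {σ, σ'}) fun τ hτ => by
        simp only [Finset.mem_insert, Finset.mem_singleton, not_or] at hτ
        simp [e, Pi.single_eq_of_ne hτ.1, Pi.single_eq_of_ne hτ.2]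
    have hae := fun z => ae_all_iff.2 fun σ => ae_all_iff.2 fun σ' =>
      ae_hasSum_fibreAmp hR hK (θ := 1) (fun ψ => by simpa using h ψ) (hs σ σ' z)
    filter_upwards [hae 0, hae 1, hae Complex.I] with k k1 k2 k3 h0 σ σ' hσ hσ'
    have hdiag : ∀ σ, k ∈ R σ → HasSum (fun γ => ‖K γ σ k‖ ^ 2) 1 := by
      intro σ hσ
      have h1 := k1 σ σ h0
      have he : e σ σ 0 = Pi.single σ 1 := by simp [e]
      simp_rw [he, fibreAmp_single hσ, mul_one, one_mul] at h1
      rwa [tsum_eq_single σ, Set.indicator_of_mem hσ, Pi.single_eq_same, norm_one, one_pow] at h1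
      intro τ hτ
      rw [Pi.single_eq_of_ne hτ]; simp
    by_cases hne : σ = σ'
    · subst hne
      rw [if_pos rfl]
      refine (Complex.hasSum_ofReal.2 (hdiag σ hσ)).congr_fun ?_
      intro γ
      rw [Complex.star_def, ← Complex.normSq_eq_conj_mul_self, Complex.normSq_eq_norm_sq]
    · rw [if_neg hne]
      have hoff : ∀ z : ℂ, ‖z‖ = 1 → HasSum (fun γ => ‖fibreAmp R K (e σ σ' z) γ k‖ ^ 2)
          (1 * ∑' τ, ‖(R τ).indicator (fun _ => e σ σ' z τ) k‖ ^ 2) →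
          HasSum (fun γ => ‖K γ σ k + K γ σ' k * z‖ ^ 2) 2 := by
        intro z hz hsum
        have e1 : e σ σ' z σ = 1 := by simp [e, hne]
        have e2 : e σ σ' z σ' = z := by simp [e, Ne.symm hne]
        have e3 : ∀ τ, τ ≠ σ → τ ≠ σ' → e σ σ' z τ = 0 := fun τ h1 h2 => by simp [e, h1, h2]
        rw [tsum_pair hne (fun τ h1 h2 => by simp [e3 τ h1 h2]), Set.indicator_of_mem hσ,
          Set.indicator_of_mem hσ', e1, e2, hz] at hsum
        have hamp : ∀ γ, fibreAmp R K (e σ σ' z) γ k = K γ σ k + K γ σ' k * z := by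
          intro γ
          rw [fibreAmp, tsum_pair hne (fun τ h1 h2 => by simp [e3 τ h1 h2]),
            Set.indicator_of_mem hσ, Set.indicator_of_mem hσ', e1, e2, mul_one]
        simp_rw [hamp] at hsum
        convert hsum using 1
        norm_num
      have a1 := hdiag σ hσ
      have a2 := hdiag σ' hσ'
      have a3 := hoff 1 norm_one (k2 σ σ' h0)
      have a4 := hoff Complex.I Complex.norm_I (k3 σ σ' h0)
      have b1 := Complex.hasSum_ofReal.2 ((a3.sub a1).sub a2)
      have b2 := Complex.hasSum_ofReal.2 ((a4.sub a1).sub a2)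
      have b3 := (b1.sub (b2.mul_left Complex.I)).div_const 2
      have hz : (((2 - 1 - 1 : ℝ) : ℂ) - Complex.I * ((2 - 1 - 1 : ℝ) : ℂ)) / 2 = 0 := by norm_num
      rw [hz] at b3
      refine b3.congr_fun ?_
      intro γ
      simp only [Complex.sq_norm]
      apply Complex.ext <;>
      simp [Complex.normSq_apply] <;> ring

end Fibre

/-! ### The measure of a contraction-valued kernel -/

section KernelMeasure

variable {d : ℕ} [NeZero d] {ι : Type*} [Countable ι] {μ : Measure (Spacetime d)} [SigmaFinite μ]
  {R : ι → Set (Spacetime d)} {Γ : Type*} [Countable Γ] {K : Γ → ι → Spacetime d → ℂ}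

/-- The amplitudes of a contraction-valued kernel are given by a contraction operator `V` which
turns the phases `exp(i x_α k^α)` into translations. -/
theorem exists_kernel_amplitudes (hR : ∀ σ, MeasurableSet (R σ))
    (hKm : ∀ γ σ, Measurable (K γ σ)) (hK : IsContraction μ R K) :
    ∃ V : WaveSpace μ R →L[ℂ] AmpSpace d Γ, (∀ ψ, IsAmplitude K ψ fun γ => V ψ γ) ∧
      (∀ ψ : WaveSpace μ R, Integrable (fun k => ∑' γ, ‖momentumAmp K ψ γ k‖ ^ 2) volume) ∧
      (∀ ψ, ‖V ψ‖ ^ 2 = ∫ k, ∑' γ, ‖momentumAmp K ψ γ k‖ ^ 2) ∧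
      ∀ x ψ γ, V (translation μ R x ψ) γ =ᵐ[volume] fun y => V ψ γ (y - x) := by
  obtain ⟨G, hG, hi, hn⟩ := exists_momentum_operator hR hKm hK
  refine ⟨ampFourier d Γ ∘L G, fun ψ => isAmplitude_of_ae_eq (hG ψ), hi, fun ψ => ?_,
    fun x ψ γ => ?_⟩
  · rw [← hn, ← norm_sq_ampFourier (G ψ)]
    rfl
  · have h : G (translation μ R x ψ) γ = phaseMul volume x (G ψ γ) := by
      ext1
      filter_upwards [hG (translation μ R x ψ) γ, hG ψ γ, phaseMul_ae volume x (G ψ γ),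
        momentumAmp_translation hR K x ψ γ] with k h1 h2 h3 h4
      rw [h1, h3, h4, h2]
    change covFourier (G (translation μ R x ψ) γ) =ᵐ[volume] fun y => covFourier (G ψ γ) (y - x)
    rw [h]
    exact covFourier_phaseMul x (G ψ γ)

theorem exists_hasDensity (hR : ∀ σ, MeasurableSet (R σ)) (hKm : ∀ γ σ, Measurable (K γ σ))
    (hK : IsContraction μ R K) :
    ∃ τ : Set (Spacetime d) → WaveSpace μ R →L[ℂ] WaveSpace μ R, HasDensity τ K := by
  obtain ⟨V, hV, -⟩ := exists_kernel_amplitudes hR hKm hK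
  exact ⟨fun I => ContinuousLinearMap.adjoint (ampRestrict Γ I ∘L V) ∘L (ampRestrict Γ I ∘L V),
    (hasDensity_iff hV).2 fun I _ ψ => inner_adjoint_comp_self _ ψ⟩

omit [SigmaFinite μ] in
/-- A measure with the density of an operator that turns phases into translations is covariant. -/
lemma isCovariant_of_operator (hR : ∀ σ, MeasurableSet (R σ))
    {τ : Set (Spacetime d) → WaveSpace μ R →L[ℂ] WaveSpace μ R}
    {V : WaveSpace μ R → AmpSpace d Γ}
    (hVU : ∀ x ψ γ, V (translation μ R x ψ) γ =ᵐ[volume] fun y => V ψ γ (y - x))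
    (h : ∀ I, MeasurableSet I → ∀ ψ,
      inner ℂ ψ (τ I ψ) = ((‖ampRestrict Γ I (V ψ)‖ ^ 2 : ℝ) : ℂ)) : IsCovariant τ := by
  intro I hI x
  have hemb : MeasurableEmbedding fun y : Spacetime d => y + x := measurableEmbedding_addRight x
  refine ext_inner_self fun ψ => ?_
  have h1 := (isTranslationRep_translation hR).inner_map x ψ
    (translation μ R (-x) (τ ((fun y => y + x) '' I) (translation μ R x ψ)))
  have h2 := translation_neg_translation hR (-x) (τ ((fun y => y + x) '' I) (translation μ R x ψ))
  rw [neg_neg] at h2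
  rw [h2, h _ (hemb.measurableSet_image.2 hI)] at h1
  rw [ContinuousLinearMap.comp_apply, ContinuousLinearMap.comp_apply, ← h1, h I hI,
    norm_sq_ampRestrict, norm_sq_ampRestrict,
    (measurePreserving_add_right volume x).setIntegral_image_emb hemb]
  congr 1
  refine integral_congr_ae (ae_restrict_of_ae ?_)
  have h3 := (quasiMeasurePreserving_add_right volume x).ae (ae_all_iff.2 (hVU x ψ))
  filter_upwards [h3] with y hy
  simp_rw [hy, add_sub_cancel_right]

/-- A measure given by a contraction-valued kernel is bounded and covariant. Both equivalences reduce
to pointwise statements: since `⟪ψ, τ(univ) ψ⟫` and `⟪ψ, P' ψ⟫` are the integrals of the local norms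
of the amplitudes and of the rescaled wave functions, of which the first is pointwise the smaller,
the operators agree if and only if these local norms agree almost everywhere. -/
theorem HasDensity.properties (hR : ∀ σ, MeasurableSet (R σ)) (hKm : ∀ γ σ, Measurable (K γ σ))
    (hK : IsContraction μ R K) {τ : Set (Spacetime d) → WaveSpace μ R →L[ℂ] WaveSpace μ R}
    (hτ : HasDensity τ K) :
    IsPOV τ ∧ τ Set.univ ≤ 1 ∧ IsCovariant τ ∧ (0 < τ Set.univ ↔ ¬ IsNull μ R K) ∧
      (τ Set.univ = acProjection μ R ↔ IsIsometric μ R K) := by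
  obtain ⟨V, hV, hi, hn, hVU⟩ := exists_kernel_amplitudes hR hKm hK
  have h := (hasDensity_iff hV).1 hτ
  have hpov := isPOV_of_operator h
  have hle : ∀ ψ : WaveSpace μ R, (fun k => ∑' γ, ‖momentumAmp K ψ γ k‖ ^ 2) ≤ᵐ[volume]
      fun k => ∑' σ, ‖rescaled ψ σ k‖ ^ 2 := fun ψ => by
    filter_upwards [ae_momentumAmp hR hK ψ] with k hk using hk.2.2
  have hint : ∀ ψ : WaveSpace μ R, inner ℂ ψ (τ Set.univ ψ) =
      ((∫ k, ∑' γ, ‖momentumAmp K ψ γ k‖ ^ 2 : ℝ) : ℂ) := fun ψ => by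
    rw [h _ .univ, norm_ampRestrict_univ, hn]
  refine ⟨hpov, le_one_of_operator (fun ψ => ?_) (h _ .univ), isCovariant_of_operator hR hVU h,
    ?_, ?_⟩
  · rw [hn]
    exact (integral_mono_ae (hi ψ) (integrable_tsum_rescaled hR ψ) (hle ψ)).trans
      (integral_tsum_rescaled_le hR ψ)
  · rw [(hpov.nonneg _ .univ).lt_iff_ne, ne_comm, not_iff_not, isNull_iff hR hK]
    have h0 : τ Set.univ = 0 ↔ ∀ ψ : WaveSpace μ R, inner ℂ ψ (τ Set.univ ψ) = (0 : ℂ) :=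
      ⟨fun h0 ψ => by rw [h0]; simp, fun h0 => ext_inner_self fun ψ => by rw [h0]; simp⟩
    rw [h0]
    refine forall_congr' fun ψ => ?_
    rw [hint, Complex.ofReal_eq_zero, integral_eq_zero_iff_of_nonneg
      (fun k => tsum_nonneg fun γ => by positivity) (hi ψ)]
    rfl
  · have h0 : τ Set.univ = acProjection μ R ↔ ∀ ψ : WaveSpace μ R,
        inner ℂ ψ (τ Set.univ ψ) = inner ℂ ψ (acProjection μ R ψ) :=
      ⟨fun h0 ψ => by rw [h0], ext_inner_self⟩
    rw [h0, isIsometric_iff hR hK]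
    refine forall_congr' fun ψ => ?_
    rw [hint, inner_acProjection hR, Complex.ofReal_inj,
      integral_eq_iff_of_ae_le (hi ψ) (integrable_tsum_rescaled hR ψ) (hle ψ)]
    rfl

end KernelMeasure

/-! ### The singular spectrum -/

section Singular

variable {d : ℕ} {ι : Type*} {μ : Measure (Spacetime d)} {R : ι → Set (Spacetime d)}

/-- Wave functions supported on a Lebesgue null set belong to the singular-spectrum subspace. -/
lemma mem_singularSubspace_of_ae (hR : ∀ σ, MeasurableSet (R σ)) {ψ : WaveSpace μ R}
    {N : Set (Spacetime d)} (hN : volume N = 0) (h : ∀ σ, ∀ᵐ k ∂μ, k ∉ N → wave ψ σ k = 0) :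
    ψ ∈ singularSubspace μ R := by
  refine (mem_vanishing_iff hR).2 fun σ => ?_
  have hN' : ∀ᵐ k ∂(volume : Measure (Spacetime d)), k ∉ N := measure_eq_zero_iff_ae_notMem.1 hN
  filter_upwards [ae_mono (Measure.withDensity_rnDeriv_le μ volume) (h σ),
    (withDensity_absolutelyContinuous volume (μ.rnDeriv volume)).ae_le hN'] with k h1 h2
  exact h1 h2

variable [NeZero d]

/-- On the singular-spectrum subspace the rescaled wave functions vanish almost everywhere, and with
them the amplitudes of a kernel for `τ`. -/
theorem apply_eq_zero_of_mem_singularSubspace [Countable ι] [SigmaFinite μ]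
    (hR : ∀ σ, MeasurableSet (R σ)) {τ : Set (Spacetime d) → WaveSpace μ R →L[ℂ] WaveSpace μ R}
    (hτ : IsPOV τ) (h1 : τ Set.univ ≤ 1) (hc : IsCovariant τ) {I : Set (Spacetime d)}
    (hI : MeasurableSet I) {ψ : WaveSpace μ R} (hψ : ψ ∈ singularSubspace μ R) : τ I ψ = 0 := by
  obtain ⟨K, -, -, hK⟩ := exists_contraction_kernel hR hτ h1 hc
  obtain ⟨Ψ, hΨ, -, -, hint⟩ := hK ψ
  have hamp : ∀ γ, momentumAmp K ψ γ =ᵐ[volume] 0 := by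
    intro γ
    have h2 : ∀ᵐ k ∂(volume : Measure (Spacetime d)), μ.rnDeriv volume k ≠ 0 →
        ∀ σ, wave ψ σ k = 0 :=
      (ae_withDensity_iff (Measure.measurable_rnDeriv μ volume)).1
        (ae_all_iff.2 ((mem_vanishing_iff hR).1 hψ))
    filter_upwards [h2] with k hk
    refine (tsum_congr fun σ => ?_).trans tsum_zero
    by_cases h0 : μ.rnDeriv volume k = 0
    · rw [rescaled_of_rnDeriv_eq_zero ψ σ h0, mul_zero]
    · rw [rescaled_eq, hk h0, mul_zero, mul_zero]
  have hΨ0 : ∀ γ, Ψ γ =ᵐ[volume] 0 := by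
    intro γ
    have h3 : IsAmplitude K ψ fun γ => ampFourier d ℕ 0 γ :=
      isAmplitude_of_ae_eq fun γ => (Lp.coeFn_zero ℂ 2 volume).trans (hamp γ).symm
    refine (hΨ.ae_eq h3 γ).trans ?_
    rw [map_zero]
    exact Lp.coeFn_zero ℂ 2 volume
  refine eq_zero_of_quadForm_eq_zero (hτ.nonneg I hI) ?_
  rw [quadForm, hint I hI, Complex.ofReal_re]
  refine integral_eq_zero_of_ae (ae_restrict_of_ae ?_)
  filter_upwards [ae_all_iff.2 hΨ0] with x hx
  simp [hx]

lemma eq_zero_of_forall_phase_eq_one {k : Spacetime d} (h : ∀ x, phase x k = 1) : k = 0 := by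
  by_contra hk
  have hk2 : ‖k‖ ^ 2 ≠ 0 := by positivity
  have h1 := h (lower ((Real.pi / ‖k‖ ^ 2) • k))
  rw [phase_lower, inner_smul_right, real_inner_self_eq_norm_sq, div_mul_cancel₀ _ hk2,
    Complex.exp_pi_mul_I] at h1
  norm_num at h1

/-- An invariant vector only has the momentum `0`. -/
theorem mem_singularSubspace_of_invariant (hR : ∀ σ, MeasurableSet (R σ)) {ψ : WaveSpace μ R}
    (hψ : ∀ x, translation μ R x ψ = ψ) : ψ ∈ singularSubspace μ R := by
  refine mem_singularSubspace_of_ae hR (N := {0}) (measure_singleton 0) fun σ => ?_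
  -- the phases at a countable dense set of translations determine all phases
  have h : ∀ n : ℕ, ∀ᵐ k ∂μ, wave ψ σ k =
      phase (TopologicalSpace.denseSeq (Spacetime d) n) k * wave ψ σ k := fun n => by
    have h1 := wave_translation hR (TopologicalSpace.denseSeq (Spacetime d) n) ψ σ
    rwa [hψ] at h1
  filter_upwards [ae_all_iff.2 h] with k hk hk0
  by_contra hne
  refine hk0 (eq_zero_of_forall_phase_eq_one fun x => ?_)
  refine (TopologicalSpace.denseRange_denseSeq (Spacetime d)).induction_on
    (p := fun x => phase x k = 1) x (isClosed_eq (continuous_phase_left k) continuous_const)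
    fun n => ?_
  exact mul_right_cancel₀ hne ((hk n).symm.trans (one_mul _).symm)

lemma minkowski_self_eq (k : Spacetime d) :
    minkowski k k = k 0 ^ 2 - ∑ α ∈ Finset.univ.erase 0, k α ^ 2 := by
  rw [minkowski, ← Finset.add_sum_erase _ _ (Finset.mem_univ (0 : Fin d)), sub_eq_add_neg,
    ← Finset.sum_neg_distrib, lower_apply, if_pos rfl, sq]
  congr 1
  refine Finset.sum_congr rfl fun α hα => ?_
  rw [lower_apply, if_neg (Finset.ne_of_mem_erase hα)]
  ring

/-- Mass shells are null sets, since the translates of a mass shell in the direction of the energy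
are pairwise disjoint. -/
lemma volume_massShell (m : ℝ) :
    volume {k : Spacetime d | 0 < k 0 ∧ minkowski k k = m ^ 2} = 0 := by
  set N := {k : Spacetime d | 0 < k 0 ∧ minkowski k k = m ^ 2}
  have hN : MeasurableSet N := by
    have h1 : Continuous fun k : Spacetime d => k 0 := by fun_prop
    have h2 : Continuous fun k : Spacetime d => minkowski k k := by
      simp_rw [minkowski_self_eq]; fun_prop
    exact (isOpen_lt continuous_const h1).measurableSet.inter
      (isClosed_eq h2 continuous_const).measurableSet
  let e : ℝ → Spacetime d := fun t => EuclideanSpace.single 0 t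
  have hdisj : Pairwise (Function.onFun Disjoint fun t => (fun k => k + e t) ⁻¹' N) := by
    intro s t hst
    refine Set.disjoint_left.2 fun k hs ht => hst ?_
    obtain ⟨hs1, hs2⟩ := hs
    obtain ⟨ht1, ht2⟩ := ht
    have h3 : ∀ (t : ℝ) (α : Fin d), α ∈ Finset.univ.erase 0 → (k + e t) α ^ 2 = k α ^ 2 := by
      intro t α hα
      simp [e, Finset.ne_of_mem_erase hα]
    have h4 : ∀ t : ℝ, (k + e t) 0 = k 0 + t := fun t => by simp [e]
    rw [minkowski_self_eq, Finset.sum_congr rfl (h3 _), h4] at hs2 ht2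
    rw [h4] at hs1 ht1
    have h5 : (k 0 + s) ^ 2 = (k 0 + t) ^ 2 := by linarith
    have h6 := (pow_left_inj₀ hs1.le ht1.le two_ne_zero).1 h5
    linarith
  by_contra hne
  have hc := Measure.countable_meas_pos_of_disjoint_iUnion (μ := (volume : Measure (Spacetime d)))
    (fun t => measurable_add_const (e t) hN) hdisj
  simp_rw [measure_preimage_add_right, pos_iff_ne_zero] at hc
  rw [show {_t : ℝ | volume N ≠ 0} = Set.univ from Set.eq_univ_of_forall fun _ => hne] at hc
  exact Cardinal.not_countable_real hc

theorem mem_singularSubspace_of_isOneParticleState (hR : ∀ σ, MeasurableSet (R σ)) {masses : Set ℝ}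
    (hm : masses.Countable) {ψ : WaveSpace μ R} (hψ : IsOneParticleState masses ψ) :
    ψ ∈ singularSubspace μ R := by
  refine mem_singularSubspace_of_ae hR
    (N := ⋃ m ∈ masses, {k : Spacetime d | 0 < k 0 ∧ minkowski k k = m ^ 2})
    ((measure_biUnion_null_iff hm).2 fun m _ => volume_massShell m) fun σ => ?_
  filter_upwards [(ae_restrict_iff' (hR σ)).1 (hψ σ)] with k hk hkN
  by_cases hkR : k ∈ R σ
  · rw [wave, Set.indicator_of_mem hkR]
    by_contra hne
    obtain ⟨h0, m, hmm, h1⟩ := hk hkR hne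
    exact hkN (Set.mem_biUnion hmm ⟨h0, h1⟩)
  · exact wave_of_notMem ψ hkR

end Singular

end CovariantPOV

end

theorem proposition3 {d : ℕ} [NeZero d] {ι : Type*} [Countable ι]
    (μ : MeasureTheory.Measure (CovariantPOV.Spacetime d)) [MeasureTheory.SigmaFinite μ]
    (R : ι → Set (CovariantPOV.Spacetime d)) (hR : ∀ σ, MeasurableSet (R σ)) :
    -- every bounded covariant POV measure has the stated form
    (∀ τ : Set (CovariantPOV.Spacetime d) →
        CovariantPOV.WaveSpace μ R →L[ℂ] CovariantPOV.WaveSpace μ R,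
      CovariantPOV.IsPOV τ → τ Set.univ ≤ 1 → CovariantPOV.IsCovariant τ →
        ∃ K : ℕ → ι → CovariantPOV.Spacetime d → ℂ, (∀ γ σ, Measurable (K γ σ)) ∧
          CovariantPOV.IsContraction μ R K ∧ CovariantPOV.HasDensity τ K) ∧
    -- every measurable contraction-valued `K` is admissible
    (∀ {Γ : Type*} [Countable Γ] (K : Γ → ι → CovariantPOV.Spacetime d → ℂ),
      (∀ γ σ, Measurable (K γ σ)) → CovariantPOV.IsContraction μ R K →
        (∃ τ : Set (CovariantPOV.Spacetime d) →
          CovariantPOV.WaveSpace μ R →L[ℂ] CovariantPOV.WaveSpace μ R,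
            CovariantPOV.HasDensity τ K) ∧
        ∀ τ : Set (CovariantPOV.Spacetime d) →
          CovariantPOV.WaveSpace μ R →L[ℂ] CovariantPOV.WaveSpace μ R,
            CovariantPOV.HasDensity τ K →
              CovariantPOV.IsPOV τ ∧ τ Set.univ ≤ 1 ∧ CovariantPOV.IsCovariant τ ∧
              (0 < τ Set.univ ↔ ¬ CovariantPOV.IsNull μ R K) ∧
              (τ Set.univ = CovariantPOV.acProjection μ R ↔ CovariantPOV.IsIsometric μ R K)) ∧
    -- a bounded covariant POV measure vanishes on the singular-spectrum subspace
    (∀ τ : Set (CovariantPOV.Spacetime d) →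
        CovariantPOV.WaveSpace μ R →L[ℂ] CovariantPOV.WaveSpace μ R,
      CovariantPOV.IsPOV τ → τ Set.univ ≤ 1 → CovariantPOV.IsCovariant τ →
        ∀ I, MeasurableSet I → ∀ ψ ∈ CovariantPOV.singularSubspace μ R, τ I ψ = 0) ∧
    -- which contains the vacuum and the one-particle states
    (∀ ψ : CovariantPOV.WaveSpace μ R, (∀ x, CovariantPOV.translation μ R x ψ = ψ) →
      ψ ∈ CovariantPOV.singularSubspace μ R) ∧
    (∀ masses : Set ℝ, masses.Countable → ∀ ψ : CovariantPOV.WaveSpace μ R,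
      CovariantPOV.IsOneParticleState masses ψ → ψ ∈ CovariantPOV.singularSubspace μ R) := by
  refine ⟨fun τ hτ h1 hc => CovariantPOV.exists_contraction_kernel hR hτ h1 hc,
    fun K hKm hK => ⟨CovariantPOV.exists_hasDensity hR hKm hK,
      fun τ hτ => hτ.properties hR hKm hK⟩,
    fun τ hτ h1 hc I hI ψ hψ =>
      CovariantPOV.apply_eq_zero_of_mem_singularSubspace hR hτ h1 hc hI hψ,
    fun ψ hψ => CovariantPOV.mem_singularSubspace_of_invariant hR hψ,
    fun masses hm ψ hψ => CovariantPOV.mem_singularSubspace_of_isOneParticleState hR hm hψ⟩
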